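/- Let $n\ge 1$, $N=2^n$, and let $f:\{0,1\}^n\to\mathbb Z_2$ mark exactly one item $x_0$, i.e. $f(x)=0$ if and only if $x=x_0$. Let $\mathcal O_f|x\rangle=(-1)^{f(x)}|x\rangle$, $|a\rangle=\frac1{\sqrt N}\sum_x|x\rangle$, $|b\rangle=\frac1{\sqrt N}\sum_x(-1)^{f(x)}|x\rangle$, let $|c\rangle$ be the normalization of $|a\rangle+|b\rangle$ and $\theta$ the angle between $|a\rangle$ and $|c\rangle$. Put $R=(I-2|b\rangle\langle b|)(I-2|a\rangle\langle a|)$ and $A=-\frac{4\theta i}{\sin 2\theta}\big(|a\rangle\langle b|-|b\rangle\langle a|\big)$. A circuit is a finite sequence of gates, each either a unitary on at most three qubits or one query (an application of $\mathcal O_f$ to $n$ of the qubits); it depends on $n$ (and the stated parameters) but not on $f$, and it may use work qubits that start in $|0\rangle$. Its time is the number of its gates, queries included. To implement an operator $M$ to precision $\varepsilon$ means to map $|\psi\rangle|0\cdots0\rangle$ to within $\varepsilon\|\psi\|$ of $(M|\psi\rangle)|0\cdots 0\rangle$ for all $\psi$. "Finds the marked item with probability $p$" means: run on $|0\cdots0\rangle$,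 a measurement of the search register gives $x_0$ with probability $p$. All constants are independent of $n$ and $f$. 1. The states are unit vectors, $|b\rangle=\mathcal O_f|a\rangle$, $|a\rangle+|b\rangle=\frac{2}{\sqrt N}|x_0\rangle$, so $|c\rangle=|x_0\rangle$. Moreover $\langle a|b\rangle=\cos2\theta=\frac{2-N}{N}$, $\sin2\theta=\frac{2\sqrt{N-1}}{N}$ and $\theta=\frac\pi2-\frac1{\sqrt N}+O(1/N)$. The states $|a\rangle$ and $|b\rangle$ are prepared exactly from $|0\cdots0\rangle$ by circuits of time $O(\log N)$. 2. (Method 2, Hamiltonian simulation of the computed generator.) $A$ is Hermitian, $e^{-iA}=R$ and $e^{-iA/4}|a\rangle=|x_0\rangle$. Preparing $|a\rangle$ and then applying any circuit that implements $e^{-iA/4}$ to precision $\varepsilon$ finds the marked item with probability at least $1-\varepsilon^2$. For every $t\in[0,1]$, $e^{-iAt}$ is implemented to precision $O(1/\sqrt N)$ by a circuit with $O(\sqrt N)$ queries and time $O(\sqrt N\log N)$. In particular, preparing $|a\rangle$ and simulating $e^{-iA/4}$ to precision $O(1/\sqrt N)$ finds the marked item with probability $1-O(1/N)$, with $O(\sqrt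 N)$ queries in time $O(\sqrt N\log N)$ in total. 3. (Method 3, $R^{1/4}$ by phase estimation.) For an $m$-qubit phase register let $\mathrm{PE}=(I\otimes \mathrm{QFT}^\dagger)\big(\sum_{k<2^m}R^k\otimes|k\rangle\langle k|\big)(I\otimes H^{\otimes m})$. Let $\tilde\theta_0=0$, $\tilde\theta_j=2\pi j/2^m-2\pi$ for $0<j<2^{m-1}$, and $\tilde\theta_j=2\pi j/2^m$ for $2^{m-1}\le j<2^m$ (the branch of the phases modulo $2\pi$ that matches the phases $4\theta$, $-4\theta$, $0$ of $R$, where $\pi<4\theta<2\pi$ for $N\geq 4$). Put $W_m=\mathrm{PE}^\dagger\big(I\otimes\sum_j e^{i\tilde\theta_j/4}|j\rangle\langle j|\big)\mathrm{PE}$. For every $\eta>0$ there are constants $L\ge1$ and $K$ such that, for all $n\ge2$ and all $m$ with $L\sqrt N\le 2^m\le 2L\sqrt N$ (phase precision of order $1/\sqrt N$), $\|W_m|a\rangle|0\rangle-|x_0\rangle|0\rangle\|\le\eta$, and some circuit, consisting of an exact preparation of $|a\rangle|0\rangle$ followed by an exact implementation of $W_m$, finds the marked item with probability at least $1-\eta$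 with at most $K\sqrt N$ queries in time at most $K\sqrt N\log N$. 4. (Method 4, repeated rotations.) Let $l$ be the solution of $(4l-1)/\sqrt N=(2m-\tfrac12)\pi$ with $m=1$, and $k=\lfloor l\rfloor$. Then $\|R^k|a\rangle-|x_0\rangle\|=O(1/\sqrt N)$, and some circuit, consisting of an exact preparation of $|a\rangle$ followed by an exact implementation of $R^k$, finds the marked item with probability $1-O(1/N)$, with $O(\sqrt N)$ queries in time $O(\sqrt N\log N)$. -/

import Mathlib

open scoped Kronecker

noncomputable section

namespace QSearch

/-! ### Registers, states and operators -/

/-- Basis labels of a register whose qubits are indexed by `Q`. -/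
abbrev Bits (Q : Type) : Type := Q → Bool

/-- Vectors of the Hilbert space of such a register, with the 2-norm. -/
abbrev QState (Q : Type) : Type := EuclideanSpace ℂ (Bits Q)

/-- Operators on the register, as matrices in the computational basis. -/
abbrev QOp (Q : Type) : Type := Matrix (Bits Q) (Bits Q) ℂ

/-- The basis state `|x⟩`. -/
def ket {Q : Type} [Fintype Q] [DecidableEq Q] (x : Bits Q) : QState Q :=
  EuclideanSpace.single x 1

/-- The basis state `|0…0⟩`. -/
def zeroState (Q : Type) [Fintype Q] [DecidableEq Q] : QState Q := ket fun _ => false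

/-- The result of applying the operator `M` to `ψ`. -/
def act {Q : Type} [Fintype Q] [DecidableEq Q] (M : QOp Q) (ψ : QState Q) : QState Q :=
  Matrix.toEuclideanLin M ψ

/-- The operator `|ψ⟩⟨χ|`. -/
def outer {Q : Type} (ψ χ : QState Q) : QOp Q :=
  Matrix.vecMulVec (fun x => ψ x) (fun x => star (χ x))

/-- The state `|ψ⟩ ⊗ |0…0⟩`, where the second register has the qubits `W`. -/
def withZeros {Q W : Type} [Fintype W] (ψ : QState Q) : QState (Q ⊕ W) :=
  WithLp.toLp 2 fun z => if ∀ w : W, z (Sum.inr w) = false then ψ (fun q => z (Sum.inl q)) else 0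

/-! ### The search problem and its two states -/

/-- `f` marks exactly the item `x₀`: `f x = 0` if and only if `x = x₀`. -/
def Marks {n : ℕ} (f : Bits (Fin n) → ZMod 2) (x₀ : Bits (Fin n)) : Prop :=
  ∀ x, f x = 0 ↔ x = x₀

/-- The sign `(-1) ^ f x`. -/
def sign {n : ℕ} (f : Bits (Fin n) → ZMod 2) (x : Bits (Fin n)) : ℂ := (-1) ^ (f x).val

/-- The oracle `O_f |x⟩ = (-1) ^ f x |x⟩`. -/
def oracleOp {n : ℕ} (f : Bits (Fin n) → ZMod 2) : QOp (Fin n) := Matrix.diagonal (sign f)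

/-- The uniform superposition `|a⟩` of all `N = 2 ^ n` basis states. -/
def aState (n : ℕ) : QState (Fin n) := WithLp.toLp 2 fun _ => 1 / (√(2 ^ n : ℝ) : ℂ)

/-- The signed superposition `|b⟩`. -/
def bState {n : ℕ} (f : Bits (Fin n) → ZMod 2) : QState (Fin n) :=
  WithLp.toLp 2 fun x => 1 / (√(2 ^ n : ℝ) : ℂ) * sign f x

/-- The normalization `|c⟩` of `|a⟩ + |b⟩`. -/
def cState {n : ℕ} (f : Bits (Fin n) → ZMod 2) : QState (Fin n) :=
  ((‖aState n + bState f‖⁻¹ : ℝ) : ℂ) • (aState n + bState f)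

/-- The angle `θ` between the real states `|a⟩` and `|c⟩`. -/
def theta {n : ℕ} (f : Bits (Fin n) → ZMod 2) : ℝ :=
  Real.arccos (inner ℂ (aState n) (cState f)).re

/-- The rotation `R_{4θ} = (I - 2|b⟩⟨b|)(I - 2|a⟩⟨a|)`. -/
def rot {n : ℕ} (f : Bits (Fin n) → ZMod 2) : QOp (Fin n) :=
  (1 - (2 : ℂ) • outer (bState f) (bState f)) * (1 - (2 : ℂ) • outer (aState n) (aState n))

/-- The generator `A = -(4 θ i / sin 2θ) (|a⟩⟨b| - |b⟩⟨a|)`. -/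
def gen {n : ℕ} (f : Bits (Fin n) → ZMod 2) : QOp (Fin n) :=
  (-(4 * (theta f : ℂ) * Complex.I / (Real.sin (2 * theta f) : ℂ))) •
    (outer (aState n) (bState f) - outer (bState f) (aState n))

/-- The evolution `e^{-i A t}`. -/
def evolution {n : ℕ} (f : Bits (Fin n) → ZMod 2) (t : ℝ) : QOp (Fin n) :=
  NormedSpace.exp ((-(Complex.I * (t : ℂ))) • gen f)

/-! ### Quantum circuits with an oracle -/

/-- A gate on the register with qubits `Q`: an arbitrary unitary on at most three chosen qubits, or
one query, that is, the oracle applied to `n` chosen qubits (in a chosen order). -/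
inductive Gate (n : ℕ) (Q : Type) : Type
  | loc (k : ℕ) (hk : k ≤ 3) (e : Fin k ↪ Q) (u : Matrix.unitaryGroup (Bits (Fin k)) ℂ)
  | query (e : Fin n ↪ Q)

/-- A circuit: its gates in the order in which they are applied. It does not depend on `f`. -/
abbrev Circuit (n : ℕ) (Q : Type) : Type := List (Gate n Q)

/-- The operator of a gate on the whole register, when the oracle is that of `f`. -/
def Gate.op {n : ℕ} {Q : Type} [Fintype Q] [DecidableEq Q]
    (f : Bits (Fin n) → ZMod 2) : Gate n Q → QOp Q
  | .loc _ _ e u => fun x y =>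
      if ∀ q, (∀ i, e i ≠ q) → x q = y q then u.1 (fun i => x (e i)) (fun i => y (e i)) else 0
  | .query e => Matrix.diagonal fun x => sign f fun i => x (e i)

/-- The operator of a circuit. -/
def circuitOp {n : ℕ} {Q : Type} [Fintype Q] [DecidableEq Q]
    (f : Bits (Fin n) → ZMod 2) : Circuit n Q → QOp Q
  | [] => 1
  | g :: c => circuitOp f c * g.op f

/-- The number of oracle queries of a circuit. -/
def queries {n : ℕ} {Q : Type} : Circuit n Q → ℕ
  | [] => 0
  | .loc _ _ _ _ :: c => queries c
  | .query _ :: c => queries c + 1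

/-- The running time of a circuit: the number of all its gates, queries included. -/
def time {n : ℕ} {Q : Type} (c : Circuit n Q) : ℕ := c.length

/-- Started in `|0…0⟩`, the circuit prepares `ψ`, and leaves the work qubits `W` in `|0…0⟩`. -/
def Prepares {n : ℕ} {Q W : Type} [Fintype Q] [DecidableEq Q] [Fintype W] [DecidableEq W]
    (c : Circuit n (Q ⊕ W)) (f : Bits (Fin n) → ZMod 2) (ψ : QState Q) : Prop :=
  act (circuitOp f c) (zeroState (Q ⊕ W)) = withZeros ψ

/-- With work qubits `W` that start in `|0…0⟩`, the circuit implements the operator `M` to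
precision `ε` (and returns the work qubits to `|0…0⟩` to the same precision). -/
def Implements {n : ℕ} {Q W : Type} [Fintype Q] [DecidableEq Q] [Fintype W] [DecidableEq W]
    (c : Circuit n (Q ⊕ W)) (f : Bits (Fin n) → ZMod 2) (M : QOp Q) (ε : ℝ) : Prop :=
  ∀ ψ : QState Q,
    ‖act (circuitOp f c) (withZeros ψ) - withZeros (act M ψ)‖ ≤ ε * ‖ψ‖

/-- The probability that, after the circuit was run on `|0…0⟩`, measuring the qubits `d 0, d 1, …`
in the computational basis yields `x₀`. -/
def findProb {n : ℕ} {Q : Type} [Fintype Q] [DecidableEq Q]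
    (c : Circuit n Q) (d : Fin n → Q) (f : Bits (Fin n) → ZMod 2) (x₀ : Bits (Fin n)) : ℝ :=
  ∑ z : Bits Q, if (fun i => z (d i)) = x₀
    then ‖act (circuitOp f c) (zeroState Q) z‖ ^ 2 else 0

/-! ### Powers of a unitary by quantum phase estimation -/

/-- The Hadamard transformation of `m` qubits. -/
def hadamardOp (m : ℕ) : QOp (Fin m) := fun j k =>
  1 / (√(2 ^ m : ℝ) : ℂ) * ∏ i, if j i && k i then -1 else 1

/-- The quantum Fourier transform of `m` qubits; `Nat.ofBits j` is the number with the binary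
digits `j`. -/
def qftOp (m : ℕ) : QOp (Fin m) := fun j k =>
  1 / (√(2 ^ m : ℝ) : ℂ) *
    Complex.exp (2 * Real.pi * Complex.I * (Nat.ofBits j : ℂ) * (Nat.ofBits k : ℂ) / 2 ^ m)

/-- The controlled powers `|ψ⟩|k⟩ ↦ U ^ k |ψ⟩|k⟩`. -/
def controlledPow {X : Type} [Fintype X] [DecidableEq X] (m : ℕ) (U : Matrix X X ℂ) :
    Matrix (X × Bits (Fin m)) (X × Bits (Fin m)) ℂ := fun p q =>
  if p.2 = q.2 then (U ^ Nat.ofBits p.2) p.1 q.1 else 0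

/-- Phase estimation of `U` with `m` bits: Hadamard transformation of the phase register,
controlled powers of `U`, inverse Fourier transform of the phase register. -/
def phaseEstimation {X : Type} [Fintype X] [DecidableEq X] (m : ℕ) (U : Matrix X X ℂ) :
    Matrix (X × Bits (Fin m)) (X × Bits (Fin m)) ℂ :=
  ((1 : Matrix X X ℂ) ⊗ₖ (qftOp m).conjTranspose) * controlledPow m U *
    ((1 : Matrix X X ℂ) ⊗ₖ hadamardOp m)

/-- The phase that an outcome `j` of phase estimation of `R_{4θ}` stands for. The phases of
`R_{4θ}` are `4θ`, `-4θ` and `0` with `π < 4θ < 2π`, so the outcome, which determines a phase modulo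
`2π`, is read in `(-2π, -π) ∪ {0} ∪ [π, 2π)`. -/
def phaseValue (m : ℕ) (j : Bits (Fin m)) : ℝ :=
  if Nat.ofBits j = 0 then 0
  else if 2 * Nat.ofBits j < 2 ^ m then 2 * Real.pi * Nat.ofBits j / 2 ^ m - 2 * Real.pi
  else 2 * Real.pi * Nat.ofBits j / 2 ^ m

/-- The implementation of `R_{4θ} ^ t` by phase estimation: estimate the phase, multiply
by `e^{i θ̃ t}`, undo the estimation. It acts on the search register and the phase register. -/
def phasePower {n : ℕ} (m : ℕ) (f : Bits (Fin n) → ZMod 2) (t : ℝ) : QOp (Fin n ⊕ Fin m) :=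
  ((phaseEstimation m (rot f)).conjTranspose *
    ((1 : QOp (Fin n)) ⊗ₖ
      Matrix.diagonal fun j => Complex.exp (Complex.I * (phaseValue m j : ℂ) * (t : ℂ))) *
    phaseEstimation m (rot f)).submatrix
      (Equiv.sumArrowEquivProdArrow (Fin n) (Fin m) Bool)
      (Equiv.sumArrowEquivProdArrow (Fin n) (Fin m) Bool)

end QSearch

end

open QSearch

/-! Everything happens in the plane spanned by |x₀⟩ and the uniform superposition of the unmarked
items. There |a⟩ and |b⟩ are mirror images in |x₀⟩, at angle θ to it with cos θ = 1/√N, and R, a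
product of two reflections, is a rotation by 4θ. Its eigenvectors in the plane, `eigState x₀ (±i)`,
have eigenvalues e^{±4iθ}, and A has the eigenvalues ∓4θ on them. Hence R and e^{-iAt} both belong
to the one-parameter group `rotBy` (`rot_eq_rotBy`, `evolution_eq_rotBy`), and |a⟩ goes to |x₀⟩
under the rotation by θ.

Hamiltonian simulation and repeated rotations thus become approximations of an angle modulo 2π. Put
δ = 2π - 4θ, which is of order 1/√N. Up to full turns R rotates by -δ, so O(√N) powers of R come
within δ of every angle (`exists_rot_pow_near_evolution`, `norm_rot_pow_floor_sub_le`). Rotations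
are Lipschitz in the angle, and a norm error ε costs at most ε² in probability
(`one_sub_sq_le_findProb`).

For phase estimation, an eigenvector turns the phase register into geometric sums, so the chord
between true and estimated phase times the amplitude is at most 2/2^m. Outcomes read in the right
branch have an error of the quarter phase no larger than that chord. Outcomes read in the wrong
branch lie across the phase 0, at distance at least δ, and form a tail of size O(1/L) once 2^m δ ≥ L
(`phaseError_le`). A large L makes the total small.

On the circuit side, `Realizes` is a calculus of exact implementations with clean work qubits. R
takes two queries and O(n) gates (`realizes_rot`), because its reflections are conjugates of a phase
on |0…0⟩, which a ladder of three-qubit gates applies (`exists_ladder`). Its controlled powers, the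
Fourier transform and the diagonal phase factors complete the circuit for `phasePower`
(`realizes_phasePower`). -/

noncomputable section

namespace QSearch

open Matrix

set_option linter.unusedSectionVars false

/-! ### Operators on some of the qubits -/

section Lift

variable {Q R S : Type} [Fintype Q] [DecidableEq Q] [Fintype R] [DecidableEq R]
  [Fintype S] [DecidableEq S]

/-- The operator `u`, applied to the qubits chosen by `e`. -/
def lift (e : R ↪ Q) (u : QOp R) : QOp Q := fun x y =>
  if ∀ q, (∀ i, e i ≠ q) → x q = y q then u (fun i => x (e i)) (fun i => y (e i)) else 0

lemma extend_apply_embedding (e : R ↪ Q) (s : Bits R) (x : Bits Q) (i : R) :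
    Function.extend e s x (e i) = s i := e.injective.extend_apply s x i

lemma extend_apply_of_ne (e : R ↪ Q) (s : Bits R) (x : Bits Q) (q : Q) (h : ∀ i, e i ≠ q) :
    Function.extend e s x q = x q :=
  Function.extend_apply' _ _ _ fun ⟨i, hi⟩ => h i hi

lemma eq_extend_iff (e : R ↪ Q) (s : Bits R) (x y : Bits Q) :
    y = Function.extend e s x ↔
      (∀ q, (∀ i, e i ≠ q) → x q = y q) ∧ (fun i => y (e i)) = s := by
  constructor
  · rintro rfl
    exact ⟨fun q hq => (extend_apply_of_ne e s x q hq).symm,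
      funext fun i => extend_apply_embedding e s x i⟩
  · rintro ⟨h1, rfl⟩
    funext q
    by_cases hq : ∃ i, e i = q
    · obtain ⟨i, rfl⟩ := hq
      rw [extend_apply_embedding]
    · rw [extend_apply_of_ne e _ x q fun i hi => hq ⟨i, hi⟩]
      exact (h1 q fun i hi => hq ⟨i, hi⟩).symm

/-- A string that agrees with `x` off the range of `e` is determined by its bits on that range. This
turns matrix products of lifted operators into sums over the small register. -/
lemma sum_agree (e : R ↪ Q) (x : Bits Q) (g : Bits Q → ℂ) :
    ∑ y, (if ∀ q, (∀ i, e i ≠ q) → x q = y q then g y else 0) =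
      ∑ s : Bits R, g (Function.extend e s x) := by
  rw [← Finset.sum_filter]
  symm
  refine Finset.sum_bij' (fun s _ => Function.extend e s x) (fun y _ i => y (e i)) ?_ ?_ ?_ ?_ ?_
  · intro s _
    simpa using fun q hq => (extend_apply_of_ne e s x q hq).symm
  · simp
  · intro s _
    funext i
    simp [extend_apply_embedding]
  · intro y hy
    exact ((eq_extend_iff e _ x y).2 ⟨by simpa using hy, rfl⟩).symm
  · simp

lemma lift_mul (e : R ↪ Q) (u v : QOp R) : lift e (u * v) = lift e u * lift e v := by
  ext x y
  have h : (lift e u * lift e v) x y = ∑ z, (if ∀ q, (∀ i, e i ≠ q) → x q = z q then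
      u (fun i => x (e i)) (fun i => z (e i)) * lift e v z y else 0) := by
    simp only [Matrix.mul_apply, lift, ite_mul, zero_mul]
  rw [h, sum_agree e x fun z => u (fun i => x (e i)) (fun i => z (e i)) * lift e v z y]
  have key : ∀ s : Bits R, lift e v (Function.extend e s x) y =
      if ∀ q, (∀ i, e i ≠ q) → x q = y q then v s (fun i => y (e i)) else 0 := by
    intro s
    simp only [lift, extend_apply_embedding]
    congr 1
    refine propext (forall_congr' fun q => forall_congr' fun hq => ?_)
    rw [extend_apply_of_ne e s x q hq]
  simp only [key, extend_apply_embedding]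
  simp only [lift, Matrix.mul_apply]
  split_ifs <;> simp

lemma lift_diagonal (e : R ↪ Q) (d : Bits R → ℂ) :
    lift e (diagonal d) = diagonal fun x => d fun i => x (e i) := by
  ext x y
  by_cases hxy : x = y
  · subst hxy; simp [lift]
  · rw [diagonal_apply_ne _ hxy, lift]
    split_ifs with h
    · rw [diagonal_apply_ne]
      intro hs
      refine hxy (funext fun q => ?_)
      by_cases hq : ∃ i, e i = q
      · obtain ⟨i, rfl⟩ := hq
        exact congrFun hs i
      · exact h q fun i hi => hq ⟨i, hi⟩
    · rfl

lemma lift_one (e : R ↪ Q) : lift e (1 : QOp R) = 1 := by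
  rw [← diagonal_one, lift_diagonal, diagonal_one]

lemma lift_conjTranspose (e : R ↪ Q) (u : QOp R) : lift e uᴴ = (lift e u)ᴴ := by
  ext x y
  simp only [lift, conjTranspose_apply, apply_ite (star : ℂ → ℂ), star_zero]
  congr 1
  exact propext (forall_congr' fun q => forall_congr' fun _ => eq_comm)

lemma lift_lift (e : R ↪ Q) (e' : S ↪ R) (u : QOp S) :
    lift e (lift e' u) = lift (e'.trans e) u := by
  ext x y
  simp only [lift, Function.Embedding.trans_apply, ← ite_and]
  congr 1
  refine propext ⟨fun ⟨h1, h2⟩ q hq => ?_, fun h => ⟨fun q hq => h q fun i => hq _,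
    fun q hq => h _ fun i hi => hq i (e.injective hi)⟩⟩
  by_cases hr : ∃ i, e i = q
  · obtain ⟨i, rfl⟩ := hr
    exact h2 i fun j hj => hq j (by rw [hj])
  · exact h1 q fun i hi => hr ⟨i, hi⟩

end Lift

/-! ### Gates and circuits -/

section Circuits

variable {n : ℕ} {Q R : Type} [Fintype Q] [DecidableEq Q] [Fintype R] [DecidableEq R]

lemma sign_mul_self (f : Bits (Fin n) → ZMod 2) (x : Bits (Fin n)) : sign f x * sign f x = 1 := by
  rw [sign, ← mul_pow]; simp

lemma star_sign (f : Bits (Fin n) → ZMod 2) (x : Bits (Fin n)) : star (sign f x) = sign f x := by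
  simp [sign]

lemma Gate.op_loc (f : Bits (Fin n) → ZMod 2) (k : ℕ) (hk : k ≤ 3) (e : Fin k ↪ Q)
    (u : Matrix.unitaryGroup (Bits (Fin k)) ℂ) :
    (Gate.loc (n := n) k hk e u).op f = lift e u.1 := by
  ext x y
  simp only [Gate.op, lift]
  congr

lemma Gate.op_query (f : Bits (Fin n) → ZMod 2) (e : Fin n ↪ Q) :
    (Gate.query e).op f = lift e (oracleOp f) := by
  rw [oracleOp, lift_diagonal]; rfl

/-- The inverse of a gate. -/
def Gate.inv : Gate n Q → Gate n Q
  | .loc k hk e u => .loc k hk e (star u)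
  | .query e => .query e

lemma oracleOp_conjTranspose (f : Bits (Fin n) → ZMod 2) : (oracleOp f)ᴴ = oracleOp f := by
  rw [oracleOp, diagonal_conjTranspose]
  congr 1
  funext x
  exact star_sign f x

lemma oracleOp_mul_self (f : Bits (Fin n) → ZMod 2) : oracleOp f * oracleOp f = 1 := by
  rw [oracleOp, diagonal_mul_diagonal, ← diagonal_one]
  congr 1
  funext x
  exact sign_mul_self f x

lemma Gate.op_inv (f : Bits (Fin n) → ZMod 2) (g : Gate n Q) : g.inv.op f = (g.op f)ᴴ := by
  cases g with
  | loc k hk e u => rw [Gate.inv, Gate.op_loc, Gate.op_loc, ← lift_conjTranspose]; rfl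
  | query e => rw [Gate.inv, Gate.op_query, ← lift_conjTranspose, oracleOp_conjTranspose]

lemma Gate.op_conjTranspose_mul_self (f : Bits (Fin n) → ZMod 2) (g : Gate n Q) :
    (g.op f)ᴴ * g.op f = 1 := by
  cases g with
  | loc k hk e u =>
    rw [Gate.op_loc, ← lift_conjTranspose, ← lift_mul]
    rw [show (u.1)ᴴ * u.1 = 1 from Matrix.mem_unitaryGroup_iff'.1 u.2, lift_one]
  | query e =>
    rw [Gate.op_query, ← lift_conjTranspose, ← lift_mul, oracleOp_conjTranspose,
      oracleOp_mul_self, lift_one]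

lemma circuitOp_append (f : Bits (Fin n) → ZMod 2) (c d : Circuit n Q) :
    circuitOp f (c ++ d) = circuitOp f d * circuitOp f c := by
  induction c with
  | nil => simp [circuitOp]
  | cons g c ih => simp [circuitOp, ih, Matrix.mul_assoc]

lemma queries_append (c d : Circuit n Q) : queries (c ++ d) = queries c + queries d := by
  induction c with
  | nil => simp [queries]
  | cons g c ih => cases g <;> simp [queries, ih]; omega

lemma circuitOp_conjTranspose_mul_self (f : Bits (Fin n) → ZMod 2) (c : Circuit n Q) :
    (circuitOp f c)ᴴ * circuitOp f c = 1 := by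
  induction c with
  | nil => simp [circuitOp]
  | cons g c ih =>
    rw [circuitOp, conjTranspose_mul, Matrix.mul_assoc, ← Matrix.mul_assoc (circuitOp f c)ᴴ, ih,
      Matrix.one_mul, Gate.op_conjTranspose_mul_self]

/-- The inverse circuit. -/
def invCircuit (c : Circuit n Q) : Circuit n Q := (c.map Gate.inv).reverse

lemma circuitOp_invCircuit (f : Bits (Fin n) → ZMod 2) (c : Circuit n Q) :
    circuitOp f (invCircuit c) = (circuitOp f c)ᴴ := by
  induction c with
  | nil => simp [circuitOp, invCircuit]
  | cons g c ih =>
    rw [invCircuit] at ih ⊢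
    rw [List.map_cons, List.reverse_cons, circuitOp_append, ih, circuitOp, circuitOp, circuitOp,
      conjTranspose_mul, Matrix.one_mul, Gate.op_inv]

lemma queries_invCircuit (c : Circuit n Q) : queries (invCircuit c) = queries c := by
  induction c with
  | nil => rfl
  | cons g c ih =>
    rw [invCircuit] at ih ⊢
    rw [List.map_cons, List.reverse_cons, queries_append, ih]
    cases g <;> rfl

/-- The gate, moved to other qubits. -/
def Gate.lift (e : R ↪ Q) : Gate n R → Gate n Q
  | .loc k hk e' u => .loc k hk (e'.trans e) u
  | .query e' => .query (e'.trans e)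

lemma Gate.op_lift (f : Bits (Fin n) → ZMod 2) (e : R ↪ Q) (g : Gate n R) :
    (g.lift e).op f = QSearch.lift e (g.op f) := by
  cases g with
  | loc k hk e' u => rw [Gate.lift, Gate.op_loc, Gate.op_loc, lift_lift]
  | query e' => rw [Gate.lift, Gate.op_query, Gate.op_query, lift_lift]

lemma circuitOp_map_lift (f : Bits (Fin n) → ZMod 2) (e : R ↪ Q) (c : Circuit n R) :
    circuitOp f (c.map (Gate.lift e)) = lift e (circuitOp f c) := by
  induction c with
  | nil => simp [circuitOp, lift_one]
  | cons g c ih => rw [List.map_cons, circuitOp, ih, circuitOp, lift_mul, Gate.op_lift]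

lemma queries_map_lift (e : R ↪ Q) (c : Circuit n R) :
    queries (c.map (Gate.lift e)) = queries c := by
  induction c with
  | nil => rfl
  | cons g c ih => cases g <;> simp [queries, Gate.lift, ih]

end Circuits

/-! ### Work qubits -/

section Pad

variable {n : ℕ} {Q W : Type} [Fintype Q] [DecidableEq Q] [Fintype W] [DecidableEq W]

/-- The isometry `|ψ⟩ ↦ |ψ⟩|0…0⟩`. -/
def pad (Q W : Type) [Fintype Q] [DecidableEq Q] [Fintype W] [DecidableEq W] :
    Matrix (Bits (Q ⊕ W)) (Bits Q) ℂ :=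
  fun z x => if z = Sum.elim x (fun _ => false) then 1 else 0

lemma eq_elim_iff (z : Bits (Q ⊕ W)) (x : Bits Q) :
    z = Sum.elim x (fun _ => false) ↔
      x = (fun q => z (Sum.inl q)) ∧ ∀ w, z (Sum.inr w) = false := by
  constructor
  · rintro rfl; simp
  · rintro ⟨rfl, h⟩
    funext q
    cases q with
    | inl q => rfl
    | inr w => exact h w

lemma mul_pad {X : Type} (M : Matrix X (Bits (Q ⊕ W)) ℂ) (z : X) (x : Bits Q) :
    (M * pad Q W) z x = M z (Sum.elim x fun _ => false) := by
  simp [Matrix.mul_apply, pad]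

lemma pad_mul {X : Type} (M : Matrix (Bits Q) X ℂ) (z : Bits (Q ⊕ W)) (x : X) :
    (pad Q W * M) z x =
      if ∀ w, z (Sum.inr w) = false then M (fun q => z (Sum.inl q)) x else 0 := by
  simp only [Matrix.mul_apply, pad, eq_elim_iff]
  split_ifs with h <;> simp [h]

lemma pad_mulVec (ψ : QState Q) :
    WithLp.toLp 2 (pad Q W *ᵥ ψ.ofLp) = (withZeros ψ : QState (Q ⊕ W)) := by
  ext z
  simp only [Matrix.mulVec, dotProduct, pad, eq_elim_iff, withZeros]
  split_ifs with h <;> simp [h]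

lemma pad_conjTranspose_mul_self : (pad Q W)ᴴ * pad Q W = 1 := by
  ext x y
  rw [mul_pad, conjTranspose_apply, pad]
  by_cases h : x = y
  · subst h; simp
  · have : ¬ (Sum.elim y (fun _ : W => false) = Sum.elim x fun _ => false) := by
      intro he
      exact h (funext fun q => (congrFun he (Sum.inl q)).symm)
    simp [h, this]

lemma lift_inl_mul_pad (M : QOp Q) :
    (lift Function.Embedding.inl M : QOp (Q ⊕ W)) * pad Q W = pad Q W * M := by
  ext z x
  rw [mul_pad, pad_mul, lift]
  simp only [Function.Embedding.inl_apply, Sum.elim_inl]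
  congr 1
  refine propext ⟨fun h w => ?_, fun h q hq => ?_⟩
  · simpa using h (Sum.inr w) (by simp)
  · cases q with
    | inl q => exact absurd rfl (hq q)
    | inr w => simpa using h w

lemma act_act (M M' : QOp Q) (ψ : QState Q) : act M (act M' ψ) = act (M * M') ψ := by
  simp [act, Matrix.toLpLin_apply]

/-- Intertwining with `pad` is exact implementation with clean work qubits, written as a matrix
identity that can be composed without estimates. -/
lemma act_withZeros {U : QOp (Q ⊕ W)} {M : QOp Q} (h : U * pad Q W = pad Q W * M)
    (ψ : QState Q) : act U (withZeros ψ) = withZeros (act M ψ) := by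
  rw [← pad_mulVec, ← pad_mulVec, act, act, Matrix.toLpLin_apply, Matrix.toLpLin_apply]
  simp only [Matrix.mulVec_mulVec, h]

/-- Some circuit with `v` work qubits, at most `q` queries and at most `t` gates implements the
operators `M f` exactly. -/
def Realizes (v : ℕ) (M : (Bits (Fin n) → ZMod 2) → QOp Q) (q t : ℕ) : Prop :=
  ∃ c : Circuit n (Q ⊕ Fin v), queries c ≤ q ∧ time c ≤ t ∧
    ∀ f, circuitOp f c * pad Q (Fin v) = pad Q (Fin v) * M f

variable {v : ℕ} {M M' : (Bits (Fin n) → ZMod 2) → QOp Q} {q q' t t' : ℕ}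

lemma Realizes.mono (h : Realizes v M q t) (hq : q ≤ q') (ht : t ≤ t') : Realizes v M q' t' := by
  obtain ⟨c, h1, h2, h3⟩ := h
  exact ⟨c, h1.trans hq, h2.trans ht, h3⟩

lemma Realizes.congr (h : Realizes v M q t) (hM : ∀ f, M f = M' f) : Realizes v M' q t := by
  rwa [← funext hM]

/-- Work qubits come back to zero, so the second circuit reuses those of the first: the costs add up
and `v` does not grow. -/
lemma Realizes.mul (h' : Realizes v M' q' t') (h : Realizes v M q t) :
    Realizes v (fun f => M' f * M f) (q' + q) (t' + t) := by
  obtain ⟨c, h1, h2, h3⟩ := h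
  obtain ⟨c', h1', h2', h3'⟩ := h'
  refine ⟨c ++ c', ?_, ?_, fun f => ?_⟩
  · rw [queries_append]; omega
  · simp only [time, List.length_append] at *; omega
  · rw [circuitOp_append, Matrix.mul_assoc, h3, ← Matrix.mul_assoc, h3', Matrix.mul_assoc]

lemma realizes_one : Realizes v (fun _ : Bits (Fin n) → ZMod 2 => (1 : QOp Q)) 0 0 :=
  ⟨[], by simp [queries], by simp [time], fun f => by simp [circuitOp]⟩

lemma Realizes.pow (h : Realizes v M q t) (k : ℕ) :
    Realizes v (fun f => M f ^ k) (k * q) (k * t) := by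
  induction k with
  | zero => simpa using realizes_one
  | succ k ih =>
    simp only [pow_succ, Nat.succ_mul]
    exact ih.mul h

/-- Since `pad` is an isometry, an operator implemented exactly by a unitary is unitary. This later
gives the unitarity of `rot f` without computing it. -/
lemma conjTranspose_mul_self_of_pad {U : QOp (Q ⊕ W)} {N : QOp Q} (hU : Uᴴ * U = 1)
    (h : U * pad Q W = pad Q W * N) : Nᴴ * N = 1 := by
  calc Nᴴ * N = Nᴴ * ((pad Q W)ᴴ * pad Q W) * N := by
        rw [pad_conjTranspose_mul_self, Matrix.mul_one]
    _ = (pad Q W * N)ᴴ * (pad Q W * N) := by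
        rw [conjTranspose_mul]; simp only [Matrix.mul_assoc]
    _ = (pad Q W)ᴴ * (Uᴴ * U) * pad Q W := by
        rw [← h, conjTranspose_mul]; simp only [Matrix.mul_assoc]
    _ = 1 := by rw [hU, Matrix.mul_one, pad_conjTranspose_mul_self]

lemma Realizes.conjTranspose_mul_self (h : Realizes v M q t) (f : Bits (Fin n) → ZMod 2) :
    (M f)ᴴ * M f = 1 := by
  obtain ⟨c, -, -, h3⟩ := h
  exact conjTranspose_mul_self_of_pad (circuitOp_conjTranspose_mul_self f c) (h3 f)

lemma Realizes.conjTranspose (h : Realizes v M q t) : Realizes v (fun f => (M f)ᴴ) q t := by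
  have hM := h.conjTranspose_mul_self
  obtain ⟨c, h1, h2, h3⟩ := h
  refine ⟨invCircuit c, by rwa [queries_invCircuit], by simpa [invCircuit, time] using h2,
    fun f => ?_⟩
  rw [circuitOp_invCircuit]
  -- Finite dimension upgrades the left inverse to a two-sided one, so every padded state is the
  -- image of a padded state.
  have h4 : M f * (M f)ᴴ = 1 := mul_eq_one_comm.1 (hM f)
  calc (circuitOp f c)ᴴ * pad Q (Fin v)
      = (circuitOp f c)ᴴ * (pad Q (Fin v) * M f) * (M f)ᴴ := by
        rw [Matrix.mul_assoc, Matrix.mul_assoc, h4, Matrix.mul_one]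
    _ = (circuitOp f c)ᴴ * circuitOp f c * pad Q (Fin v) * (M f)ᴴ := by
        rw [← h3]; simp only [Matrix.mul_assoc]
    _ = pad Q (Fin v) * (M f)ᴴ := by
        rw [circuitOp_conjTranspose_mul_self, Matrix.one_mul]

lemma realizes_circuitOp (v : ℕ) (c : Circuit n Q) :
    Realizes v (fun f => circuitOp f c) (queries c) (time c) :=
  ⟨c.map (Gate.lift Function.Embedding.inl), (queries_map_lift _ _).le, by simp [time],
    fun f => by rw [circuitOp_map_lift, lift_inl_mul_pad]⟩

lemma realizes_lift_circuitOp {R : Type} [Fintype R] [DecidableEq R] (v : ℕ) (e : R ↪ Q)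
    (c : Circuit n R) : Realizes v (fun f => lift e (circuitOp f c)) (queries c) (time c) :=
  ((realizes_circuitOp v (c.map (Gate.lift e))).congr fun f => circuitOp_map_lift f e c).mono
    (queries_map_lift _ _).le (by simp [time])

lemma Realizes.prod {ι : Type} {N : ι → (Bits (Fin n) → ZMod 2) → QOp Q} {a b : ι → ℕ}
    (l : List ι) (h : ∀ i ∈ l, Realizes v (N i) (a i) (b i)) :
    Realizes v (fun f => (l.map fun i => N i f).prod) (l.map a).sum (l.map b).sum := by
  induction l with
  | nil => simpa using realizes_one
  | cons i l ih =>
    simp only [List.map_cons, List.prod_cons, List.sum_cons]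
    exact (h i (by simp)).mul (ih fun j hj => h j (by simp [hj]))

end Pad

/-! ### Elementary gates -/

section ElementaryGates

variable {n : ℕ} {Q : Type} [Fintype Q] [DecidableEq Q]

lemma queries_cons (g : Gate n Q) (c : Circuit n Q) :
    queries (g :: c) = queries [g] + queries c := queries_append [g] c

lemma diagonal_mem_unitaryGroup {X : Type} [Fintype X] [DecidableEq X] (d : X → ℂ)
    (hd : ∀ s, ‖d s‖ = 1) : diagonal d ∈ Matrix.unitaryGroup X ℂ := by
  rw [Matrix.mem_unitaryGroup_iff, star_eq_conjTranspose, diagonal_conjTranspose,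
    diagonal_mul_diagonal, ← diagonal_one]
  congr 1
  funext s
  simp [Complex.mul_conj, Complex.normSq_eq_norm_sq, hd]

lemma exists_phase_gate (q : Q) (d : Bool → ℂ) (hd : ∀ a, ‖d a‖ = 1) :
    ∃ g : Gate n Q, queries [g] = 0 ∧ ∀ f, g.op f = diagonal fun x => d (x q) := by
  refine ⟨.loc 1 (by norm_num) ⟨fun _ => q, fun i j _ => Subsingleton.elim i j⟩
    ⟨diagonal fun s => d (s 0), diagonal_mem_unitaryGroup _ fun _ => hd _⟩, rfl, fun f => ?_⟩
  rw [Gate.op_loc, lift_diagonal]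
  rfl

lemma injective_pair {p q : Q} (h : p ≠ q) : Function.Injective ![p, q] := by
  intro i j hij
  fin_cases i <;> fin_cases j <;> simp_all

lemma injective_triple {p q r : Q} (h : p ≠ q) (h' : p ≠ r) (h'' : q ≠ r) :
    Function.Injective ![p, q, r] := by
  intro i j hij
  fin_cases i <;> fin_cases j <;> simp_all

lemma exists_phase_gate₂ {p q : Q} (hpq : p ≠ q) (d : Bool → Bool → ℂ)
    (hd : ∀ a b, ‖d a b‖ = 1) :
    ∃ g : Gate n Q, queries [g] = 0 ∧ ∀ f, g.op f = diagonal fun x => d (x p) (x q) := by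
  refine ⟨.loc 2 (by norm_num) ⟨![p, q], injective_pair hpq⟩
    ⟨diagonal fun s => d (s 0) (s 1), diagonal_mem_unitaryGroup _ fun _ => hd _ _⟩, rfl,
    fun f => ?_⟩
  rw [Gate.op_loc, lift_diagonal]
  rfl

/-- Conjugating by an involutive permutation of the basis keeps an operator diagonal. This is the
compute, phase, uncompute pattern. -/
lemma one_submatrix_conjTranspose_mul {X : Type} [Fintype X] [DecidableEq X] {T : X → X}
    (hT : Function.Involutive T) (d : X → ℂ) :
    (1 : Matrix X X ℂ).submatrix T id * diagonal d * (1 : Matrix X X ℂ).submatrix T id =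
      diagonal fun x => d (T x) := by
  ext x y
  rw [Matrix.mul_apply]
  rw [Finset.sum_eq_single (T x)]
  · simp [mul_diagonal, one_apply, hT x, diagonal_apply]
  · intro z _ hz
    simp [mul_diagonal, one_apply, hz.symm]
  · simp

lemma one_submatrix_mem_unitaryGroup {X : Type} [Fintype X] [DecidableEq X] {T : X → X}
    (hT : Function.Involutive T) :
    (1 : Matrix X X ℂ).submatrix T id ∈ Matrix.unitaryGroup X ℂ := by
  rw [Matrix.mem_unitaryGroup_iff]
  have h : star ((1 : Matrix X X ℂ).submatrix T id) = (1 : Matrix X X ℂ).submatrix T id := by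
    ext x y
    simp only [star_apply, submatrix_apply, id, one_apply]
    have : T y = x ↔ T x = y := ⟨fun h => by rw [← h, hT], fun h => by rw [← h, hT]⟩
    simp [this]
  have h' := one_submatrix_conjTranspose_mul hT fun _ => (1 : ℂ)
  rw [diagonal_one, Matrix.mul_one] at h'
  rw [h, h']

/-- Add a function of two bits to a third one. -/
def xorBit (h : Bool → Bool → Bool) (p q t : Q) (x : Bits Q) : Bits Q :=
  Function.update x t (xor (x t) (h (x p) (x q)))

lemma xorBit_involutive (h : Bool → Bool → Bool) {p q t : Q} (hp : p ≠ t) (hq : q ≠ t) :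
    Function.Involutive (xorBit h p q t) := by
  intro x
  simp [xorBit, Function.update_of_ne hp, Function.update_of_ne hq]

lemma exists_xor_gate (h : Bool → Bool → Bool) {p q t : Q} (hpq : p ≠ q) (hp : p ≠ t)
    (hq : q ≠ t) : ∃ g : Gate n Q, queries [g] = 0 ∧
      ∀ f, g.op f = (1 : QOp Q).submatrix (xorBit h p q t) id := by
  refine ⟨.loc 3 le_rfl ⟨![p, q, t], injective_triple hpq hp hq⟩
    ⟨(1 : QOp (Fin 3)).submatrix (xorBit h 0 1 2) id,
      one_submatrix_mem_unitaryGroup (xorBit_involutive h (by decide) (by decide))⟩, rfl,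
    fun f => ?_⟩
  rw [Gate.op_loc]
  ext x y
  simp only [lift, submatrix_apply, id, one_apply, ← ite_and]
  congr 1
  refine propext ⟨fun ⟨h1, h2⟩ => ?_, ?_⟩
  · have h0 := congrFun h2 0
    have h1' := congrFun h2 1
    have h2' := congrFun h2 2
    simp [xorBit] at h0 h1' h2'
    funext r
    by_cases hr : r = t
    · subst hr; simpa [xorBit] using h2'
    · rw [xorBit, Function.update_of_ne hr]
      by_cases hr1 : r = p
      · subst hr1; exact h0
      by_cases hr2 : r = q
      · subst hr2; exact h1'
      refine h1 r fun i hi => ?_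
      fin_cases i
      · exact hr1 (by simpa using hi.symm)
      · exact hr2 (by simpa using hi.symm)
      · exact hr (by simpa using hi.symm)
  · rintro rfl
    refine ⟨fun r hr => ?_, ?_⟩
    · rw [xorBit, Function.update_of_ne]
      rintro rfl
      exact hr 2 rfl
    · funext i
      fin_cases i <;> simp [xorBit, Function.update_of_ne hp, Function.update_of_ne hq]

/-- The entries of the Hadamard matrix of one qubit. -/
def hEntry (a b : Bool) : ℂ := 1 / ((√2 : ℝ) : ℂ) * if a && b then -1 else 1

lemma inv_sqrt_two_mul_self : (((√2 : ℝ) : ℂ))⁻¹ * (((√2 : ℝ) : ℂ))⁻¹ = 1 / 2 := by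
  rw [← mul_inv, ← Complex.ofReal_mul, Real.mul_self_sqrt (by norm_num)]
  norm_num

lemma hEntry_mem_unitaryGroup :
    (Matrix.of fun s s' => hEntry (s 0) (s' 0)) ∈ Matrix.unitaryGroup (Bits (Fin 1)) ℂ := by
  rw [Matrix.mem_unitaryGroup_iff]
  ext s s'
  rw [Matrix.mul_apply, ← (Equiv.funUnique (Fin 1) Bool).symm.sum_comp]
  have hs : s = s' ↔ s 0 = s' 0 := ⟨fun h => by rw [h], fun h => funext fun i => by
    rw [Subsingleton.elim i 0, h]⟩
  have key := inv_sqrt_two_mul_self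
  simp only [star_apply, of_apply, one_apply, hs, Fintype.sum_bool, hEntry]
  cases s 0 <;> cases s' 0 <;> simp [key]
  all_goals norm_num

/-- The operator of one qubit with the entries `h`, applied to the qubit `q`. -/
def qubitOp (q : Q) (h : Bool → Bool → ℂ) : QOp Q :=
  Matrix.of fun x y => if ∀ p, p ≠ q → x p = y p then h (x q) (y q) else 0

lemma exists_hadamard_gate (q : Q) : ∃ g : Gate n Q, queries [g] = 0 ∧
    ∀ f, g.op f = qubitOp q hEntry := by
  refine ⟨.loc 1 (by norm_num) ⟨fun _ => q, fun i j _ => Subsingleton.elim i j⟩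
    ⟨_, hEntry_mem_unitaryGroup⟩, rfl, fun f => ?_⟩
  rw [Gate.op_loc]
  ext x y
  simp only [lift, qubitOp, of_apply]
  congr 1
  refine propext (forall_congr' fun p => ?_)
  exact ⟨fun h hp => h fun _ => hp.symm, fun h hp => h (hp 0).symm⟩

lemma qubitOp_mul (q : Q) (h : Bool → Bool → ℂ) (M : QOp Q) (x y : Bits Q) :
    (qubitOp q h * M) x y =
      ∑ b, h (x q) b * M (Function.update x q b) y := by
  simp only [Matrix.mul_apply, qubitOp, of_apply, ite_mul, zero_mul]
  rw [← Finset.sum_filter]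
  refine Finset.sum_bij' (fun z _ => z q) (fun b _ => Function.update x q b) ?_ ?_ ?_ ?_ ?_
  · simp
  · intro b _
    simp +contextual
  · intro z hz
    funext p
    by_cases hp : p = q
    · subst hp; simp
    · rw [Function.update_of_ne hp]
      exact (Finset.mem_filter.1 hz).2 p hp
  · simp
  · intro z hz
    congr 2
    funext p
    by_cases hp : p = q
    · subst hp; simp
    · rw [Function.update_of_ne hp]
      exact ((Finset.mem_filter.1 hz).2 p hp).symm

end ElementaryGates

/-! ### Diagonal operators -/

section Diagonal

variable {n v : ℕ} {Q : Type} [Fintype Q] [DecidableEq Q]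

/-- Work qubit `i` is a flag that records whether a mismatch with the pattern has occurred so far.
Each entry of `l` computes the next flag into a fresh work qubit, the last flag controls the phase,
and the same gates in reverse order clear the flags. The circuit is diagonal on all states; its
entries are needed only where the qubits after `i` are zero. -/
lemma exists_ladder {u : ℂ} (hu : ‖u‖ = 1) (l : List (Q × Bool)) :
    ∀ (i : ℕ) (hi : i + l.length < v), ∃ (c : Circuit n (Q ⊕ Fin v)) (d : Bits (Q ⊕ Fin v) → ℂ),
      queries c = 0 ∧ c.length = 2 * l.length + 1 ∧ (∀ f, circuitOp f c = diagonal d) ∧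
      ∀ z, (∀ j : Fin v, i < j → z (Sum.inr j) = false) →
        d z = if z (Sum.inr ⟨i, by omega⟩) = false ∧ ∀ p ∈ l, z (Sum.inl p.1) = p.2
          then u else 1 := by
  induction l with
  | nil =>
    intro i hi
    obtain ⟨g, hg, hop⟩ := exists_phase_gate (n := n) (Sum.inr ⟨i, by simpa using hi⟩ : Q ⊕ Fin v)
      (fun a => if a = false then u else 1) (fun a => by cases a <;> simp [hu])
    refine ⟨[g], _, hg, by simp, fun f => by rw [circuitOp, circuitOp, hop, Matrix.one_mul],
      fun z _ => by simp⟩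
  | cons p l ih =>
    intro i hi
    rw [List.length_cons] at hi
    obtain ⟨c, d, hc, hlen, hop, hd⟩ := ih (i + 1) (by omega)
    set w : Q ⊕ Fin v := Sum.inr ⟨i, by omega⟩ with hw
    set t : Q ⊕ Fin v := Sum.inr ⟨i + 1, by omega⟩ with ht
    have hwt : w ≠ t := by simp [hw, ht]
    have hpt : Sum.inl p.1 ≠ t := by simp [ht]
    -- The new flag is the old flag or a mismatch at the qubit `p.1`; xor into a zero qubit stores
    -- it.
    obtain ⟨g, hg, hgop⟩ := exists_xor_gate (n := n) (fun a b => b || (a != p.2))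
      (p := Sum.inl p.1) (q := w) (t := t) (by simp [hw]) hpt hwt
    refine ⟨g :: (c ++ [g]), fun z => d (xorBit (fun a b => b || (a != p.2)) (Sum.inl p.1) w t z),
      ?_, ?_, fun f => ?_, fun z hz => ?_⟩
    · rw [queries_cons, queries_append, hg, hc]
    · simp [hlen]; ring
    · rw [circuitOp, circuitOp_append, circuitOp, circuitOp, hop, hgop, Matrix.one_mul,
        one_submatrix_conjTranspose_mul (xorBit_involutive _ hpt hwt)]
    · have hz1 : z t = false := hz _ (by simp)
      dsimp only
      rw [hd]
      · have h1 : xorBit (fun a b => b || (a != p.2)) (Sum.inl p.1) w t z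
            t = (z w || (z (Sum.inl p.1) != p.2)) := by
          rw [xorBit, Function.update_self, hz1]; simp
        have h2 : ∀ q : Q, xorBit (fun a b => b || (a != p.2)) (Sum.inl p.1) w t z
            (Sum.inl q) = z (Sum.inl q) := fun q => by
          rw [xorBit, Function.update_of_ne]; simp [ht]
        simp only [h1, h2, Bool.or_eq_false_iff, bne_eq_false_iff_eq, List.forall_mem_cons,
          and_assoc]
      · intro j hj
        rw [xorBit, Function.update_of_ne]
        · exact hz j (by omega)
        · intro h
          have := congrArg Fin.val (Sum.inr_injective h)
          simp at this
          omega

lemma realizes_pattern_phase {u : ℂ} (hu : ‖u‖ = 1) (l : List (Q × Bool)) (hl : l.length < v) :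
    Realizes v (fun _ : Bits (Fin n) → ZMod 2 =>
      (diagonal fun x => if ∀ p ∈ l, x p.1 = p.2 then u else 1 : QOp Q)) 0
      (2 * l.length + 1) := by
  obtain ⟨c, d, hc, hlen, hop, hd⟩ := exists_ladder (n := n) hu l 0 (by simpa using hl)
  refine ⟨c, hc.le, hlen.le, fun f => ?_⟩
  ext z x
  rw [hop, mul_pad, pad_mul, diagonal_apply]
  simp only [eq_elim_iff, diagonal_apply]
  by_cases hz : ∀ w, z (Sum.inr w) = false
  · rw [hd z fun j _ => hz j]
    simp only [hz, implies_true, and_true, true_and, if_true]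
    congr 1
    exact propext eq_comm
  · simp [hz]

lemma realizes_embedded_pattern_phase {u : ℂ} (hu : ‖u‖ = 1) {r : ℕ} (e : Fin r ↪ Q)
    (s : Bits (Fin r)) (hr : r < v) :
    Realizes v (fun _ : Bits (Fin n) → ZMod 2 =>
      (diagonal fun x => if (fun i => x (e i)) = s then u else 1 : QOp Q)) 0 (2 * r + 1) := by
  refine ((realizes_pattern_phase (n := n) hu (List.ofFn fun i => (e i, s i))
    (by rwa [List.length_ofFn])).congr fun f => ?_).mono le_rfl (by rw [List.length_ofFn])
  congr 1
  funext x
  congr 1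
  simp [List.mem_ofFn, funext_iff]

lemma list_prod_diagonal {X ι : Type} [Fintype X] [DecidableEq X] (l : List ι)
    (d : ι → X → ℂ) :
    (l.map fun i => diagonal (d i)).prod = diagonal fun x => (l.map fun i => d i x).prod := by
  induction l with
  | nil => simp
  | cons i l ih => simp [ih]

/-- One pattern phase for each of the `2 ^ r` strings. The exponential cost is affordable because
this is used on the phase register, whose dimension is of order √N. -/
lemma realizes_diagonal {r : ℕ} (e : Fin r ↪ Q) (d : Bits (Fin r) → ℂ) (hd : ∀ s, ‖d s‖ = 1)
    (hr : r < v) :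
    Realizes v (fun _ : Bits (Fin n) → ZMod 2 =>
      (diagonal fun x => d fun i => x (e i) : QOp Q)) 0 (2 ^ r * (2 * r + 1)) := by
  refine ((Realizes.prod (Finset.univ : Finset (Bits (Fin r))).toList fun s _ =>
    realizes_embedded_pattern_phase (n := n) (hd s) e s hr).congr fun f => ?_).mono ?_ ?_
  · rw [list_prod_diagonal]
    congr 1
    funext x
    rw [Finset.prod_map_toList]
    simp
  · simp
  · simp

end Diagonal

/-! ### Layers of Hadamard gates and the Fourier transform -/

section Layers

variable {n m : ℕ}

/-- The first bits, up to `a`, of `x`, followed by those of `y`. -/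
def mixBits (a : Fin m) (x y : Bits (Fin m)) : Bits (Fin m) := fun i => if i ≤ a then x i else y i

/-- The operator of a sequence of layers: in the layer `a`, a Hadamard gate on the qubit `a`
is followed by the diagonal operator `g a`. -/
def layersOp (g : Fin m → Bits (Fin m) → ℂ) : QOp (Fin m) := fun x y =>
  ∏ a, hEntry (x a) (y a) * g a (mixBits a x y)

/-- Each qubit passes through exactly one Hadamard gate, so exactly one path leads from the input
`y` to the output `x`: after the layer `a` the basis state is `mixBits a x y`. Matrix entries are
therefore products rather than sums over paths. -/
lemma exists_layers (g : Fin m → Bits (Fin m) → ℂ) (b : ℕ)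
    (hg : ∀ a, ∃ c : Circuit n (Fin m), queries c = 0 ∧ c.length ≤ b ∧
      ∀ f, circuitOp f c = diagonal (g a)) :
    ∃ c : Circuit n (Fin m), queries c = 0 ∧ c.length ≤ m * (b + 1) ∧
      ∀ f, circuitOp f c = layersOp g := by
  -- After `s` layers, the qubits from `s` on are untouched and the layers below `s` have
  -- contributed their factors.
  have key : ∀ s ≤ m, ∃ c : Circuit n (Fin m), queries c = 0 ∧ c.length ≤ s * (b + 1) ∧
      ∀ f, circuitOp f c = Matrix.of fun x y => if ∀ i : Fin m, s ≤ i → x i = y i then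
        ∏ a ∈ Finset.univ.filter fun a : Fin m => (a : ℕ) < s,
          hEntry (x a) (y a) * g a (mixBits a x y) else 0 := by
    intro s
    induction s with
    | zero =>
      refine fun _ => ⟨[], rfl, by simp, fun f => ?_⟩
      ext x y
      simp [circuitOp, one_apply, funext_iff]
    | succ s ih =>
      intro hs
      obtain ⟨c, hc, hlen, hop⟩ := ih (by omega)
      obtain ⟨c', hc', hlen', hop'⟩ := hg ⟨s, by omega⟩
      obtain ⟨h, hh, hhop⟩ := exists_hadamard_gate (n := n) (⟨s, by omega⟩ : Fin m)
      refine ⟨c ++ h :: c', ?_, ?_, fun f => ?_⟩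
      · rw [queries_append, queries_cons, hc, hh, hc']
      · rw [List.length_append, List.length_cons, Nat.succ_mul]; omega
      · rw [circuitOp_append, circuitOp, hop', hhop, hop, Matrix.mul_assoc]
        ext x y
        rw [diagonal_mul, qubitOp_mul]
        simp only [of_apply]
        set q : Fin m := ⟨s, by omega⟩ with hq
        have hcond : ∀ b, (∀ i : Fin m, s ≤ i → Function.update x q b i = y i) ↔
            b = y q ∧ ∀ i : Fin m, s + 1 ≤ i → x i = y i := by
          intro b
          constructor
          · intro h
            refine ⟨by simpa using h q le_rfl, fun i hi => ?_⟩
            have := h i (by omega)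
            rwa [Function.update_of_ne] at this
            intro hiq
            rw [hiq] at hi
            simp [hq] at hi
          · rintro ⟨rfl, h⟩ i hi
            by_cases hiq : i = q
            · subst hiq; simp
            · rw [Function.update_of_ne hiq]
              refine h i ?_
              have : (i : ℕ) ≠ s := fun h => hiq (Fin.ext h)
              omega
        simp only [hcond]
        by_cases hxy : ∀ i : Fin m, s + 1 ≤ i → x i = y i
        · simp only [eq_true hxy, and_true, if_true, mul_ite, mul_zero]
          rw [Finset.sum_ite_eq' Finset.univ (y q)]
          have hfilter : (Finset.univ.filter fun a : Fin m => (a : ℕ) < s + 1) =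
              insert q (Finset.univ.filter fun a : Fin m => (a : ℕ) < s) := by
            ext a
            simp only [Finset.mem_filter, Finset.mem_univ, true_and, Finset.mem_insert,
              Fin.ext_iff, hq]
            omega
          have hmix : mixBits q x y = x := by
            funext i
            rw [mixBits]
            split_ifs with hi
            · rfl
            · refine (hxy i ?_).symm
              rw [Fin.le_def, hq] at hi
              simp at hi
              omega
          rw [hfilter, Finset.prod_insert (by simp [hq]), hmix, if_pos (Finset.mem_univ _)]
          have hprod : ∀ a ∈ Finset.univ.filter (fun a : Fin m => (a : ℕ) < s),
              hEntry (Function.update x q (y q) a) (y a) *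
                g a (mixBits a (Function.update x q (y q)) y) =
              hEntry (x a) (y a) * g a (mixBits a x y) := by
            intro a ha
            have has : (a : ℕ) < s := by simpa using ha
            have haq : ∀ i : Fin m, i ≤ a → i ≠ q := by
              rintro i hi rfl
              rw [Fin.le_def, hq] at hi
              simp at hi
              omega
            have hmixa : mixBits a (Function.update x q (y q)) y = mixBits a x y := by
              funext i
              simp only [mixBits]
              split_ifs with hi
              · rw [Function.update_of_ne (haq i hi)]
              · rfl
            rw [hmixa, Function.update_of_ne (haq a le_rfl)]
          rw [Finset.prod_congr rfl hprod]
          ring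
        · simp [eq_false hxy, -Order.add_one_le_iff]
  obtain ⟨c, hc, hlen, hop⟩ := key m le_rfl
  refine ⟨c, hc, hlen, fun f => ?_⟩
  rw [hop]
  ext x y
  rw [of_apply, if_pos fun i hi => absurd i.2 (by omega), layersOp]
  congr 1
  ext a
  simp

lemma inv_sqrt_two_pow (m : ℕ) :
    (1 / ((√2 : ℝ) : ℂ)) ^ m = 1 / ((√(2 ^ m : ℝ) : ℝ) : ℂ) := by
  rw [Real.sqrt_eq_rpow, Real.sqrt_eq_rpow, ← Real.rpow_natCast_mul (by norm_num), mul_comm,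
    Real.rpow_mul_natCast (by norm_num)]
  push_cast
  rw [div_pow, one_pow]

lemma layersOp_one : layersOp (fun _ _ => 1) = hadamardOp m := by
  ext x y
  simp only [layersOp, hadamardOp, hEntry, mul_one]
  rw [Finset.prod_mul_distrib, Finset.prod_const, Finset.card_univ, Fintype.card_fin,
    inv_sqrt_two_pow]

lemma exists_hadamard_circuit (n m : ℕ) : ∃ c : Circuit n (Fin m), queries c = 0 ∧ c.length ≤ m ∧
    ∀ f, circuitOp f c = hadamardOp m := by
  obtain ⟨c, h1, h2, h3⟩ := exists_layers (n := n) (m := m) (fun _ _ => 1) 0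
    fun a => ⟨[], rfl, le_rfl, fun f => by simp [circuitOp]⟩
  exact ⟨c, h1, by simpa using h2, fun f => by rw [h3, layersOp_one]⟩

end Layers

/-! ### The quantum Fourier transform as a circuit, up to the order of the bits. -/

section Fourier

variable {n m : ℕ}

lemma ofBits_eq_sum (j : Bits (Fin m)) : Nat.ofBits j = ∑ i : Fin m, (j i).toNat * 2 ^ (i : ℕ) := by
  induction m with
  | zero => simp
  | succ m ih =>
    rw [Nat.ofBits_succ, ih, Fin.sum_univ_succ, Finset.mul_sum, add_comm]
    congr 1
    · simp
    · refine Finset.sum_congr rfl fun i _ => ?_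
      simp only [Function.comp_apply, Fin.val_succ]
      ring

/-- The phase between the output bit `a` and the input bit `b` in the Fourier transform. -/
def fourierPhase (a b : ℕ) (s t : Bool) : ℂ :=
  if s && t then Complex.exp (2 * Real.pi * Complex.I * (2 ^ a / 2 ^ (b + 1))) else 1

lemma norm_fourierPhase (a b : ℕ) (s t : Bool) : ‖fourierPhase a b s t‖ = 1 := by
  rw [fourierPhase]
  split_ifs
  · rw [show 2 * (Real.pi : ℂ) * Complex.I * (2 ^ a / 2 ^ (b + 1)) =
      ((2 * Real.pi * (2 ^ a / 2 ^ (b + 1)) : ℝ) : ℂ) * Complex.I by push_cast; ring]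
    exact Complex.norm_exp_ofReal_mul_I _
  · simp

/-- The phases that follow the Hadamard gate on the qubit `a` in the Fourier transform. -/
def fourierLayer (a : Fin m) (x : Bits (Fin m)) : ℂ :=
  ∏ b : Fin m, if a < b then fourierPhase a b (x a) (x b) else 1

lemma exists_fourierLayer_circuit (a : Fin m) : ∃ c : Circuit n (Fin m), queries c = 0 ∧
    c.length ≤ m ∧ ∀ f, circuitOp f c = diagonal (fourierLayer a) := by
  have key : ∀ l : List (Fin m), ∃ c : Circuit n (Fin m), queries c = 0 ∧ c.length ≤ l.length ∧
      ∀ f, circuitOp f c = diagonal fun x =>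
        (l.map fun b : Fin m => if a < b then fourierPhase a b (x a) (x b) else 1).prod := by
    intro l
    induction l with
    | nil => exact ⟨[], rfl, by simp, fun f => by simp [circuitOp]⟩
    | cons b l ih =>
      obtain ⟨c, hc, hlen, hop⟩ := ih
      by_cases hab : a < b
      · obtain ⟨g, hg, hgop⟩ := exists_phase_gate₂ (n := n) hab.ne (fourierPhase a b)
          (norm_fourierPhase _ _)
        refine ⟨g :: c, by rw [queries_cons, hg, hc], by simpa using hlen, fun f => ?_⟩
        rw [circuitOp, hgop, hop, diagonal_mul_diagonal]
        congr 1
        funext x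
        simp [hab, mul_comm]
      · refine ⟨c, hc, hlen.trans (by simp), fun f => ?_⟩
        rw [hop]
        simp [hab]
  obtain ⟨c, hc, hlen, hop⟩ := key Finset.univ.toList
  refine ⟨c, hc, by simpa using hlen, fun f => ?_⟩
  rw [hop]
  congr 1
  funext x
  rw [Finset.prod_map_toList, fourierLayer]

/-- Expanding both numbers in binary, with the bits of `k` reversed, the pair of bits `a`, `b`
contributes the phase 2π · 2^a / 2^(b+1). For b < a it is a multiple of 2π, for b = a it is the sign
of the Hadamard gate, and for b > a it is a controlled phase. -/
lemma qftOp_eq_layersOp : qftOp m = (layersOp fourierLayer).submatrix id fun k i => k i.rev := by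
  ext j k
  have hk : (Nat.ofBits k : ℂ) = ∑ b : Fin m, ((k b.rev).toNat : ℂ) * 2 ^ (b.rev : ℕ) := by
    rw [ofBits_eq_sum, ← Equiv.sum_comp Fin.revPerm]
    push_cast
    rfl
  have hj : (Nat.ofBits j : ℂ) = ∑ a : Fin m, ((j a).toNat : ℂ) * 2 ^ (a : ℕ) := by
    rw [ofBits_eq_sum]; push_cast; rfl
  have hterm : 2 * Real.pi * Complex.I * (Nat.ofBits j : ℂ) * (Nat.ofBits k : ℂ) / 2 ^ m =
      ∑ a : Fin m, ∑ b : Fin m, 2 * Real.pi * Complex.I *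
        (((j a).toNat : ℂ) * ((k b.rev).toNat : ℂ) * (2 ^ (a : ℕ) / 2 ^ ((b : ℕ) + 1))) := by
    rw [hj, hk, mul_assoc, Finset.sum_mul_sum, Finset.mul_sum, Finset.sum_div]
    refine Finset.sum_congr rfl fun a _ => ?_
    rw [Finset.mul_sum, Finset.sum_div]
    refine Finset.sum_congr rfl fun b _ => ?_
    have hb : (2 : ℂ) ^ m = 2 ^ (b.rev : ℕ) * 2 ^ ((b : ℕ) + 1) := by
      rw [← pow_add, Fin.val_rev]
      congr 1
      omega
    rw [hb]
    field_simp
  simp only [submatrix_apply, id, qftOp, layersOp]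
  have hconst : (1 / ((√2 : ℝ) : ℂ)) ^ m = ∏ _a : Fin m, 1 / ((√2 : ℝ) : ℂ) := by simp
  rw [hterm, Complex.exp_sum, ← inv_sqrt_two_pow, hconst, ← Finset.prod_mul_distrib]
  refine Finset.prod_congr rfl fun a _ => ?_
  rw [hEntry, mul_assoc (1 / ((√2 : ℝ) : ℂ)), Complex.exp_sum]
  congr 1
  have hfac : ∀ b : Fin m, Complex.exp (2 * Real.pi * Complex.I *
      (((j a).toNat : ℂ) * ((k b.rev).toNat : ℂ) * (2 ^ (a : ℕ) / 2 ^ ((b : ℕ) + 1)))) =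
      (if a = b then (if j a && k b.rev then -1 else 1) else 1) *
        if a < b then fourierPhase a b (j a) (k b.rev) else 1 := by
    intro b
    cases j a
    · simp [fourierPhase]
    cases k b.rev
    · simp [fourierPhase]
    rcases lt_trichotomy a b with h | h | h
    · simp [fourierPhase, h, h.ne]
    · subst h
      simp only [Bool.toNat_true, Nat.cast_one, one_mul, if_true, Bool.and_self, lt_irrefl,
        if_false, mul_one]
      rw [pow_succ, show 2 * (Real.pi : ℂ) * Complex.I * (2 ^ (a : ℕ) / (2 ^ (a : ℕ) * 2)) =
        Real.pi * Complex.I by field_simp, Complex.exp_pi_mul_I]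
    · have hpow : (2 : ℂ) ^ (a : ℕ) = 2 ^ ((a : ℕ) - (b : ℕ) - 1) * 2 ^ ((b : ℕ) + 1) := by
        rw [← pow_add]
        congr 1
        have : (b : ℕ) < a := h
        omega
      simp only [Bool.toNat_true, Nat.cast_one, one_mul, h.ne', h.not_gt, if_false]
      rw [hpow, mul_div_assoc, div_self (pow_ne_zero _ two_ne_zero), mul_one,
        Complex.exp_eq_one_iff]
      exact ⟨2 ^ ((a : ℕ) - (b : ℕ) - 1), by push_cast; ring⟩
  rw [Finset.prod_congr rfl fun b _ => hfac b, Finset.prod_mul_distrib,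
    Finset.prod_ite_eq Finset.univ a, if_pos (Finset.mem_univ _), fourierLayer]
  congr 1
  refine Finset.prod_congr rfl fun b _ => ?_
  split_ifs with h
  · simp [mixBits, h.not_ge]
  · rfl

lemma exists_fourierLayers_circuit (n m : ℕ) : ∃ c : Circuit n (Fin m), queries c = 0 ∧
    c.length ≤ m * (m + 1) ∧ ∀ f, circuitOp f c = layersOp fourierLayer :=
  exists_layers _ m fun a => exists_fourierLayer_circuit a

/-- Circuits are unitary, so no sum over roots of unity is needed. -/
lemma fourierLayers_mul_conjTranspose :
    (layersOp fourierLayer : QOp (Fin m)) * (layersOp fourierLayer)ᴴ = 1 := by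
  obtain ⟨c, -, -, hop⟩ := exists_fourierLayers_circuit 0 m
  have := circuitOp_conjTranspose_mul_self (fun _ => 0) c
  rw [hop] at this
  exact mul_eq_one_comm.1 this

/-- The reversal of the order of bits. -/
def revBits (m : ℕ) : Bits (Fin m) ≃ Bits (Fin m) := Fin.revPerm.arrowCongr (Equiv.refl Bool)

lemma qftOp_eq_submatrix_revBits :
    qftOp m = (layersOp fourierLayer).submatrix id (revBits m) := qftOp_eq_layersOp

/-- The bit reversal is never carried out: around a diagonal operator it only permutes the diagonal
entries. -/
lemma qftOp_mul_diagonal_mul (d : Bits (Fin m) → ℂ) :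
    qftOp m * diagonal d * (qftOp m)ᴴ =
      layersOp fourierLayer * diagonal (fun j => d ((revBits m).symm j)) *
        (layersOp fourierLayer)ᴴ := by
  have hd : diagonal d =
      (diagonal fun j => d ((revBits m).symm j)).submatrix (revBits m) (revBits m) := by
    rw [submatrix_diagonal_equiv]
    congr 1
    funext x
    simp
  rw [hd, qftOp_eq_submatrix_revBits, conjTranspose_submatrix, submatrix_mul_equiv,
    submatrix_mul_equiv, submatrix_id_id]

lemma qftOp_mul_conjTranspose : qftOp m * (qftOp m)ᴴ = 1 := by
  have := qftOp_mul_diagonal_mul (m := m) fun _ => 1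
  rwa [diagonal_one, Matrix.mul_one, Matrix.mul_one, fourierLayers_mul_conjTranspose] at this

lemma hadamardOp_conjTranspose : (hadamardOp m)ᴴ = hadamardOp m := by
  ext j k
  simp only [conjTranspose_apply, hadamardOp, star_mul', star_prod]
  congr 1
  · simp
  · refine Finset.prod_congr rfl fun i _ => ?_
    rw [Bool.and_comm]
    split_ifs <;> simp

lemma hadamardOp_mul_self : hadamardOp m * hadamardOp m = 1 := by
  obtain ⟨c, -, -, hop⟩ := exists_hadamard_circuit 0 m
  have := circuitOp_conjTranspose_mul_self (fun _ => 0) c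
  rwa [hop, hadamardOp_conjTranspose] at this

end Fourier

/-! ### The rotation -/

section Rotation

variable {n v : ℕ}

/-- The phase `-1` for the basis state `|0…0⟩`. -/
def zeroPhase (n : ℕ) : QOp (Fin n) := diagonal fun x => if x = fun _ => false then -1 else 1

lemma zeroPhase_eq :
    zeroPhase n = 1 - (2 : ℂ) • Matrix.single (fun _ => false) (fun _ => false) 1 := by
  ext x y
  simp only [zeroPhase, diagonal_apply, Matrix.sub_apply, Matrix.smul_apply, one_apply,
    single_apply, smul_eq_mul]
  by_cases h : x = y
  · subst h
    by_cases h' : x = fun _ => false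
    · rw [if_pos rfl, if_pos h', if_pos rfl, if_pos ⟨h'.symm, h'.symm⟩]; norm_num
    · rw [if_pos rfl, if_neg h', if_pos rfl, if_neg fun h => h' h.1.symm]; norm_num
  · rw [if_neg h, if_neg h, if_neg fun h' => h (h'.1.symm.trans h'.2)]; norm_num

lemma outer_aState : outer (aState n) (aState n) =
    hadamardOp n * Matrix.single (fun _ => false) (fun _ => false) 1 * hadamardOp n := by
  ext x y
  rw [Matrix.mul_apply, Finset.sum_eq_single fun _ => false]
  · rw [mul_single_apply_same]
    simp [outer, aState, vecMulVec_apply, hadamardOp]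
  · intro z _ hz
    rw [mul_single_apply_of_ne _ _ _ _ _ hz, zero_mul]
  · simp

lemma one_sub_outer_aState :
    1 - (2 : ℂ) • outer (aState n) (aState n) = hadamardOp n * zeroPhase n * hadamardOp n := by
  rw [zeroPhase_eq, Matrix.mul_sub, Matrix.sub_mul, Matrix.mul_one, hadamardOp_mul_self,
    outer_aState, Matrix.mul_smul, Matrix.smul_mul]

lemma outer_bState (f : Bits (Fin n) → ZMod 2) : outer (bState f) (bState f) =
    oracleOp f * outer (aState n) (aState n) * oracleOp f := by
  ext x y
  rw [oracleOp, mul_diagonal, diagonal_mul]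
  simp only [outer, vecMulVec_apply, bState, aState, star_mul', star_sign]
  ring

/-- The reflection in |b⟩ is the reflection in |a⟩ conjugated by the oracle, and the latter is a
phase on |0…0⟩ conjugated by Hadamard gates. Hence two queries per rotation. -/
lemma rot_eq (f : Bits (Fin n) → ZMod 2) :
    rot f = oracleOp f * (hadamardOp n * zeroPhase n * hadamardOp n) * oracleOp f *
      (hadamardOp n * zeroPhase n * hadamardOp n) := by
  have hb : 1 - (2 : ℂ) • outer (bState f) (bState f) =
      oracleOp f * (1 - (2 : ℂ) • outer (aState n) (aState n)) * oracleOp f := by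
    rw [outer_bState, Matrix.mul_sub, Matrix.sub_mul, Matrix.mul_one, oracleOp_mul_self,
      Matrix.mul_smul, Matrix.smul_mul]
  rw [rot, hb, one_sub_outer_aState]

variable {Q : Type} [Fintype Q] [DecidableEq Q]

lemma realizes_lift_hadamardOp {r : ℕ} (v : ℕ) (e : Fin r ↪ Q) :
    Realizes v (fun _ : Bits (Fin n) → ZMod 2 => lift e (hadamardOp r)) 0 r := by
  obtain ⟨c, h1, h2, h3⟩ := exists_hadamard_circuit n r
  exact ((realizes_lift_circuitOp v e c).congr fun f => by rw [h3]).mono h1.le h2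

lemma realizes_lift_oracleOp (v : ℕ) (e : Fin n ↪ Q) :
    Realizes v (fun f => lift e (oracleOp f)) 1 1 :=
  (realizes_circuitOp v [Gate.query e]).congr fun f => by
    rw [circuitOp, circuitOp, Matrix.one_mul, Gate.op_query]

lemma lift_refl (M : QOp Q) : lift (Function.Embedding.refl Q) M = M := by
  ext x y
  simp [lift]

lemma realizes_hadamardOp (n v : ℕ) :
    Realizes v (fun _ : Bits (Fin n) → ZMod 2 => hadamardOp n) 0 n :=
  (realizes_lift_hadamardOp v (Function.Embedding.refl _)).congr fun _ => lift_refl _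

lemma realizes_oracleOp (n v : ℕ) :
    Realizes v (fun f : Bits (Fin n) → ZMod 2 => oracleOp f) 1 1 :=
  (realizes_lift_oracleOp v (Function.Embedding.refl _)).congr fun _ => lift_refl _

lemma realizes_zeroPhase (hv : n < v) :
    Realizes v (fun _ : Bits (Fin n) → ZMod 2 => zeroPhase n) 0 (2 * n + 1) :=
  realizes_embedded_pattern_phase (by simp) (Function.Embedding.refl _) _ hv

lemma realizes_rot (hv : n < v) :
    Realizes v (fun f : Bits (Fin n) → ZMod 2 => rot f) 2 (8 * n + 4) := by
  have hH := realizes_hadamardOp n v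
  have hO := realizes_oracleOp n v
  have hZ := realizes_zeroPhase hv
  have hS := (hH.mul hZ).mul hH
  refine ((((hO.mul hS).mul hO).mul hS).congr fun f => (rot_eq f).symm).mono ?_ ?_ <;> omega

lemma rot_conjTranspose_mul_self (f : Bits (Fin n) → ZMod 2) : (rot f)ᴴ * rot f = 1 :=
  (realizes_rot (Nat.lt_succ_self n)).conjTranspose_mul_self f

end Rotation

/-! ### Phase estimation -/

section PhaseEstimation

variable {n m v : ℕ}

/-- The operator that acts as `k j` on the first register when the second one is in `|j⟩`. -/
def blockOp (k : Bits (Fin m) → QOp (Fin n)) : QOp (Fin n ⊕ Fin m) :=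
  (blockDiagonal k).submatrix (Equiv.sumArrowEquivProdArrow (Fin n) (Fin m) Bool)
    (Equiv.sumArrowEquivProdArrow (Fin n) (Fin m) Bool)

lemma blockOp_mul (k k' : Bits (Fin m) → QOp (Fin n)) :
    blockOp k * blockOp k' = blockOp fun j => k j * k' j := by
  rw [blockOp, blockOp, submatrix_mul_equiv, ← blockDiagonal_mul, blockOp]

lemma blockOp_one : blockOp (fun _ : Bits (Fin m) => (1 : QOp (Fin n))) = 1 := by
  rw [blockOp, show (fun _ : Bits (Fin m) => (1 : QOp (Fin n))) = 1 from rfl, blockDiagonal_one,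
    submatrix_one_equiv]

lemma blockOp_pow (k : Bits (Fin m) → QOp (Fin n)) (r : ℕ) :
    blockOp k ^ r = blockOp fun j => k j ^ r := by
  induction r with
  | zero => simp [blockOp_one]
  | succ r ih => simp [pow_succ, ih, blockOp_mul]

lemma blockOp_list_prod {ι : Type} (l : List ι) (k : ι → Bits (Fin m) → QOp (Fin n)) :
    (l.map fun i => blockOp (k i)).prod = blockOp fun j => (l.map fun i => k i j).prod := by
  induction l with
  | nil => simp [blockOp_one]
  | cons i l ih => simp [ih, blockOp_mul]

lemma blockOp_apply (k : Bits (Fin m) → QOp (Fin n)) (x y : Bits (Fin n ⊕ Fin m)) :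
    blockOp k x y = if (fun i => x (Sum.inr i)) = (fun i => y (Sum.inr i)) then
      k (fun i => x (Sum.inr i)) (fun i => x (Sum.inl i)) (fun i => y (Sum.inl i)) else 0 := rfl

lemma lift_inl (M : QOp (Fin n)) :
    (lift Function.Embedding.inl M : QOp (Fin n ⊕ Fin m)) = blockOp fun _ => M := by
  ext x y
  rw [blockOp_apply, lift]
  congr 1
  refine propext ⟨fun h => funext fun i => h _ (by simp), fun h q hq => ?_⟩
  cases q with
  | inl q => exact absurd rfl (hq q)
  | inr q => exact congrFun h q

lemma lift_inr (M : QOp (Fin m)) :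
    (lift Function.Embedding.inr M : QOp (Fin n ⊕ Fin m)) = ((1 : QOp (Fin n)) ⊗ₖ M).submatrix
      (Equiv.sumArrowEquivProdArrow (Fin n) (Fin m) Bool)
      (Equiv.sumArrowEquivProdArrow (Fin n) (Fin m) Bool) := by
  ext x y
  simp only [lift, submatrix_apply, kroneckerMap_apply, one_apply, ite_mul, one_mul, zero_mul]
  congr 1
  refine propext ⟨fun h => funext fun i => h _ (by simp), fun h q hq => ?_⟩
  cases q with
  | inl q => exact congrFun h q
  | inr q => exact absurd rfl (hq q)

lemma realizes_controlled_zeroPhase (i : Fin m) (hv : n + 1 < v) :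
    Realizes v (fun _ : Bits (Fin n) → ZMod 2 =>
      (blockOp fun j => if j i then zeroPhase n else 1 : QOp (Fin n ⊕ Fin m))) 0 (2 * n + 3) := by
  refine ((realizes_pattern_phase (n := n) (u := -1) (by simp)
    ((Sum.inr i, true) :: List.ofFn fun i : Fin n => ((Sum.inl i : Fin n ⊕ Fin m), false))
    (by rwa [List.length_cons, List.length_ofFn])).congr fun f => ?_).mono le_rfl
    (by rw [List.length_cons, List.length_ofFn]; omega)
  ext x y
  rw [diagonal_apply, blockOp_apply]
  have hxy : x = y ↔ (fun i => x (Sum.inr i)) = (fun i => y (Sum.inr i)) ∧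
      (fun i => x (Sum.inl i)) = (fun i => y (Sum.inl i)) := by
    refine ⟨by rintro rfl; simp, fun ⟨h1, h2⟩ => funext fun q => ?_⟩
    cases q with
    | inl q => exact congrFun h2 q
    | inr q => exact congrFun h1 q
  have hcond : (∀ p ∈ (Sum.inr i, true) ::
      List.ofFn (fun i : Fin n => ((Sum.inl i : Fin n ⊕ Fin m), false)), x p.1 = p.2) ↔
      x (Sum.inr i) = true ∧ (fun i => x (Sum.inl i)) = fun _ => false := by
    simp [List.mem_ofFn, funext_iff]
  simp only [hcond, hxy]
  by_cases hi : x (Sum.inr i) = true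
  · simp [hi, zeroPhase, diagonal_apply, ite_and]
  · simp [hi, one_apply, ite_and]

/-- Only the two phases on |0…0⟩ need a control. Without them the Hadamard layers cancel each other
and so do the two queries, so no controlled query is used. -/
lemma realizes_controlled_rot (i : Fin m) (hv : n + 1 < v) :
    Realizes v (fun f : Bits (Fin n) → ZMod 2 =>
      (blockOp fun j => if j i then rot f else 1 : QOp (Fin n ⊕ Fin m))) 2 (8 * n + 8) := by
  have hH : Realizes v (fun _ : Bits (Fin n) → ZMod 2 =>
      (blockOp fun _ => hadamardOp n : QOp (Fin n ⊕ Fin m))) 0 n :=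
    (realizes_lift_hadamardOp v Function.Embedding.inl).congr fun _ => lift_inl _
  have hO : Realizes v (fun f : Bits (Fin n) → ZMod 2 =>
      (blockOp fun _ => oracleOp f : QOp (Fin n ⊕ Fin m))) 1 1 :=
    (realizes_lift_oracleOp v Function.Embedding.inl).congr fun _ => lift_inl _
  have hZ := realizes_controlled_zeroPhase (n := n) i hv
  have hS := (hH.mul hZ).mul hH
  refine ((((hO.mul hS).mul hO).mul hS).congr fun f => ?_).mono ?_ ?_
  · simp only [blockOp_mul]
    congr 1
    funext j
    cases j i
    · simp [hadamardOp_mul_self, oracleOp_mul_self]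
    · simp [rot_eq]
  · omega
  · omega

lemma list_prod_pow {M ι : Type} [Monoid M] (x : M) (l : List ι) (k : ι → ℕ) :
    (l.map fun i => x ^ k i).prod = x ^ (l.map k).sum := by
  induction l with
  | nil => simp
  | cons i l ih => simp [ih, pow_add]

lemma controlledPow_eq {X : Type} [Fintype X] [DecidableEq X] (U : Matrix X X ℂ) :
    controlledPow m U = blockDiagonal fun j => U ^ Nat.ofBits j := by
  ext p q
  rw [blockDiagonal_apply, controlledPow]

lemma sum_two_pow (m : ℕ) : ∑ i : Fin m, 2 ^ (i : ℕ) ≤ 2 ^ m := by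
  have := ofBits_eq_sum fun _ : Fin m => true
  have h := Nat.ofBits_lt_two_pow fun _ : Fin m => true
  simp at this
  omega

/-- The bit `i` controls `2 ^ i` rotations, and these numbers sum to less than `2 ^ m`. -/
lemma realizes_controlledPow (m : ℕ) (hv : n + 1 < v) :
    Realizes v (fun f : Bits (Fin n) → ZMod 2 =>
      (blockOp fun j => rot f ^ Nat.ofBits j : QOp (Fin n ⊕ Fin m)))
      (2 ^ m * 2) (2 ^ m * (8 * n + 8)) := by
  refine ((Realizes.prod (List.finRange m) fun i _ =>
    (realizes_controlled_rot (n := n) i hv).pow (2 ^ (i : ℕ))).congr fun f => ?_).mono ?_ ?_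
  · simp only [blockOp_pow]
    rw [blockOp_list_prod]
    congr 1
    funext j
    rw [ofBits_eq_sum, Fin.sum_univ_def, ← list_prod_pow]
    congr 1
    refine List.map_congr_left fun i _ => ?_
    cases j i <;> simp
  · rw [← Fin.sum_univ_def, ← Finset.sum_mul]
    exact Nat.mul_le_mul_right _ (sum_two_pow m)
  · rw [← Fin.sum_univ_def, ← Finset.sum_mul]
    exact Nat.mul_le_mul_right _ (sum_two_pow m)

/-- An operator of the phase register, applied to both registers. -/
abbrev liftPhase (n : ℕ) (M : QOp (Fin m)) : QOp (Fin n ⊕ Fin m) := lift Function.Embedding.inr M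

/-- The Fourier transform occurs only around the diagonal `D`, which is the form in which its bit
reversal can be absorbed. -/
lemma phaseEstimation_conj (X : Type) [Fintype X] [DecidableEq X] (U : Matrix X X ℂ)
    (D : QOp (Fin m)) :
    (phaseEstimation m U)ᴴ * ((1 : Matrix X X ℂ) ⊗ₖ D) * phaseEstimation m U =
      ((1 : Matrix X X ℂ) ⊗ₖ hadamardOp m)ᴴ * (controlledPow m U)ᴴ *
        ((1 : Matrix X X ℂ) ⊗ₖ (qftOp m * D * (qftOp m)ᴴ)) * controlledPow m U *
        ((1 : Matrix X X ℂ) ⊗ₖ hadamardOp m) := by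
  have h : (1 : Matrix X X ℂ) ⊗ₖ (qftOp m * D * (qftOp m)ᴴ) =
      ((1 : Matrix X X ℂ) ⊗ₖ qftOp m) * ((1 : Matrix X X ℂ) ⊗ₖ D) *
        ((1 : Matrix X X ℂ) ⊗ₖ (qftOp m)ᴴ) := by
    rw [← mul_kronecker_mul, ← mul_kronecker_mul, Matrix.mul_one, Matrix.mul_one]
  rw [h, phaseEstimation, conjTranspose_mul, conjTranspose_mul,
    conjTranspose_kronecker (1 : Matrix X X ℂ) (qftOp m)ᴴ, conjTranspose_conjTranspose,
    conjTranspose_one]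
  simp only [Matrix.mul_assoc]

lemma phasePower_eq (f : Bits (Fin n) → ZMod 2) (t : ℝ) :
    phasePower m f t =
      (liftPhase n (hadamardOp m))ᴴ * (blockOp fun j => rot f ^ Nat.ofBits j)ᴴ *
      (liftPhase n (layersOp fourierLayer) * liftPhase n (diagonal fun j =>
          Complex.exp (Complex.I * (phaseValue m ((revBits m).symm j) : ℂ) * (t : ℂ))) *
        liftPhase n (layersOp fourierLayer)ᴴ) *
      (blockOp fun j => rot f ^ Nat.ofBits j) * liftPhase n (hadamardOp m) := by
  rw [← lift_mul, ← lift_mul, ← qftOp_mul_diagonal_mul fun j =>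
    Complex.exp (Complex.I * (phaseValue m j : ℂ) * (t : ℂ)), phasePower, phaseEstimation_conj,
    liftPhase, lift_inr, lift_inr, blockOp, conjTranspose_submatrix, conjTranspose_submatrix,
    submatrix_mul_equiv, submatrix_mul_equiv, submatrix_mul_equiv, submatrix_mul_equiv,
    controlledPow_eq]

lemma norm_exp_I_mul_mul (a b : ℝ) : ‖Complex.exp (Complex.I * a * b)‖ = 1 := by
  rw [show Complex.I * (a : ℂ) * b = ((a * b : ℝ) : ℂ) * Complex.I by push_cast; ring]
  exact Complex.norm_exp_ofReal_mul_I _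

lemma realizes_phasePower (m : ℕ) (t : ℝ) (hv : n + m + 1 < v) :
    Realizes v (fun f : Bits (Fin n) → ZMod 2 => phasePower m f t)
      (2 ^ m * 4) (2 ^ m * (16 * n + 2 * m + 17) + 2 * (m * (m + 2))) := by
  have hH := realizes_lift_hadamardOp (n := n) (Q := Fin n ⊕ Fin m) v Function.Embedding.inr
  have hC := realizes_controlledPow (n := n) (v := v) m (by omega)
  have hF : Realizes v (fun _ : Bits (Fin n) → ZMod 2 =>
      liftPhase n (layersOp (fourierLayer (m := m))))
      0 (m * (m + 1)) := by
    obtain ⟨c, h1, h2, h3⟩ := exists_fourierLayers_circuit n m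
    exact ((realizes_lift_circuitOp v _ c).congr fun f => by rw [h3]).mono h1.le h2
  have hD : Realizes v (fun _ : Bits (Fin n) → ZMod 2 =>
      liftPhase n (diagonal fun j =>
        Complex.exp (Complex.I * (phaseValue m ((revBits m).symm j) : ℂ) * (t : ℂ))))
        0 (2 ^ m * (2 * m + 1)) :=
    (realizes_diagonal Function.Embedding.inr
      (fun j => Complex.exp (Complex.I * (phaseValue m ((revBits m).symm j) : ℂ) * (t : ℂ)))
      (fun j => norm_exp_I_mul_mul _ t) (by omega)).congr fun _ =>
      (lift_diagonal Function.Embedding.inr fun j =>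
        Complex.exp (Complex.I * (phaseValue m ((revBits m).symm j) : ℂ) * (t : ℂ))).symm
  have hF' := hF.conjTranspose
  simp only [← lift_conjTranspose] at hF'
  -- Each of the two controlled powers makes at most `2 ^ m * 2` queries; the other factors make
  -- none.
  refine (((((hH.conjTranspose.mul hC.conjTranspose).mul ((hF.mul hD).mul hF')).mul hC).mul
    hH).congr fun f => (phasePower_eq f t).symm).mono ?_ ?_
  · omega
  · apply le_of_eq; ring

lemma phaseEstimation_conjTranspose_mul_self (f : Bits (Fin n) → ZMod 2) :
    (phaseEstimation m (rot f))ᴴ * phaseEstimation m (rot f) = 1 := by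
  have hF : ((1 : QOp (Fin n)) ⊗ₖ qftOp m) * ((1 : QOp (Fin n)) ⊗ₖ (qftOp m)ᴴ) = 1 := by
    rw [← mul_kronecker_mul, Matrix.mul_one, qftOp_mul_conjTranspose, one_kronecker_one]
  have hH : ((1 : QOp (Fin n)) ⊗ₖ hadamardOp m) * ((1 : QOp (Fin n)) ⊗ₖ hadamardOp m) = 1 := by
    rw [← mul_kronecker_mul, Matrix.mul_one, hadamardOp_mul_self, one_kronecker_one]
  have hR : ∀ k, (rot f ^ k)ᴴ * rot f ^ k = 1 := by
    intro k
    rw [conjTranspose_pow]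
    have := rot_conjTranspose_mul_self f
    rw [← Commute.mul_pow, this, one_pow]
    rw [Commute, SemiconjBy, this, mul_eq_one_comm.1 this]
  have hC : (controlledPow m (rot f))ᴴ * controlledPow m (rot f) = 1 := by
    rw [controlledPow_eq, blockDiagonal_conjTranspose, ← blockDiagonal_mul]
    simp only [hR]
    exact blockDiagonal_one
  rw [phaseEstimation, conjTranspose_mul, conjTranspose_mul, conjTranspose_kronecker,
    conjTranspose_kronecker, conjTranspose_conjTranspose, conjTranspose_one,
    hadamardOp_conjTranspose]
  calc _ = ((1 : QOp (Fin n)) ⊗ₖ hadamardOp m) * ((controlledPow m (rot f))ᴴ *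
        (((1 : QOp (Fin n)) ⊗ₖ qftOp m) * ((1 : QOp (Fin n)) ⊗ₖ (qftOp m)ᴴ)) *
        controlledPow m (rot f)) * ((1 : QOp (Fin n)) ⊗ₖ hadamardOp m) := by
        simp only [Matrix.mul_assoc]
    _ = 1 := by rw [hF, Matrix.mul_one, hC, Matrix.mul_one, hH]

end PhaseEstimation

/-! ### Rank-one operators, linearity of the action, isometries. -/

section Outer

variable {Q : Type} [Fintype Q] [DecidableEq Q]

lemma outer_mul_outer (ψ χ φ ω : QState Q) :
    outer ψ χ * outer φ ω = (inner ℂ χ φ : ℂ) • outer ψ ω := by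
  ext x y
  simp only [Matrix.mul_apply, outer, vecMulVec_apply, Matrix.smul_apply, smul_eq_mul,
    PiLp.inner_apply, RCLike.inner_apply, Finset.sum_mul]
  exact Finset.sum_congr rfl fun z _ => by simp only [RCLike.star_def]; ring

lemma act_outer (ψ χ φ : QState Q) : act (outer ψ χ) φ = (inner ℂ χ φ : ℂ) • ψ := by
  ext x
  simp only [act, Matrix.toLpLin_apply, Matrix.mulVec, dotProduct, outer, vecMulVec_apply,
    PiLp.smul_apply, smul_eq_mul, PiLp.inner_apply, RCLike.inner_apply, Finset.sum_mul]
  exact Finset.sum_congr rfl fun z _ => by simp only [RCLike.star_def]; ring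

lemma outer_conjTranspose (ψ χ : QState Q) : (outer ψ χ)ᴴ = outer χ ψ := by
  ext x y
  simp [outer, vecMulVec_apply, mul_comm]

lemma act_one (ψ : QState Q) : act 1 ψ = ψ := by
  simp [act]

lemma act_add (M M' : QOp Q) (ψ : QState Q) : act (M + M') ψ = act M ψ + act M' ψ := by
  simp [act]

lemma act_sub (M M' : QOp Q) (ψ : QState Q) : act (M - M') ψ = act M ψ - act M' ψ := by
  simp [act]

lemma act_smul (z : ℂ) (M : QOp Q) (ψ : QState Q) : act (z • M) ψ = z • act M ψ := by
  simp [act]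

lemma act_map_add (M : QOp Q) (ψ χ : QState Q) : act M (ψ + χ) = act M ψ + act M χ :=
  map_add _ _ _

lemma act_map_smul (z : ℂ) (M : QOp Q) (ψ : QState Q) : act M (z • ψ) = z • act M ψ :=
  map_smul _ _ _

lemma norm_toEuclideanLin_of_conjTranspose_mul_self {X Y : Type} [Fintype X] [DecidableEq X]
    [Fintype Y] [DecidableEq Y] {M : Matrix X Y ℂ} (hM : Mᴴ * M = 1) (ψ : EuclideanSpace ℂ Y) :
    ‖Matrix.toEuclideanLin M ψ‖ = ‖ψ‖ := by
  have h : ‖Matrix.toEuclideanLin M ψ‖ ^ 2 = ‖ψ‖ ^ 2 := by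
    have : (inner ℂ (Matrix.toEuclideanLin M ψ) (Matrix.toEuclideanLin M ψ) : ℂ) = inner ℂ ψ ψ := by
      rw [← LinearMap.adjoint_inner_right, ← Matrix.toEuclideanLin_conjTranspose_eq_adjoint]
      congr 1
      simp [Matrix.toLpLin_apply, hM]
    rw [inner_self_eq_norm_sq_to_K, inner_self_eq_norm_sq_to_K] at this
    exact_mod_cast this
  exact (sq_eq_sq₀ (norm_nonneg _) (norm_nonneg _)).1 h

lemma norm_act_of_conjTranspose_mul_self {M : QOp Q} (hM : Mᴴ * M = 1) (ψ : QState Q) :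
    ‖act M ψ‖ = ‖ψ‖ := norm_toEuclideanLin_of_conjTranspose_mul_self hM ψ

end Outer

/-! ### The exponential of a combination of two orthogonal idempotents. -/

section Exponential

variable {X : Type} [Fintype X] [DecidableEq X]

/-- Mixed products vanish, so powers act on the coefficients. Only the zeroth power also sees the
complement of the two ranges, hence the correction term. -/
lemma pow_add_idempotents {E F : Matrix X X ℂ} (hE : E * E = E) (hF : F * F = F)
    (hEF : E * F = 0) (hFE : F * E = 0) (z w : ℂ) (k : ℕ) :
    (z • E + w • F) ^ k = z ^ k • E + w ^ k • F + if k = 0 then 1 - E - F else 0 := by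
  induction k with
  | zero => simp
  | succ k ih =>
    rw [pow_succ, ih]
    by_cases hk : k = 0
    · subst hk
      simp
    · simp [hk, Matrix.add_mul, Matrix.mul_add, hE, hF, hEF, hFE, pow_succ, smul_smul, mul_comm]

lemma exp_add_idempotents {E F : Matrix X X ℂ} (hE : E * E = E) (hF : F * F = F)
    (hEF : E * F = 0) (hFE : F * E = 0) (z w : ℂ) :
    NormedSpace.exp (z • E + w • F) =
      1 + (Complex.exp z - 1) • E + (Complex.exp w - 1) • F := by
  have hexp : ∀ u : ℂ, HasSum (fun k : ℕ => (k.factorial⁻¹ : ℂ) • u ^ k) (Complex.exp u) := by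
    intro u
    rw [Complex.exp_eq_exp_ℂ]
    exact NormedSpace.exp_series_hasSum_exp' u
  have h := (((hexp z).smul_const E).add ((hexp w).smul_const F)).add
    (hasSum_ite_eq (0 : ℕ) (1 - E - F))
  have hterm : (fun k : ℕ => (k.factorial⁻¹ : ℂ) • (z • E + w • F) ^ k) = fun k : ℕ =>
      ((k.factorial⁻¹ : ℂ) • z ^ k) • E + ((k.factorial⁻¹ : ℂ) • w ^ k) • F +
        if k = 0 then 1 - E - F else 0 := by
    funext k
    rw [pow_add_idempotents hE hF hEF hFE]
    by_cases hk : k = 0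
    · subst hk; simp
    · simp [hk, smul_smul]
  rw [NormedSpace.exp_eq_tsum ℂ]
  dsimp only
  rw [hterm, h.tsum_eq]
  module

end Exponential

/-! ### The plane of the rotation -/

section Plane

variable {n : ℕ} {f : Bits (Fin n) → ZMod 2} {x₀ : Bits (Fin n)}

/-- The angle between the uniform superposition of `2 ^ n` basis states and one of them. -/
def angle (n : ℕ) : ℝ := Real.arccos (1 / √(2 ^ n))

lemma one_lt_two_pow_real (hn : 1 ≤ n) : (2 : ℝ) ≤ 2 ^ n := by
  calc (2 : ℝ) = 2 ^ 1 := by norm_num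
    _ ≤ 2 ^ n := pow_le_pow_right₀ (by norm_num) hn

lemma inv_sqrt_le_one (n : ℕ) : 1 / √(2 ^ n : ℝ) ≤ 1 := by
  rw [div_le_one (by positivity), Real.one_le_sqrt]
  exact one_le_pow₀ (by norm_num)

lemma cos_angle (n : ℕ) : Real.cos (angle n) = 1 / √(2 ^ n) :=
  Real.cos_arccos (by linarith [show 0 ≤ 1 / √(2 ^ n : ℝ) by positivity]) (inv_sqrt_le_one n)

lemma sin_angle (n : ℕ) : Real.sin (angle n) = √(2 ^ n - 1) / √(2 ^ n) := by
  rw [angle, Real.sin_arccos, div_pow, Real.sq_sqrt (by positivity), ← Real.sqrt_div']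
  · congr 1
    field_simp
  · positivity

lemma cos_two_mul_angle (n : ℕ) : Real.cos (2 * angle n) = (2 - 2 ^ n) / 2 ^ n := by
  rw [Real.cos_two_mul, cos_angle, div_pow, Real.sq_sqrt (by positivity)]
  field_simp

lemma sin_two_mul_angle (n : ℕ) : Real.sin (2 * angle n) = 2 * √(2 ^ n - 1) / 2 ^ n := by
  rw [Real.sin_two_mul, cos_angle, sin_angle]
  have h : √(2 ^ n : ℝ) * √(2 ^ n) = 2 ^ n := Real.mul_self_sqrt (by positivity)
  rw [mul_assoc, div_mul_div_comm, h, mul_one, mul_div_assoc]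

lemma sin_two_mul_angle_pos (hn : 1 ≤ n) : 0 < Real.sin (2 * angle n) := by
  have := one_lt_two_pow_real hn
  rw [sin_two_mul_angle]
  have : 0 < √((2 : ℝ) ^ n - 1) := Real.sqrt_pos.2 (by linarith)
  positivity

lemma sign_of_marks (h : Marks f x₀) (x : Bits (Fin n)) :
    sign f x = if x = x₀ then 1 else -1 := by
  split_ifs with hx
  · simp [sign, (h x).2 hx]
  · have h0 : f x ≠ 0 := fun h0 => hx ((h x).1 h0)
    have h1 : f x = 1 := by
      revert h0
      generalize f x = y
      revert y
      decide
    simp [sign, h1, ZMod.val_one]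

/-- The uniform superposition of the basis states other than `|x₀⟩`. -/
def restState (x₀ : Bits (Fin n)) : QState (Fin n) :=
  WithLp.toLp 2 fun x => if x = x₀ then 0 else 1 / (√(2 ^ n - 1 : ℝ) : ℂ)

/-- The eigenvectors of the rotation, for `σ = i` and `σ = -i`. -/
def eigState (x₀ : Bits (Fin n)) (σ : ℂ) : QState (Fin n) := ket x₀ + σ • restState x₀

lemma ket_apply (x y : Bits (Fin n)) : ket x y = if y = x then 1 else 0 := by
  simp [ket]

lemma eigState_apply (σ : ℂ) (x : Bits (Fin n)) :
    eigState x₀ σ x = if x = x₀ then 1 else σ / (√(2 ^ n - 1 : ℝ) : ℂ) := by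
  simp only [eigState, PiLp.add_apply, PiLp.smul_apply, ket_apply, restState, smul_eq_mul]
  split_ifs <;> simp [div_eq_mul_inv]

/-- |x₀⟩ and `restState x₀` are orthonormal. So the two eigenvectors, for σ = i and σ = -i, are
orthogonal with squared norm 2, which explains the factor 1/2 in `eigProj`. -/
lemma inner_eigState (hn : 1 ≤ n) (σ τ : ℂ) :
    (inner ℂ (eigState x₀ σ) (eigState x₀ τ) : ℂ) = 1 + star σ * τ := by
  have hN := one_lt_two_pow_real hn
  have hs : ((√(2 ^ n - 1 : ℝ) : ℝ) : ℂ) * ((√(2 ^ n - 1 : ℝ) : ℝ) : ℂ) = 2 ^ n - 1 := by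
    rw [← Complex.ofReal_mul, Real.mul_self_sqrt (by linarith)]
    push_cast
    rfl
  have hne : (2 : ℂ) ^ n - 1 ≠ 0 := by
    have : ((2 ^ n - 1 : ℝ) : ℂ) ≠ 0 := Complex.ofReal_ne_zero.2 (by linarith)
    simpa using this
  rw [PiLp.inner_apply]
  simp only [eigState_apply, RCLike.inner_apply]
  rw [← Finset.add_sum_erase _ _ (Finset.mem_univ x₀)]
  have hterm : ∀ x ∈ Finset.univ.erase x₀,
      (if x = x₀ then (1 : ℂ) else τ / ((√(2 ^ n - 1 : ℝ) : ℝ) : ℂ)) *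
        (starRingEnd ℂ) (if x = x₀ then 1 else σ / ((√(2 ^ n - 1 : ℝ) : ℝ) : ℂ)) =
        star σ * τ / (2 ^ n - 1) := by
    intro x hx
    rw [if_neg (Finset.ne_of_mem_erase hx), if_neg (Finset.ne_of_mem_erase hx), map_div₀,
      Complex.conj_ofReal, div_mul_div_comm, hs, mul_comm]
    rfl
  rw [Finset.sum_congr rfl hterm, Finset.sum_const, Finset.card_erase_of_mem (Finset.mem_univ _),
    Finset.card_univ]
  have hcard : ((Fintype.card (Bits (Fin n)) - 1 : ℕ) : ℂ) = 2 ^ n - 1 := by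
    rw [Nat.cast_sub (by simp [Nat.one_le_two_pow])]
    simp
  rw [nsmul_eq_mul, hcard]
  simp
  field_simp

lemma norm_sq_eigState (hn : 1 ≤ n) {σ : ℂ} (hσ : star σ * σ = 1) :
    ‖eigState x₀ σ‖ ^ 2 = 2 := by
  have h := inner_self_eq_norm_sq_to_K (𝕜 := ℂ) (eigState x₀ σ)
  rw [inner_eigState hn, hσ] at h
  have h' : ((‖eigState x₀ σ‖ ^ 2 : ℝ) : ℂ) = ((2 : ℝ) : ℂ) := by
    push_cast
    rw [← Complex.coe_algebraMap] at *
    simpa [one_add_one_eq_two] using h.symm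
  exact_mod_cast h'

lemma ket_eq_eigState : ket x₀ = (1 / 2 : ℂ) • (eigState x₀ Complex.I + eigState x₀ (-Complex.I)) := by
  ext x
  simp only [PiLp.smul_apply, PiLp.add_apply, eigState_apply, ket_apply, smul_eq_mul]
  split_ifs
  · norm_num
  · ring

lemma exp_angle (s : ℝ) : Complex.exp (Complex.I * s) = Real.cos s + Real.sin s * Complex.I := by
  rw [mul_comm, Complex.exp_mul_I, Complex.ofReal_cos, Complex.ofReal_sin]

/-- In the plane |a⟩ = cos θ |x₀⟩ + sin θ |rest⟩, here in the eigenbasis; |b⟩ has the opposite sign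
of sin θ, which exchanges the two exponentials. -/
lemma aState_eq (hn : 1 ≤ n) : aState n = (1 / 2 : ℂ) •
    (Complex.exp (-(Complex.I * angle n)) • eigState x₀ Complex.I +
      Complex.exp (Complex.I * angle n) • eigState x₀ (-Complex.I)) := by
  have hN := one_lt_two_pow_real hn
  have hs : ((√(2 ^ n - 1 : ℝ) : ℝ) : ℂ) ≠ 0 :=
    Complex.ofReal_ne_zero.2 (Real.sqrt_pos.2 (by linarith)).ne'
  ext x
  have hneg : Complex.exp (-(Complex.I * angle n)) =
      Real.cos (angle n) - Real.sin (angle n) * Complex.I := by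
    rw [show -(Complex.I * (angle n : ℂ)) = Complex.I * ((-angle n : ℝ) : ℂ) by push_cast; ring,
      exp_angle, Real.cos_neg, Real.sin_neg]
    push_cast
    ring
  rw [hneg, exp_angle, cos_angle, sin_angle]
  simp only [aState, PiLp.smul_apply, PiLp.add_apply, eigState_apply, smul_eq_mul]
  split_ifs
  · push_cast; ring
  · push_cast
    field_simp
    ring_nf
    simp

lemma bState_eq (hn : 1 ≤ n) (h : Marks f x₀) : bState f = (1 / 2 : ℂ) •
    (Complex.exp (Complex.I * angle n) • eigState x₀ Complex.I +
      Complex.exp (-(Complex.I * angle n)) • eigState x₀ (-Complex.I)) := by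
  have hN := one_lt_two_pow_real hn
  have hs : ((√(2 ^ n - 1 : ℝ) : ℝ) : ℂ) ≠ 0 :=
    Complex.ofReal_ne_zero.2 (Real.sqrt_pos.2 (by linarith)).ne'
  ext x
  have hneg : Complex.exp (-(Complex.I * angle n)) =
      Real.cos (angle n) - Real.sin (angle n) * Complex.I := by
    rw [show -(Complex.I * (angle n : ℂ)) = Complex.I * ((-angle n : ℝ) : ℂ) by push_cast; ring,
      exp_angle, Real.cos_neg, Real.sin_neg]
    push_cast
    ring
  rw [hneg, exp_angle, cos_angle, sin_angle]
  simp only [bState, sign_of_marks h, PiLp.smul_apply, PiLp.add_apply, eigState_apply, smul_eq_mul]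
  split_ifs
  · push_cast; ring
  · push_cast
    field_simp
    ring_nf
    simp

/-- The projections onto the eigenvectors of the rotation. -/
def eigProj (x₀ : Bits (Fin n)) (σ : ℂ) : QOp (Fin n) :=
  (1 / 2 : ℂ) • outer (eigState x₀ σ) (eigState x₀ σ)

lemma star_I_mul_I : star Complex.I * Complex.I = 1 := by simp

lemma star_neg_I_mul_neg_I : star (-Complex.I) * -Complex.I = 1 := by simp

lemma eigProj_mul_self (hn : 1 ≤ n) {σ : ℂ} (hσ : star σ * σ = 1) :
    eigProj x₀ σ * eigProj x₀ σ = eigProj x₀ σ := by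
  rw [eigProj, Matrix.smul_mul, Matrix.mul_smul, outer_mul_outer, inner_eigState hn, hσ, smul_smul,
    smul_smul]
  norm_num

lemma eigProj_mul_eq_zero (hn : 1 ≤ n) {σ τ : ℂ} (h : star σ * τ = -1) :
    eigProj x₀ σ * eigProj x₀ τ = 0 := by
  rw [eigProj, eigProj, Matrix.smul_mul, Matrix.mul_smul, outer_mul_outer, inner_eigState hn, h]
  simp

lemma eigProj_conjTranspose (σ : ℂ) : (eigProj x₀ σ)ᴴ = eigProj x₀ σ := by
  rw [eigProj, conjTranspose_smul, outer_conjTranspose]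
  simp

lemma norm_act_eigProj_le (hn : 1 ≤ n) {σ : ℂ} (hσ : star σ * σ = 1) (ψ : QState (Fin n)) :
    ‖act (eigProj x₀ σ) ψ‖ ≤ ‖ψ‖ := by
  rw [eigProj, act_smul, act_outer, norm_smul, norm_smul]
  have h := norm_inner_le_norm (𝕜 := ℂ) (eigState x₀ σ) ψ
  have h2 := norm_sq_eigState (x₀ := x₀) hn hσ
  have h3 : ‖(1 / 2 : ℂ)‖ = 1 / 2 := by norm_num
  rw [h3]
  nlinarith [norm_nonneg (eigState x₀ σ), norm_nonneg ψ,
    mul_le_mul_of_nonneg_right h (norm_nonneg (eigState x₀ σ))]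

/-- The rotation by the angle `s` in the plane of the two states. -/
def rotBy (x₀ : Bits (Fin n)) (s : ℝ) : QOp (Fin n) :=
  1 + (Complex.exp (Complex.I * s) - 1) • eigProj x₀ Complex.I +
    (Complex.exp (-(Complex.I * s)) - 1) • eigProj x₀ (-Complex.I)

lemma rotBy_zero : rotBy x₀ 0 = 1 := by simp [rotBy]

/-- The projections are orthogonal idempotents, so the phases multiply. From here on, composing
rotations is adding angles. -/
lemma rotBy_mul (hn : 1 ≤ n) (s t : ℝ) : rotBy x₀ s * rotBy x₀ t = rotBy x₀ (s + t) := by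
  have h1 := eigProj_mul_self (x₀ := x₀) hn star_I_mul_I
  have h2 := eigProj_mul_self (x₀ := x₀) hn star_neg_I_mul_neg_I
  have h3 := eigProj_mul_eq_zero (x₀ := x₀) hn (σ := Complex.I) (τ := -Complex.I) (by simp)
  have h4 := eigProj_mul_eq_zero (x₀ := x₀) hn (σ := -Complex.I) (τ := Complex.I) (by simp)
  rw [rotBy, rotBy, rotBy, Complex.ofReal_add, mul_add Complex.I, neg_add, Complex.exp_add,
    Complex.exp_add]
  simp only [Matrix.add_mul, Matrix.mul_add, Matrix.smul_mul, Matrix.mul_smul, Matrix.one_mul,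
    Matrix.mul_one, h1, h2, h3, h4, smul_zero]
  module

lemma rotBy_pow (hn : 1 ≤ n) (s : ℝ) (k : ℕ) : rotBy x₀ s ^ k = rotBy x₀ (k * s) := by
  induction k with
  | zero => simp [rotBy_zero]
  | succ k ih =>
    rw [pow_succ, ih, rotBy_mul hn]
    congr 1
    push_cast
    ring

lemma rotBy_add_int_mul_two_pi (s : ℝ) (k : ℤ) :
    rotBy x₀ (s + k * (2 * Real.pi)) = rotBy x₀ s := by
  have h1 : Complex.exp (Complex.I * ((s + k * (2 * Real.pi) : ℝ) : ℂ)) =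
      Complex.exp (Complex.I * s) := by
    rw [Complex.exp_eq_exp_iff_exists_int]
    exact ⟨k, by push_cast; ring⟩
  have h2 : Complex.exp (-(Complex.I * ((s + k * (2 * Real.pi) : ℝ) : ℂ))) =
      Complex.exp (-(Complex.I * s)) := by
    rw [Complex.exp_neg, h1, Complex.exp_neg]
  rw [rotBy, rotBy, h1, h2]

lemma norm_exp_sub_exp_le (s t : ℝ) :
    ‖Complex.exp (Complex.I * s) - Complex.exp (Complex.I * t)‖ ≤ |s - t| := by
  have h : Complex.exp (Complex.I * s) - Complex.exp (Complex.I * t) =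
      Complex.exp (Complex.I * t) * (Complex.exp (Complex.I * ((s - t : ℝ) : ℂ)) - 1) := by
    rw [mul_sub, ← Complex.exp_add]
    congr 2
    · push_cast; ring
    · ring
  rw [h, norm_mul, mul_comm Complex.I (t : ℂ), Complex.norm_exp_ofReal_mul_I, one_mul]
  exact Real.norm_exp_I_mul_ofReal_sub_one_le

/-- Each of the two eigenvalues moves by at most |s - t|. The triangle inequality over the two
projections gives the factor 2, which is not sharp but suffices. -/
lemma norm_act_rotBy_sub_le (hn : 1 ≤ n) (s t : ℝ) (ψ : QState (Fin n)) :
    ‖act (rotBy x₀ s) ψ - act (rotBy x₀ t) ψ‖ ≤ 2 * |s - t| * ‖ψ‖ := by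
  have h : rotBy x₀ s - rotBy x₀ t =
      (Complex.exp (Complex.I * s) - Complex.exp (Complex.I * t)) • eigProj x₀ Complex.I +
      (Complex.exp (Complex.I * ((-s : ℝ) : ℂ)) - Complex.exp (Complex.I * ((-t : ℝ) : ℂ))) •
        eigProj x₀ (-Complex.I) := by
    rw [rotBy, rotBy]
    push_cast
    rw [mul_neg, mul_neg]
    module
  rw [← act_sub, h, act_add, act_smul, act_smul]
  refine (norm_add_le _ _).trans ?_
  rw [norm_smul, norm_smul]
  have h1 := norm_act_eigProj_le (x₀ := x₀) hn star_I_mul_I ψ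
  have h2 := norm_act_eigProj_le (x₀ := x₀) hn star_neg_I_mul_neg_I ψ
  have h3 := norm_exp_sub_exp_le s t
  have h4 := norm_exp_sub_exp_le (-s) (-t)
  rw [show -s - -t = -(s - t) by ring, abs_neg] at h4
  calc _ ≤ |s - t| * ‖ψ‖ + |s - t| * ‖ψ‖ := by gcongr
    _ = _ := by ring

lemma act_eigProj_eigState (hn : 1 ≤ n) (σ τ : ℂ) :
    act (eigProj x₀ σ) (eigState x₀ τ) = ((1 + star σ * τ) / 2) • eigState x₀ σ := by
  rw [eigProj, act_smul, act_outer, inner_eigState hn, smul_smul]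
  congr 1
  ring

lemma act_rotBy_eigState_I (hn : 1 ≤ n) (s : ℝ) : act (rotBy x₀ s) (eigState x₀ Complex.I) =
    Complex.exp (Complex.I * s) • eigState x₀ Complex.I := by
  rw [rotBy, act_add, act_add, act_one, act_smul, act_smul, act_eigProj_eigState hn,
    act_eigProj_eigState hn, star_I_mul_I]
  simp
  module

lemma act_rotBy_eigState_neg_I (hn : 1 ≤ n) (s : ℝ) :
    act (rotBy x₀ s) (eigState x₀ (-Complex.I)) =
    Complex.exp (-(Complex.I * s)) • eigState x₀ (-Complex.I) := by
  rw [rotBy, act_add, act_add, act_one, act_smul, act_smul, act_eigProj_eigState hn,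
    act_eigProj_eigState hn, star_neg_I_mul_neg_I]
  simp
  module

/-- The eigenphases e^{±iθ} cancel the coefficients e^{∓iθ} of |a⟩, leaving the half sum of the
eigenvectors. -/
lemma act_rotBy_angle_aState (hn : 1 ≤ n) : act (rotBy x₀ (angle n)) (aState n) = ket x₀ := by
  rw [aState_eq (x₀ := x₀) hn, act_map_smul, act_map_add, act_map_smul, act_map_smul,
    act_rotBy_eigState_I hn, act_rotBy_eigState_neg_I hn, smul_smul, smul_smul, ← Complex.exp_add,
    ← Complex.exp_add, ket_eq_eigState]
  simp

lemma star_exp_angle :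
    star (Complex.exp (Complex.I * angle n)) = Complex.exp (-(Complex.I * angle n)) := by
  rw [Complex.star_def, ← Complex.exp_conj]
  simp

lemma star_exp_neg_angle :
    star (Complex.exp (-(Complex.I * angle n))) = Complex.exp (Complex.I * angle n) := by
  rw [← star_exp_angle, star_star]

lemma cos_two_mul_eq_exp (s : ℝ) : (Real.cos (2 * s) : ℂ) =
    (Complex.exp (Complex.I * s) ^ 2 + Complex.exp (-(Complex.I * s)) ^ 2) / 2 := by
  rw [Complex.ofReal_cos, Complex.cos, ← Complex.exp_nat_mul, ← Complex.exp_nat_mul]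
  push_cast
  congr 3 <;> ring

lemma sin_two_mul_eq_exp (s : ℝ) : (Real.sin (2 * s) : ℂ) * Complex.I =
    (Complex.exp (Complex.I * s) ^ 2 - Complex.exp (-(Complex.I * s)) ^ 2) / 2 := by
  rw [Complex.ofReal_sin, Complex.sin, ← Complex.exp_nat_mul, ← Complex.exp_nat_mul]
  push_cast
  rw [show -(2 * (s : ℂ)) * Complex.I = 2 * -(Complex.I * s) by ring,
    show 2 * (s : ℂ) * Complex.I = 2 * (Complex.I * s) by ring]
  linear_combination (-1 / 2 : ℂ) * (Complex.exp (2 * (Complex.I * s)) -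
    Complex.exp (2 * -(Complex.I * s))) * Complex.I_mul_I

lemma inner_aState_bState (hn : 1 ≤ n) (h : Marks f x₀) :
    (inner ℂ (aState n) (bState f) : ℂ) = Real.cos (2 * angle n) := by
  rw [aState_eq (x₀ := x₀) hn, bState_eq hn h, cos_two_mul_eq_exp]
  simp only [inner_smul_left, inner_smul_right, inner_add_left, inner_add_right,
    inner_eigState hn, ← Complex.star_def, star_exp_angle, star_exp_neg_angle]
  simp
  ring

lemma inner_bState_aState (hn : 1 ≤ n) (h : Marks f x₀) :
    (inner ℂ (bState f) (aState n) : ℂ) = Real.cos (2 * angle n) := by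
  rw [← inner_conj_symm, inner_aState_bState hn h, Complex.conj_ofReal]

lemma rot_eq_rotBy (hn : 1 ≤ n) (h : Marks f x₀) : rot f = rotBy x₀ (4 * angle n) := by
  have hprod : rot f = 1 - (2 : ℂ) • outer (bState f) (bState f) -
      (2 : ℂ) • outer (aState n) (aState n) +
      (4 * (Real.cos (2 * angle n) : ℂ)) • outer (bState f) (aState n) := by
    rw [rot, Matrix.sub_mul, Matrix.one_mul, Matrix.mul_sub, Matrix.mul_one, Matrix.smul_mul,
      Matrix.mul_smul, outer_mul_outer, inner_bState_aState hn h]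
    module
  rw [hprod, cos_two_mul_eq_exp]
  have h4 : Complex.exp (Complex.I * ((4 * angle n : ℝ) : ℂ)) =
      Complex.exp (Complex.I * angle n) ^ 4 := by
    rw [← Complex.exp_nat_mul]
    push_cast
    congr 1
    ring
  have h4' : Complex.exp (-(Complex.I * ((4 * angle n : ℝ) : ℂ))) =
      Complex.exp (-(Complex.I * angle n)) ^ 4 := by
    rw [← Complex.exp_nat_mul]
    push_cast
    congr 1
    ring
  have hpq : Complex.exp (Complex.I * angle n) * Complex.exp (-(Complex.I * angle n)) = 1 := by
    rw [← Complex.exp_add, add_neg_cancel, Complex.exp_zero]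
  have sp := star_exp_angle (n := n)
  have sq := star_exp_neg_angle (n := n)
  rw [rotBy, h4, h4', aState_eq (x₀ := x₀) hn, bState_eq hn h]
  -- With p = e^{iθ} and q = p⁻¹, and with the entries of the eigenvectors as free variables, every
  -- matrix entry becomes a rational identity in p.
  generalize Complex.exp (Complex.I * angle n) = p at *
  generalize Complex.exp (-(Complex.I * angle n)) = q at *
  have hp : p ≠ 0 := left_ne_zero_of_mul_eq_one hpq
  obtain rfl : q = p⁻¹ := eq_inv_of_mul_eq_one_right hpq
  ext x y
  simp only [eigProj, outer, vecMulVec_apply, Matrix.add_apply, Matrix.sub_apply,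
    Matrix.smul_apply, PiLp.smul_apply, PiLp.add_apply, smul_eq_mul, star_add, star_mul', sp, sq]
  have h2 : star (1 / 2 : ℂ) = 1 / 2 := by simp
  rw [h2]
  generalize star (eigState x₀ Complex.I y) = u'
  generalize star (eigState x₀ (-Complex.I) y) = w'
  field_simp
  ring

lemma outer_sub_outer (hn : 1 ≤ n) (h : Marks f x₀) :
    outer (aState n) (bState f) - outer (bState f) (aState n) =
      (-((Real.sin (2 * angle n) : ℂ) * Complex.I)) •
        (eigProj x₀ Complex.I - eigProj x₀ (-Complex.I)) := by
  have hpq : Complex.exp (Complex.I * angle n) * Complex.exp (-(Complex.I * angle n)) = 1 := by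
    rw [← Complex.exp_add, add_neg_cancel, Complex.exp_zero]
  have sp := star_exp_angle (n := n)
  have sq := star_exp_neg_angle (n := n)
  rw [sin_two_mul_eq_exp, aState_eq (x₀ := x₀) hn, bState_eq hn h]
  generalize Complex.exp (Complex.I * angle n) = p at *
  generalize Complex.exp (-(Complex.I * angle n)) = q at *
  have hp : p ≠ 0 := left_ne_zero_of_mul_eq_one hpq
  obtain rfl : q = p⁻¹ := eq_inv_of_mul_eq_one_right hpq
  ext x y
  simp only [eigProj, outer, vecMulVec_apply, Matrix.sub_apply,
    Matrix.smul_apply, PiLp.smul_apply, PiLp.add_apply, smul_eq_mul, star_add, star_mul', sp, sq]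
  have h2 : star (1 / 2 : ℂ) = 1 / 2 := by simp
  rw [h2]
  generalize star (eigState x₀ Complex.I y) = u'
  generalize star (eigState x₀ (-Complex.I) y) = w'
  field_simp
  ring

lemma aState_add_bState (h : Marks f x₀) :
    aState n + bState f = ((2 / √(2 ^ n : ℝ) : ℝ) : ℂ) • ket x₀ := by
  ext x
  simp only [aState, bState, sign_of_marks h, PiLp.add_apply, PiLp.smul_apply, ket_apply,
    smul_eq_mul]
  split_ifs
  · push_cast; ring
  · push_cast; ring

lemma norm_ket (x : Bits (Fin n)) : ‖ket x‖ = 1 := by simp [ket]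

lemma cState_eq_ket (h : Marks f x₀) : cState f = ket x₀ := by
  have hpos : 0 < 2 / √(2 ^ n : ℝ) := by positivity
  rw [cState, aState_add_bState h, norm_smul, norm_ket, mul_one, Complex.norm_real,
    Real.norm_of_nonneg hpos.le, smul_smul, ← Complex.ofReal_mul, inv_mul_cancel₀ hpos.ne']
  simp

lemma theta_eq_angle (h : Marks f x₀) : theta f = angle n := by
  rw [theta, cState_eq_ket h, angle]
  congr 1
  simp [ket, aState, EuclideanSpace.inner_single_right]
  exact Real.sqrt_div_self

/-- The spectral form of A. The antisymmetric combination of |a⟩ and |b⟩ carries the factor sin 2θ,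
which the normalization of A removes; it is nonzero since `1 ≤ n`. -/
lemma gen_eq (hn : 1 ≤ n) (h : Marks f x₀) : gen f = (-(4 * (angle n : ℂ))) •
    (eigProj x₀ Complex.I - eigProj x₀ (-Complex.I)) := by
  have hs : (Real.sin (2 * angle n) : ℂ) ≠ 0 :=
    Complex.ofReal_ne_zero.2 (sin_two_mul_angle_pos hn).ne'
  rw [gen, theta_eq_angle h, outer_sub_outer hn h, smul_smul]
  congr 1
  field_simp
  rw [Complex.I_sq]
  ring

lemma evolution_eq_rotBy (hn : 1 ≤ n) (h : Marks f x₀) (t : ℝ) :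
    evolution f t = rotBy x₀ (4 * angle n * t) := by
  have hexp : (-(Complex.I * (t : ℂ))) • gen f =
      (Complex.I * ((4 * angle n * t : ℝ) : ℂ)) • eigProj x₀ Complex.I +
        (-(Complex.I * ((4 * angle n * t : ℝ) : ℂ))) • eigProj x₀ (-Complex.I) := by
    rw [gen_eq hn h]
    push_cast
    module
  rw [evolution, hexp, rotBy, exp_add_idempotents (eigProj_mul_self hn star_I_mul_I)
    (eigProj_mul_self hn star_neg_I_mul_neg_I) (eigProj_mul_eq_zero hn (by simp))
    (eigProj_mul_eq_zero hn (by simp))]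

lemma gen_isHermitian (hn : 1 ≤ n) (h : Marks f x₀) : (gen f).IsHermitian := by
  rw [Matrix.IsHermitian, gen_eq hn h, conjTranspose_smul, conjTranspose_sub,
    eigProj_conjTranspose, eigProj_conjTranspose]
  congr 1
  simp

lemma norm_aState (n : ℕ) : ‖aState n‖ = 1 := by
  have h : ‖aState n‖ ^ 2 = 1 := by
    rw [EuclideanSpace.norm_sq_eq]
    simp [aState]
  nlinarith [norm_nonneg (aState n)]

lemma norm_bState (h : Marks f x₀) : ‖bState f‖ = 1 := by
  have h : ‖bState f‖ ^ 2 = 1 := by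
    rw [EuclideanSpace.norm_sq_eq]
    have : ∀ x, ‖sign f x‖ = 1 := fun x => by rw [sign_of_marks h]; split_ifs <;> simp
    simp [bState, this]
  nlinarith [norm_nonneg (bState f)]

lemma act_oracleOp_aState (f : Bits (Fin n) → ZMod 2) : act (oracleOp f) (aState n) = bState f := by
  ext x
  simp [act, Matrix.toLpLin_apply, oracleOp, mulVec_diagonal, aState, bState, mul_comm]

end Plane

/-! ### Measurements -/

section Measurement

variable {n v : ℕ} {Q W : Type} [Fintype Q] [DecidableEq Q] [Fintype W] [DecidableEq W]

lemma withZeros_eq_toEuclideanLin (ψ : QState Q) :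
    (withZeros ψ : QState (Q ⊕ W)) = Matrix.toEuclideanLin (pad Q W) ψ := by
  rw [← pad_mulVec, Matrix.toLpLin_apply]

lemma norm_withZeros_sub (ψ χ : QState Q) :
    ‖(withZeros ψ : QState (Q ⊕ W)) - withZeros χ‖ = ‖ψ - χ‖ := by
  rw [withZeros_eq_toEuclideanLin, withZeros_eq_toEuclideanLin, ← map_sub,
    norm_toEuclideanLin_of_conjTranspose_mul_self pad_conjTranspose_mul_self]

lemma withZeros_ket (x : Bits Q) :
    (withZeros (ket x) : QState (Q ⊕ W)) = ket (Sum.elim x fun _ => false) := by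
  ext z
  simp only [withZeros, ket, PiLp.single_apply, eq_elim_iff]
  by_cases h : ∀ w, z (Sum.inr w) = false
  · simp only [h, and_true, if_true, implies_true]
    congr 1
    exact propext eq_comm
  · simp [h]

lemma zeroState_sum : zeroState (Q ⊕ W) = withZeros (zeroState Q) := by
  rw [zeroState, zeroState, withZeros_ket]
  congr 1
  funext q
  cases q <;> rfl

/-- On every outcome that does not show `x₀`, the target state has amplitude zero. The probability
of these outcomes is therefore part of the squared distance to the target, so the loss is ε² rather
than of order ε. -/
lemma one_sub_sq_le_findProb (c : Circuit n Q) (d : Fin n → Q) (f : Bits (Fin n) → ZMod 2)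
    {x₀ : Bits (Fin n)} {z₀ : Bits Q} (hz : (fun i => z₀ (d i)) = x₀) {ε : ℝ}
    (h : ‖act (circuitOp f c) (zeroState Q) - ket z₀‖ ≤ ε) : 1 - ε ^ 2 ≤ findProb c d f x₀ := by
  have hnorm : ‖act (circuitOp f c) (zeroState Q)‖ = 1 := by
    rw [norm_act_of_conjTranspose_mul_self (circuitOp_conjTranspose_mul_self f c)]
    simp [zeroState, ket]
  rw [findProb]
  generalize act (circuitOp f c) (zeroState Q) = φ at *
  have h1 : ∑ z, ‖φ z‖ ^ 2 = 1 := by rw [← EuclideanSpace.norm_sq_eq, hnorm, one_pow]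
  have h2 : ∑ z, ‖(φ - ket z₀) z‖ ^ 2 ≤ ε ^ 2 := by
    rw [← EuclideanSpace.norm_sq_eq]
    exact pow_le_pow_left₀ (norm_nonneg _) h 2
  have h3 : ∑ z, ‖φ z‖ ^ 2 ≤ ∑ z, ((if (fun i => z (d i)) = x₀ then ‖φ z‖ ^ 2 else 0) +
      ‖(φ - ket z₀) z‖ ^ 2) := by
    refine Finset.sum_le_sum fun z _ => ?_
    split_ifs with hzx
    · exact le_add_of_nonneg_right (by positivity)
    · have hne : z ≠ z₀ := by
        rintro rfl
        exact hzx hz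
      simp [ket, hne]
  rw [Finset.sum_add_distrib, h1] at h3
  linarith

lemma implements_of_mul_pad {c : Circuit n (Q ⊕ Fin v)} {f : Bits (Fin n) → ZMod 2} {M : QOp Q}
    (h : circuitOp f c * pad Q (Fin v) = pad Q (Fin v) * M) : Implements c f M 0 := by
  intro ψ
  rw [act_withZeros h]
  simp

lemma prepares_of_mul_pad {c : Circuit n (Q ⊕ Fin v)} {f : Bits (Fin n) → ZMod 2} {M : QOp Q}
    (h : circuitOp f c * pad Q (Fin v) = pad Q (Fin v) * M) :
    Prepares c f (act M (zeroState Q)) := by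
  rw [Prepares, zeroState_sum, act_withZeros h]

lemma implements_of_norm_sub_le {c : Circuit n (Q ⊕ Fin v)} {f : Bits (Fin n) → ZMod 2}
    {M M' : QOp Q} {ε : ℝ} (h : circuitOp f c * pad Q (Fin v) = pad Q (Fin v) * M)
    (hM : ∀ ψ, ‖act M ψ - act M' ψ‖ ≤ ε * ‖ψ‖) : Implements c f M' ε := by
  intro ψ
  rw [act_withZeros h, norm_withZeros_sub]
  exact hM ψ

lemma one_sub_sq_le_findProb_append {P V : Circuit n (Q ⊕ Fin v)} {d : Fin n → Q}
    {f : Bits (Fin n) → ZMod 2} {x₀ : Bits (Fin n)} {z₀ : Bits Q} {ψ : QState Q}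
    {ε : ℝ} (hz : (fun i => z₀ (d i)) = x₀) (hP : Prepares P f ψ)
    (hV : ‖act (circuitOp f V) (withZeros ψ) - withZeros (ket z₀)‖ ≤ ε) :
    1 - ε ^ 2 ≤ findProb (P ++ V) (fun i => Sum.inl (d i)) f x₀ := by
  refine one_sub_sq_le_findProb (z₀ := Sum.elim z₀ fun _ => false) _ _ f (by simpa using hz) ?_
  rwa [circuitOp_append, ← act_act, hP, ← withZeros_ket]

end Measurement

/-! ### Bounds for the angle and for the size of the circuits -/

section Bounds

variable {n : ℕ}

lemma one_div_sqrt_pos (n : ℕ) : 0 < 1 / √(2 ^ n : ℝ) := by positivity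

lemma one_div_sqrt_sq (n : ℕ) : (1 / √(2 ^ n : ℝ)) ^ 2 = 1 / 2 ^ n := by
  rw [div_pow, Real.sq_sqrt (by positivity), one_pow]

lemma pi_div_two_sub_angle_nonneg (n : ℕ) : 0 ≤ Real.pi / 2 - angle n := by
  have : angle n ≤ Real.pi / 2 := Real.arccos_le_pi_div_two.2 (one_div_sqrt_pos n).le
  linarith

lemma sin_pi_div_two_sub_angle (n : ℕ) : Real.sin (Real.pi / 2 - angle n) = 1 / √(2 ^ n) := by
  rw [Real.sin_pi_div_two_sub, cos_angle]

lemma one_div_sqrt_le (n : ℕ) : 1 / √(2 ^ n : ℝ) ≤ Real.pi / 2 - angle n := by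
  rw [← sin_pi_div_two_sub_angle]
  exact Real.sin_le (pi_div_two_sub_angle_nonneg n)

/-- With s = 1/√N the left side is y = arcsin s. Jordan's inequality bounds y by a multiple of s,
and the cubic lower bound for the sine then leaves an error of order s³, which is at most s² because
s ≤ 1. -/
lemma pi_div_two_sub_angle_le (n : ℕ) :
    Real.pi / 2 - angle n ≤ 1 / √(2 ^ n) + (1 / √(2 ^ n)) ^ 2 := by
  have hs := one_div_sqrt_pos n
  have hs1 := inv_sqrt_le_one n
  have hy := one_div_sqrt_le n
  have hsin := sin_pi_div_two_sub_angle n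
  have hangle : 0 ≤ angle n := Real.arccos_nonneg _
  have hjordan := Real.mul_le_sin (pi_div_two_sub_angle_nonneg n) (by linarith)
  have hcube := Real.sin_gt_sub_cube (x := Real.pi / 2 - angle n) (by linarith)
  rw [hsin] at hjordan hcube
  generalize Real.pi / 2 - angle n = y at *
  generalize 1 / √(2 ^ n : ℝ) = s at *
  have hpi := Real.pi_lt_d2
  -- The constant 1.6 is an upper bound for π/2.
  have hy2 : y ≤ 1.6 * s := by
    calc y = Real.pi / 2 * (2 / Real.pi * y) := by field_simp
      _ ≤ Real.pi / 2 * s := by gcongr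
      _ ≤ 1.6 * s := by gcongr; linarith
  have hy3 : y ^ 3 ≤ (1.6 * s) ^ 3 := pow_le_pow_left₀ (by linarith) hy2 3
  nlinarith [sq_nonneg s, mul_nonneg (sq_nonneg s) (sub_nonneg.2 hs1)]

lemma abs_angle_sub_le (n : ℕ) :
    |angle n - (Real.pi / 2 - 1 / √(2 ^ n))| ≤ 1 / 2 ^ n := by
  rw [← one_div_sqrt_sq, abs_le]
  have h1 := one_div_sqrt_le n
  have h2 := pi_div_two_sub_angle_le n
  constructor
  · linarith
  · nlinarith [sq_nonneg (1 / √(2 ^ n : ℝ))]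

lemma natCast_le_two_mul_log (n : ℕ) : (n : ℝ) ≤ 2 * Real.log (2 ^ n) := by
  rw [Real.log_pow]
  have := Real.log_two_gt_d9
  nlinarith [Nat.cast_nonneg (α := ℝ) n]

lemma one_le_sqrt_two_pow (n : ℕ) : 1 ≤ √(2 ^ n : ℝ) :=
  Real.one_le_sqrt.2 (one_le_pow₀ (by norm_num))

lemma time_rot_pow_le (hn : 1 ≤ n) {k : ℕ} (hk : (k : ℝ) ≤ 2 * √(2 ^ n)) :
    ((n + k * (8 * n + 4) : ℕ) : ℝ) ≤ 50 * (√(2 ^ n) * Real.log (2 ^ n)) := by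
  have hn' : (1 : ℝ) ≤ n := by exact_mod_cast hn
  have h1 := natCast_le_two_mul_log n
  have h2 := one_le_sqrt_two_pow n
  push_cast
  calc (n : ℝ) + k * (8 * n + 4) ≤ √(2 ^ n) * n + 2 * √(2 ^ n) * (12 * n) := by
        gcongr
        · nlinarith
        · linarith
    _ = 25 * (√(2 ^ n) * n) := by ring
    _ ≤ 25 * (√(2 ^ n) * (2 * Real.log (2 ^ n))) := by gcongr
    _ = _ := by ring

end Bounds

/-! ### Search by powers of the rotation -/

section Search

variable {n : ℕ}

lemma act_hadamardOp_zeroState (n : ℕ) : act (hadamardOp n) (zeroState (Fin n)) = aState n := by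
  ext x
  simp [act, Matrix.toLpLin_apply, zeroState, ket, aState, hadamardOp]

lemma exists_prepares_aState (n v : ℕ) : ∃ P : Circuit n (Fin n ⊕ Fin v), queries P = 0 ∧
    time P ≤ n ∧ ∀ f, Prepares P f (aState n) := by
  obtain ⟨P, h1, h2, h3⟩ := realizes_hadamardOp n v
  refine ⟨P, by omega, h2, fun f => ?_⟩
  rw [← act_hadamardOp_zeroState]
  exact prepares_of_mul_pad (h3 f)

lemma exists_prepares_bState (n v : ℕ) : ∃ P : Circuit n (Fin n ⊕ Fin v), time P ≤ n + 1 ∧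
    ∀ f, Prepares P f (bState f) := by
  obtain ⟨P, h1, h2, h3⟩ := (realizes_oracleOp n v).mul (realizes_hadamardOp n v)
  refine ⟨P, by omega, fun f => ?_⟩
  rw [← act_oracleOp_aState, ← act_hadamardOp_zeroState, act_act]
  exact prepares_of_mul_pad (h3 f)

lemma exists_prepare_and_rot_pow (hn : 1 ≤ n) {k : ℕ} (hk : (k : ℝ) ≤ 2 * √(2 ^ n)) :
    ∃ P V : Circuit n (Fin n ⊕ Fin (n + 1)),
      (queries (P ++ V) : ℝ) ≤ 4 * √(2 ^ n) ∧
      (time (P ++ V) : ℝ) ≤ 50 * (√(2 ^ n) * Real.log (2 ^ n)) ∧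
      (∀ f, Prepares P f (aState n)) ∧
      ∀ f, circuitOp f V * pad (Fin n) (Fin (n + 1)) = pad (Fin n) (Fin (n + 1)) * rot f ^ k := by
  obtain ⟨P, hP1, hP2, hP3⟩ := exists_prepares_aState n (n + 1)
  obtain ⟨V, hV1, hV2, hV3⟩ := (realizes_rot (Nat.lt_succ_self n)).pow k
  refine ⟨P, V, ?_, ?_, hP3, hV3⟩
  · have : (queries V : ℝ) ≤ k * 2 := by exact_mod_cast hV1
    rw [queries_append, hP1, zero_add]
    linarith
  · refine le_trans ?_ (time_rot_pow_le hn hk)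
    rw [time, List.length_append]
    exact_mod_cast add_le_add hP2 hV2

/-- Modulo 2π, R rotates by -δ and the evolution by -τ, with δ of order 1/√N. The integer part of
τ/δ is the exponent: the angles then differ by less than δ ≤ 8/√N, and the Lipschitz constant 2
gives 16/√N. -/
lemma exists_rot_pow_near_evolution (hn : 1 ≤ n) {t : ℝ} (ht0 : 0 ≤ t) (ht1 : t ≤ 1) :
    ∃ k : ℕ, (k : ℝ) ≤ 2 * √(2 ^ n) ∧ ∀ (f : Bits (Fin n) → ZMod 2) (x₀ : Bits (Fin n)),
      Marks f x₀ → ∀ ψ, ‖act (rot f ^ k) ψ - act (evolution f t) ψ‖ ≤ 16 / √(2 ^ n) * ‖ψ‖ := by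
  have hs := one_div_sqrt_pos n
  have hs1 := inv_sqrt_le_one n
  have hy := one_div_sqrt_le n
  have hy' := pi_div_two_sub_angle_le n
  have hangle : 0 ≤ angle n := Real.arccos_nonneg _
  set δ := 2 * Real.pi - 4 * angle n with hδ
  set τ := 2 * Real.pi - 4 * angle n * t with hτ
  have hδ1 : 4 * (1 / √(2 ^ n)) ≤ δ := by linarith
  have hδ2 : δ ≤ 8 * (1 / √(2 ^ n)) := by nlinarith
  have hδ0 : 0 < δ := by linarith
  have hτ0 : 0 ≤ τ := by nlinarith
  have hτ1 : τ ≤ 2 * Real.pi := by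
    have : 0 ≤ 4 * angle n * t := by positivity
    linarith
  have hk1 : (⌊τ / δ⌋₊ : ℝ) ≤ τ / δ := Nat.floor_le (by positivity)
  have hk2 : τ / δ < ⌊τ / δ⌋₊ + 1 := Nat.lt_floor_add_one _
  refine ⟨⌊τ / δ⌋₊, ?_, fun f x₀ h ψ => ?_⟩
  -- Since τ ≤ 2π and δ ≥ 4/√N, the exponent is at most (π/2)√N.
  · refine hk1.trans ?_
    rw [div_le_iff₀ hδ0]
    have hpi := Real.pi_lt_four
    have hsq : √(2 ^ n : ℝ) * (1 / √(2 ^ n)) = 1 := by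
      rw [mul_one_div, div_self]
      positivity
    nlinarith [one_le_sqrt_two_pow n]
  · generalize ⌊τ / δ⌋₊ = k at *
    rw [le_div_iff₀ hδ0] at hk1
    rw [div_lt_iff₀ hδ0] at hk2
    rw [rot_eq_rotBy hn h, rotBy_pow hn, evolution_eq_rotBy hn h,
      -- Each of the `k` rotations falls short of a full turn by δ, while the target falls short of
      -- one full turn by τ; `k - 1` turns align the two.
      ← rotBy_add_int_mul_two_pi (4 * angle n * t) ((k : ℤ) - 1)]
    refine (norm_act_rotBy_sub_le hn _ _ ψ).trans ?_
    gcongr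
    have : (k : ℝ) * (4 * angle n) - (4 * angle n * t + (((k : ℤ) - 1 : ℤ) : ℝ) *
        (2 * Real.pi)) = τ - k * δ := by
      rw [hτ, hδ]
      push_cast
      ring
    rw [this, abs_of_nonneg (by linarith)]
    have h16 : 16 / √(2 ^ n : ℝ) = 16 * (1 / √(2 ^ n)) := by ring
    rw [h16]
    linarith

/-- Modulo 2π the rotations go backwards by 4y each, where y = π/2 - θ, and the angle θ is reached
when (4k - 1) y = 3π/2. The equation for `l` replaces y by 1/√N. Rounding `l` down and this
replacement both cost O(1/√N). -/
lemma norm_rot_pow_floor_sub_le (hn : 1 ≤ n) {l : ℝ}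
    (hl : (4 * l - 1) / √(2 ^ n) = (2 * 1 - 1 / 2) * Real.pi)
    {f : Bits (Fin n) → ZMod 2} {x₀ : Bits (Fin n)} (h : Marks f x₀) :
    ‖act (rot f ^ ⌊l⌋₊) (aState n) - ket x₀‖ ≤ 18 / √(2 ^ n) := by
  have hs := one_div_sqrt_pos n
  have hs1 := inv_sqrt_le_one n
  have hy := one_div_sqrt_le n
  have hy' := pi_div_two_sub_angle_le n
  have hl' : (4 * l - 1) * (1 / √(2 ^ n)) = 3 / 2 * Real.pi := by
    rw [mul_one_div, hl]; ring
  have hl0 : 0 ≤ l := by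
    have hpi := Real.pi_pos
    by_contra hneg
    nlinarith
  have hk1 : (⌊l⌋₊ : ℝ) ≤ l := Nat.floor_le hl0
  have hk2 : l < ⌊l⌋₊ + 1 := Nat.lt_floor_add_one _
  have hk0 : (0 : ℝ) ≤ ⌊l⌋₊ := Nat.cast_nonneg _
  generalize ⌊l⌋₊ = k at *
  rw [← act_rotBy_angle_aState (x₀ := x₀) hn, rot_eq_rotBy hn h, rotBy_pow hn,
    ← rotBy_add_int_mul_two_pi (angle n) ((k : ℤ) - 1)]
  refine (norm_act_rotBy_sub_le hn _ _ _).trans ?_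
  have hrw : (k : ℝ) * (4 * angle n) - (angle n + (((k : ℤ) - 1 : ℤ) : ℝ) * (2 * Real.pi)) =
      3 / 2 * Real.pi - (4 * k - 1) * (Real.pi / 2 - angle n) := by
    push_cast
    ring
  have h18 : 18 / √(2 ^ n : ℝ) = 18 * (1 / √(2 ^ n)) := by ring
  rw [hrw, norm_aState, h18, mul_one]
  generalize Real.pi / 2 - angle n = y at *
  generalize 1 / √(2 ^ n : ℝ) = s at *
  have hpi := Real.pi_lt_d2
  have hys : 0 ≤ y - s := by linarith
  have h3 : (4 * (k : ℝ) - 1) * s ≤ 5 := by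
    have : (4 * (k : ℝ) - 1) * s ≤ (4 * l - 1) * s := by gcongr
    linarith
  have h4 : (4 * (k : ℝ) - 1) * (y - s) ≤ 5 * s := by
    rcases le_total 0 (4 * (k : ℝ) - 1) with hc | hc
    · calc (4 * (k : ℝ) - 1) * (y - s) ≤ (4 * (k : ℝ) - 1) * s ^ 2 := by
            gcongr; linarith
        _ = (4 * (k : ℝ) - 1) * s * s := by ring
        _ ≤ 5 * s := by gcongr
    -- This covers `k = 0`, where the factor 4k - 1 is negative.
    · nlinarith
  have h5 : -s ≤ (4 * (k : ℝ) - 1) * (y - s) := by nlinarith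
  have h6 : 3 / 2 * Real.pi - (4 * k - 1) * y =
      4 * (l - k) * s - (4 * (k : ℝ) - 1) * (y - s) := by
    rw [← hl']; ring
  have h7 : 4 * (l - k) * s ≤ 4 * s := by nlinarith
  have h8 : 0 ≤ 4 * (l - k) * s := by
    have : 0 ≤ l - k := by linarith
    positivity
  rw [h6]
  -- At most 4s comes from the rounding and 5s from y - s ≤ s², since (4k - 1)s ≤ 3π/2 < 5. The
  -- Lipschitz constant doubles 9 to 18.
  have : |4 * (l - k) * s - (4 * (k : ℝ) - 1) * (y - s)| ≤ 9 * s := by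
    rw [abs_le]; constructor <;> linarith
  linarith

lemma floor_le_of_eq (n : ℕ) {l : ℝ}
    (hl : (4 * l - 1) / √(2 ^ n) = (2 * 1 - 1 / 2) * Real.pi) :
    (⌊l⌋₊ : ℝ) ≤ 2 * √(2 ^ n) := by
  have h1 := one_le_sqrt_two_pow n
  have hpi := Real.pi_lt_d2
  have hpi0 := Real.pi_pos
  rw [div_eq_iff (by positivity)] at hl
  have hl0 : 0 ≤ l := by nlinarith
  refine (Nat.floor_le hl0).trans ?_
  nlinarith

end Search

/-! ### The error of phase estimation -/

section Chord

/-- The distance of `e^{ix}` from `1`. -/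
def chord (x : ℝ) : ℝ := ‖Complex.exp (Complex.I * x) - 1‖

lemma chord_eq (x : ℝ) : chord x = 2 * |Real.sin (x / 2)| := by
  rw [chord, Complex.norm_exp_I_mul_ofReal_sub_one, Real.norm_eq_abs, abs_mul, abs_two]

lemma chord_neg (x : ℝ) : chord (-x) = chord x := by
  rw [chord_eq, chord_eq, neg_div, Real.sin_neg, abs_neg]

lemma chord_add_int_mul_two_pi (x : ℝ) (k : ℤ) : chord (x + k * (2 * Real.pi)) = chord x := by
  have h : Complex.exp (Complex.I * ((x + k * (2 * Real.pi) : ℝ) : ℂ)) =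
      Complex.exp (Complex.I * x) := by
    rw [Complex.exp_eq_exp_iff_exists_int]
    exact ⟨k, by push_cast; ring⟩
  rw [chord, h, chord]

lemma chord_nonneg (x : ℝ) : 0 ≤ chord x := norm_nonneg _

lemma norm_exp_sub_exp (s t : ℝ) :
    ‖Complex.exp (Complex.I * s) - Complex.exp (Complex.I * t)‖ = chord (s - t) := by
  have h : Complex.exp (Complex.I * s) - Complex.exp (Complex.I * t) =
      Complex.exp (Complex.I * t) * (Complex.exp (Complex.I * ((s - t : ℝ) : ℂ)) - 1) := by
    rw [mul_sub, ← Complex.exp_add]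
    congr 2
    · push_cast; ring
    · ring
  rw [h, norm_mul, mul_comm Complex.I (t : ℂ), Complex.norm_exp_ofReal_mul_I, one_mul, chord]

/-- The sine is increasing on [0, π/2]. This is why the branch matters: an estimate within π of the
phase has a quarter whose error is no larger than the error of the phase on the circle. -/
lemma chord_div_four_le {x : ℝ} (hx : |x| ≤ Real.pi) : chord (x / 4) ≤ chord x := by
  have key : ∀ y : ℝ, 0 ≤ y → y ≤ Real.pi → chord (y / 4) ≤ chord y := by
    intro y h0 h1
    rw [chord_eq, chord_eq, abs_of_nonneg, abs_of_nonneg]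
    · gcongr
      exact Real.sin_le_sin_of_le_of_le_pi_div_two (by linarith) (by linarith) (by linarith)
    · exact Real.sin_nonneg_of_nonneg_of_le_pi (by linarith) (by linarith)
    · exact Real.sin_nonneg_of_nonneg_of_le_pi (by linarith) (by linarith)
  rcases abs_le.1 hx with ⟨h1, h2⟩
  rcases le_total 0 x with h | h
  · exact key x h h2
  · have := key (-x) (by linarith) (by linarith)
    rwa [neg_div, chord_neg, chord_neg] at this

lemma chord_le_two (x : ℝ) : chord x ≤ 2 := by
  rw [chord_eq]
  linarith [Real.abs_sin_le_one (x / 2)]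

/-- Up to π Jordan's inequality applies directly, beyond π it is applied to the supplement. The
range 5π/3 is π for a half circle of outcomes plus 2π/3 for the gap δ. -/
lemma div_nine_le_chord {x : ℝ} (h0 : 0 ≤ x) (h1 : x ≤ 5 / 3 * Real.pi) : x / 9 ≤ chord x := by
  have hpi := Real.pi_lt_d2
  have hpi' := Real.pi_gt_three
  have h2 : 0 ≤ Real.sin (x / 2) :=
    Real.sin_nonneg_of_nonneg_of_le_pi (by linarith) (by linarith)
  have hc : 1 / 2 ≤ 2 / Real.pi := by rw [div_le_div_iff₀] <;> linarith
  rw [chord_eq, abs_of_nonneg h2]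
  rcases le_total x Real.pi with h | h
  · have := Real.mul_le_sin (x := x / 2) (by linarith) (by linarith)
    nlinarith
  · have h3 := Real.mul_le_sin (x := Real.pi - x / 2) (by linarith) (by linarith)
    rw [Real.sin_pi_sub] at h3
    have h4 : 1 / 3 ≤ 2 / Real.pi * (Real.pi - x / 2) := by
      calc 1 / 3 = 2 / Real.pi * (Real.pi / 6) := by field_simp; norm_num
        _ ≤ _ := by gcongr; linarith
    linarith

end Chord

/-! ### Amplitudes of the outcomes of phase estimation and the mean square error of the quarter
phase. -/

section Amplitudes

variable {m : ℕ}

lemma ofBits_injective : Function.Injective (Nat.ofBits : Bits (Fin m) → ℕ) := by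
  intro j j' h
  funext i
  rw [← Nat.testBit_ofBits_lt j i i.2, ← Nat.testBit_ofBits_lt j' i i.2, h]

lemma sum_ofBits (g : ℕ → ℂ) : ∑ j : Bits (Fin m), g (Nat.ofBits j) =
    ∑ k ∈ Finset.range (2 ^ m), g k := by
  have h : Finset.univ.image (Nat.ofBits : Bits (Fin m) → ℕ) = Finset.range (2 ^ m) := by
    refine Finset.eq_of_subset_of_card_le (fun k hk => ?_) ?_
    · obtain ⟨j, -, rfl⟩ := Finset.mem_image.1 hk
      exact Finset.mem_range.2 (Nat.ofBits_lt_two_pow j)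
    · rw [Finset.card_image_of_injective _ ofBits_injective]
      simp
  rw [← h, Finset.sum_image fun j _ j' _ hjj' => ofBits_injective hjj']

/-- The phase, in `[0, 2π)`, that an outcome of phase estimation stands for. -/
def gridPhase (m : ℕ) (j : Bits (Fin m)) : ℝ := 2 * Real.pi * Nat.ofBits j / 2 ^ m

/-- The amplitude of the outcome `j` of the estimation of the phase `φ`. -/
def amplitude (m : ℕ) (φ : ℝ) (j : Bits (Fin m)) : ℂ :=
  1 / 2 ^ m * ∑ k ∈ Finset.range (2 ^ m), Complex.exp (Complex.I * ((φ - gridPhase m j : ℝ) : ℂ)) ^ k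

/-- The amplitude is a geometric sum: multiplied by e^{ix} - 1 it telescopes to a difference of two
numbers of modulus 1, divided by 2^m. -/
lemma chord_mul_norm_amplitude_le (φ : ℝ) (j : Bits (Fin m)) :
    chord (φ - gridPhase m j) * ‖amplitude m φ j‖ ≤ 2 / 2 ^ m := by
  rw [amplitude, chord, norm_mul, mul_left_comm, ← norm_mul, mul_geom_sum, norm_div, norm_one,
    norm_pow, Complex.norm_two, div_mul_eq_mul_div, one_mul]
  gcongr
  refine (norm_sub_le _ _).trans ?_
  rw [norm_pow, mul_comm Complex.I, Complex.norm_exp_ofReal_mul_I]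
  norm_num

lemma qftOp_conjTranspose_mulVec (φ : ℝ) (j : Bits (Fin m)) :
    ((qftOp m)ᴴ *ᵥ fun k => Complex.exp (Complex.I * φ) ^ Nat.ofBits k *
      (1 / ((√(2 ^ m : ℝ) : ℝ) : ℂ))) j = amplitude m φ j := by
  rw [amplitude, ← sum_ofBits fun k => Complex.exp (Complex.I * ((φ - gridPhase m j : ℝ) : ℂ)) ^ k,
    Finset.mul_sum, Matrix.mulVec, dotProduct]
  refine Finset.sum_congr rfl fun k _ => ?_
  have hs : ((√(2 ^ m : ℝ) : ℝ) : ℂ) * ((√(2 ^ m : ℝ) : ℝ) : ℂ) = 2 ^ m := by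
    rw [← Complex.ofReal_mul, Real.mul_self_sqrt (by positivity)]
    push_cast
    rfl
  have hexp : star (Complex.exp (2 * Real.pi * Complex.I * (Nat.ofBits k : ℂ) *
      (Nat.ofBits j : ℂ) / 2 ^ m)) * Complex.exp (Complex.I * φ) ^ Nat.ofBits k =
      Complex.exp (Complex.I * ((φ - gridPhase m j : ℝ) : ℂ)) ^ Nat.ofBits k := by
    rw [Complex.star_def, ← Complex.exp_conj, ← Complex.exp_nat_mul, ← Complex.exp_nat_mul,
      ← Complex.exp_add, gridPhase]
    congr 1
    simp only [map_div₀, map_mul, map_pow, Complex.conj_I, Complex.conj_ofReal, Complex.conj_ofNat,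
      Complex.conj_natCast]
    push_cast
    ring
  rw [conjTranspose_apply, qftOp, ← hexp, ← hs, star_mul', star_div₀, star_one, Complex.star_def,
    Complex.conj_ofReal]
  ring

lemma exp_phaseValue (j : Bits (Fin m)) : ∃ k : ℤ,
    phaseValue m j = gridPhase m j + k * (2 * Real.pi) := by
  rw [phaseValue, gridPhase]
  split_ifs with h1 h2
  · exact ⟨0, by simp [h1]⟩
  · exact ⟨-1, by push_cast; ring⟩
  · exact ⟨0, by simp⟩

/-- The mean square error of the phase factor `e^{iφ/4}`. -/
def phaseError (m : ℕ) (φ : ℝ) : ℝ :=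
  ∑ j : Bits (Fin m), chord ((phaseValue m j - φ) / 4) ^ 2 * ‖amplitude m φ j‖ ^ 2

/-- Telescoping, since 1/(L + r)² ≤ 1/(L + r - 1) - 1/(L + r). -/
lemma sum_inv_sq_le {L : ℝ} (hL : 1 < L) (K : ℕ) :
    ∑ r ∈ Finset.range K, 1 / (L + r) ^ 2 ≤ 1 / (L - 1) - 1 / (L - 1 + K) := by
  induction K with
  | zero => simp
  | succ K ih =>
    rw [Finset.sum_range_succ]
    have hK : (0 : ℝ) ≤ K := Nat.cast_nonneg K
    have h1 : 0 < L - 1 + K := by linarith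
    have h2 : 0 < L + K := by linarith
    have key : 1 / (L + K) ^ 2 ≤ 1 / (L - 1 + K) - 1 / (L - 1 + (K + 1 : ℕ)) := by
      push_cast
      rw [show L - 1 + ((K : ℝ) + 1) = L + K by ring, div_sub_div _ _ h1.ne' h2.ne',
        div_le_div_iff₀ (by positivity) (by positivity)]
      nlinarith
    linarith

/-- The outcomes in `good` are read in the branch of `φ`. Each contributes at most (2/2^m)², and
there are at most 2^m of them. The others have an error factor of at most 2, but `r` numbers them by
their distance from `φ`, so their amplitudes decay like 1/(L + r) and the squares sum to O(1/(L -
1)). -/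
lemma phaseError_le {φ L : ℝ} (hL : 1 < L) (good : Bits (Fin m) → Prop) (r : Bits (Fin m) → ℕ)
    (hgood : ∀ j, good j → |phaseValue m j - φ| ≤ Real.pi)
    (hr : ∀ j, ¬ good j → r j < 2 ^ m)
    (hinj : ∀ j j', ¬ good j → ¬ good j' → r j = r j' → j = j')
    (hbad : ∀ j, ¬ good j → (L + r j) / (9 * 2 ^ m) ≤ chord (φ - gridPhase m j)) :
    phaseError m φ ≤ 4 / 2 ^ m + 1296 / (L - 1) := by
  classical
  have h2m : (0 : ℝ) < 2 ^ m := by positivity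
  have hterm : ∀ j, chord ((phaseValue m j - φ) / 4) ^ 2 * ‖amplitude m φ j‖ ^ 2 ≤
      4 / (2 ^ m) ^ 2 + if good j then 0 else 1296 * (1 / (L + r j) ^ 2) := by
    intro j
    have hamp := chord_mul_norm_amplitude_le φ j
    rw [← mul_pow]
    split_ifs with hj
    · obtain ⟨k, hk⟩ := exp_phaseValue j
      have h1 : chord ((phaseValue m j - φ) / 4) ≤ chord (φ - gridPhase m j) := by
        refine (chord_div_four_le (hgood j hj)).trans (le_of_eq ?_)
        rw [hk, show gridPhase m j + k * (2 * Real.pi) - φ =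
          -(φ - gridPhase m j) + k * (2 * Real.pi) by ring, chord_add_int_mul_two_pi, chord_neg]
      have h2 : chord ((phaseValue m j - φ) / 4) * ‖amplitude m φ j‖ ≤ 2 / 2 ^ m :=
        (mul_le_mul_of_nonneg_right h1 (norm_nonneg _)).trans hamp
      calc _ ≤ (2 / 2 ^ m : ℝ) ^ 2 :=
            pow_le_pow_left₀ (mul_nonneg (chord_nonneg _) (norm_nonneg _)) h2 2
        _ = _ := by rw [div_pow]; norm_num
    · have hLr : 0 < L + r j := by positivity
      -- The quotient of 2/2^m by (L + r)/(9 · 2^m); together with the chord bound 2 it gives 36² =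
      -- 1296.
      have h1 : ‖amplitude m φ j‖ ≤ 18 / (L + r j) := by
        have h3 := mul_le_mul_of_nonneg_right (hbad j hj) (norm_nonneg (amplitude m φ j))
        have h4 := h3.trans hamp
        rw [le_div_iff₀ hLr]
        rw [div_mul_eq_mul_div, div_le_div_iff₀ (by positivity) h2m] at h4
        nlinarith
      have h2 : chord ((phaseValue m j - φ) / 4) * ‖amplitude m φ j‖ ≤ 2 * (18 / (L + r j)) := by
        gcongr
        exact chord_le_two _
      calc _ ≤ (2 * (18 / (L + r j))) ^ 2 :=
            pow_le_pow_left₀ (mul_nonneg (chord_nonneg _) (norm_nonneg _)) h2 2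
        _ = 1296 * (1 / (L + r j) ^ 2) := by field_simp; norm_num
        _ ≤ _ := le_add_of_nonneg_left (by positivity)
  refine (Finset.sum_le_sum fun j _ => hterm j).trans ?_
  rw [Finset.sum_add_distrib]
  refine add_le_add (le_of_eq ?_) ?_
  · simp
    field_simp
  · have h1 : ∑ j, (if good j then 0 else 1296 * (1 / (L + r j) ^ 2)) =
        ∑ j ∈ Finset.univ.filter fun j => ¬ good j, 1296 * (1 / (L + r j) ^ 2) := by
      rw [Finset.sum_filter]
      exact Finset.sum_congr rfl fun j _ => by split_ifs <;> rfl
    rw [h1, ← Finset.mul_sum]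
    have h2 : ∑ j ∈ Finset.univ.filter (fun j => ¬ good j), 1 / (L + r j) ^ 2 ≤
        ∑ k ∈ Finset.range (2 ^ m), 1 / (L + k) ^ 2 := by
      rw [← Finset.sum_image (f := fun k : ℕ => 1 / (L + k) ^ 2)
        fun j hj j' hj' h => hinj j j' (by simpa using hj) (by simpa using hj') h]
      refine Finset.sum_le_sum_of_subset_of_nonneg (fun k hk => ?_) fun k _ _ => by positivity
      obtain ⟨j, hj, rfl⟩ := Finset.mem_image.1 hk
      exact Finset.mem_range.2 (hr j (by simpa using hj))
    have h3 := sum_inv_sq_le hL (2 ^ m)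
    have h4 : 0 ≤ 1 / (L - 1 + ((2 ^ m : ℕ) : ℝ)) := by
      have : 0 < L - 1 := by linarith
      positivity
    have h5 : (1296 : ℝ) / (L - 1) = 1296 * (1 / (L - 1)) := by ring
    rw [h5]
    gcongr
    linarith

lemma two_pi_mul_grid_le {J : ℕ} (hJ : 2 * J ≤ 2 ^ m) :
    2 * Real.pi * J / 2 ^ m ≤ Real.pi := by
  rw [div_le_iff₀ (by positivity)]
  have : (2 * J : ℝ) ≤ 2 ^ m := by exact_mod_cast hJ
  nlinarith [Real.pi_pos]

lemma le_two_pi_mul_grid {J : ℕ} (hJ : 2 ^ m ≤ 2 * J) :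
    Real.pi ≤ 2 * Real.pi * J / 2 ^ m := by
  rw [le_div_iff₀ (by positivity)]
  have : (2 ^ m : ℝ) ≤ 2 * J := by exact_mod_cast hJ
  nlinarith [Real.pi_pos]

lemma two_pi_mul_grid_le_two_pi {J : ℕ} (hJ : J ≤ 2 ^ m) :
    2 * Real.pi * J / 2 ^ m ≤ 2 * Real.pi := by
  rw [div_le_iff₀ (by positivity)]
  have : (J : ℝ) ≤ 2 ^ m := by exact_mod_cast hJ
  nlinarith [Real.pi_pos]

/-- An outcome `r` grid steps beyond the phase 0 is at distance δ + 2πr/2^m, which is at least (L +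
r)/2^m. -/
lemma le_chord_of_far {δ L : ℝ} (hδ : δ ≤ 2 / 3 * Real.pi) (hδ0 : 0 ≤ δ) (hL : L ≤ 2 ^ m * δ)
    {r : ℕ} (hr : 2 * r ≤ 2 ^ m) :
    (L + r) / (9 * 2 ^ m) ≤ chord (δ + 2 * Real.pi * r / 2 ^ m) := by
  have h2m : (0 : ℝ) < 2 ^ m := by positivity
  have h0 : 0 ≤ 2 * Real.pi * r / 2 ^ m := by positivity
  have h1 := two_pi_mul_grid_le hr
  refine le_trans ?_ (div_nine_le_chord (by linarith) (by linarith))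
  rw [div_le_div_iff₀ (by positivity) (by norm_num)]
  have h3 : 2 * Real.pi * r / 2 ^ m * 2 ^ m = 2 * Real.pi * r := by field_simp
  have hr0 : (0 : ℝ) ≤ r := Nat.cast_nonneg r
  nlinarith [Real.pi_gt_three]

/-- The phase 4θ. The wrong branch is the lower half of the outcomes, including 0, and these are
numbered by their own value. -/
lemma phaseError_two_pi_sub_le {δ L : ℝ} (hL1 : 1 < L) (hδ0 : 0 ≤ δ) (hδ : δ ≤ 2 / 3 * Real.pi)
    (hL : L ≤ 2 ^ m * δ) : phaseError m (2 * Real.pi - δ) ≤ 4 / 2 ^ m + 1296 / (L - 1) := by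
  have hpi := Real.pi_pos
  refine phaseError_le hL1 (fun j => 2 ^ m ≤ 2 * Nat.ofBits j) Nat.ofBits (fun j hj => ?_)
    (fun j _ => Nat.ofBits_lt_two_pow j) (fun j j' _ _ h => ofBits_injective h) fun j hj => ?_
  · have hj0 : Nat.ofBits j ≠ 0 := by
      intro h0
      rw [h0] at hj
      simp at hj
    rw [phaseValue, if_neg hj0, if_neg (by omega), abs_le]
    have h1 := le_two_pi_mul_grid hj
    have h2 := two_pi_mul_grid_le_two_pi (Nat.ofBits_lt_two_pow j).le
    constructor <;> linarith
  · rw [gridPhase, show 2 * Real.pi - δ - 2 * Real.pi * Nat.ofBits j / 2 ^ m =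
      -(δ + 2 * Real.pi * Nat.ofBits j / 2 ^ m) + (1 : ℤ) * (2 * Real.pi) by push_cast; ring,
      chord_add_int_mul_two_pi, chord_neg]
    exact le_chord_of_far hδ hδ0 hL (by omega)

/-- The phase -4θ. The wrong branch consists of the outcome 0 and the upper half, which is counted
downwards from 2^m; the number 0 remains free for the outcome 0. -/
lemma phaseError_sub_two_pi_le {δ L : ℝ} (hL1 : 1 < L) (hδ0 : 0 ≤ δ) (hδ : δ ≤ 2 / 3 * Real.pi)
    (hL : L ≤ 2 ^ m * δ) : phaseError m (δ - 2 * Real.pi) ≤ 4 / 2 ^ m + 1296 / (L - 1) := by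
  have hpi := Real.pi_pos
  refine phaseError_le hL1 (fun j => Nat.ofBits j ≠ 0 ∧ 2 * Nat.ofBits j < 2 ^ m)
    (fun j => if Nat.ofBits j = 0 then 0 else 2 ^ m - Nat.ofBits j) (fun j hj => ?_)
    (fun j hj => ?_) (fun j j' hj hj' h => ?_) fun j hj => ?_
  · rw [phaseValue, if_neg hj.1, if_pos hj.2, abs_le]
    have h1 := two_pi_mul_grid_le hj.2.le
    have h2 : 0 ≤ 2 * Real.pi * Nat.ofBits j / 2 ^ m := by positivity
    constructor <;> linarith
  · have := Nat.ofBits_lt_two_pow j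
    split_ifs with h0
    · positivity
    · omega
  · have h1 := Nat.ofBits_lt_two_pow j
    have h2 := Nat.ofBits_lt_two_pow j'
    refine ofBits_injective ?_
    split_ifs at h <;> omega
  · by_cases h0 : Nat.ofBits j = 0
    · have := le_chord_of_far hδ hδ0 hL (r := 0) (by simp)
      rw [gridPhase, if_pos h0, h0, show δ - 2 * Real.pi - 2 * Real.pi * ((0 : ℕ) : ℝ) / 2 ^ m =
        δ + 2 * Real.pi * ((0 : ℕ) : ℝ) / 2 ^ m + (-1 : ℤ) * (2 * Real.pi) by push_cast; ring,
        chord_add_int_mul_two_pi]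
      exact this
    · have hlt := Nat.ofBits_lt_two_pow j
      have := le_chord_of_far hδ hδ0 hL (r := 2 ^ m - Nat.ofBits j) (by omega)
      rw [gridPhase, if_neg h0, show δ - 2 * Real.pi - 2 * Real.pi * Nat.ofBits j / 2 ^ m =
        δ + 2 * Real.pi * ((2 ^ m - Nat.ofBits j : ℕ) : ℝ) / 2 ^ m + (-2 : ℤ) * (2 * Real.pi) by
          rw [Nat.cast_sub hlt.le]
          push_cast
          field_simp
          ring, chord_add_int_mul_two_pi]
      exact this

end Amplitudes

/-! ### Phase estimation on eigenvectors and the resulting search state. -/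

section Estimation

variable {n m : ℕ}

/-- The product of two vectors. -/
def tensorVec {X J : Type} (v : X → ℂ) (w : J → ℂ) : X × J → ℂ := fun p => v p.1 * w p.2

lemma one_kronecker_mulVec_tensorVec {X J : Type} [Fintype X] [DecidableEq X] [Fintype J]
    (M : Matrix J J ℂ) (v : X → ℂ) (w : J → ℂ) :
    ((1 : Matrix X X ℂ) ⊗ₖ M) *ᵥ tensorVec v w = tensorVec v (M *ᵥ w) := by
  ext ⟨x, j⟩
  simp only [Matrix.mulVec, dotProduct, kroneckerMap_apply, tensorVec, Fintype.sum_prod_type]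
  rw [Finset.sum_eq_single x]
  · simp only [one_apply_eq, one_mul, Finset.mul_sum]
    exact Finset.sum_congr rfl fun k _ => by ring
  · intro y _ hy
    simp [one_apply_ne hy.symm]
  · simp

lemma pow_mulVec_eigenvector {X : Type} [Fintype X] [DecidableEq X] {U : Matrix X X ℂ}
    {v : X → ℂ} {μ : ℂ} (h : U *ᵥ v = μ • v) (k : ℕ) : (U ^ k) *ᵥ v = μ ^ k • v := by
  induction k with
  | zero => simp
  | succ k ih =>
    rw [pow_succ, ← Matrix.mulVec_mulVec, h, Matrix.mulVec_smul, ih, smul_smul, pow_succ, mul_comm]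

lemma controlledPow_mulVec_tensorVec {X : Type} [Fintype X] [DecidableEq X] {U : Matrix X X ℂ}
    {v : X → ℂ} {μ : ℂ} (h : U *ᵥ v = μ • v) (w : Bits (Fin m) → ℂ) :
    controlledPow m U *ᵥ tensorVec v w = tensorVec v fun j => μ ^ Nat.ofBits j * w j := by
  ext ⟨x, j⟩
  have hx := congrFun (pow_mulVec_eigenvector h (Nat.ofBits j)) x
  simp only [Matrix.mulVec, dotProduct, Pi.smul_apply, smul_eq_mul] at hx
  simp only [Matrix.mulVec, dotProduct, controlledPow, tensorVec, Fintype.sum_prod_type,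
    ite_mul, zero_mul, Finset.sum_ite_eq, Finset.mem_univ, if_true]
  calc _ = (∑ y, (U ^ Nat.ofBits j) x y * v y) * w j := by
        rw [Finset.sum_mul]
        exact Finset.sum_congr rfl fun y _ => by ring
    _ = _ := by rw [hx]; ring

lemma hadamardOp_mulVec_single :
    hadamardOp m *ᵥ Pi.single (fun _ => false) 1 = fun _ => 1 / ((√(2 ^ m : ℝ) : ℝ) : ℂ) := by
  ext j
  simp [hadamardOp]

lemma phaseEstimation_mulVec {X : Type} [Fintype X] [DecidableEq X] {U : Matrix X X ℂ}
    {v : X → ℂ} {φ : ℝ} (h : U *ᵥ v = Complex.exp (Complex.I * φ) • v) :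
    phaseEstimation m U *ᵥ tensorVec v (Pi.single (fun _ => false) 1) =
      tensorVec v (amplitude m φ) := by
  rw [phaseEstimation, ← Matrix.mulVec_mulVec, ← Matrix.mulVec_mulVec,
    one_kronecker_mulVec_tensorVec, hadamardOp_mulVec_single, controlledPow_mulVec_tensorVec h,
    one_kronecker_mulVec_tensorVec]
  congr 1
  funext j
  exact qftOp_conjTranspose_mulVec φ j

lemma norm_sq_tensorVec {X J : Type} [Fintype X] [Fintype J] (v : X → ℂ) (w : J → ℂ) :
    ‖(WithLp.toLp 2 (tensorVec v w) : EuclideanSpace ℂ (X × J))‖ ^ 2 =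
      ‖(WithLp.toLp 2 v : EuclideanSpace ℂ X)‖ ^ 2 * ∑ j, ‖w j‖ ^ 2 := by
  rw [EuclideanSpace.norm_sq_eq, EuclideanSpace.norm_sq_eq, Finset.sum_mul_sum,
    Fintype.sum_prod_type]
  simp only [tensorVec, norm_mul, mul_pow]

/-- Phase estimation is unitary, so the error can be measured before it is undone. There the state
is the eigenvector times the amplitudes, and the error acts diagonally as `d j - z`. -/
lemma norm_sq_estimated_power_sub {X : Type} [Fintype X] [DecidableEq X] {U : Matrix X X ℂ}
    (hU : (phaseEstimation m U)ᴴ * phaseEstimation m U = 1)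
    {v : X → ℂ} {φ : ℝ} (h : U *ᵥ v = Complex.exp (Complex.I * φ) • v)
    (d : Bits (Fin m) → ℂ) (z : ℂ) :
    ‖(WithLp.toLp 2 (((phaseEstimation m U)ᴴ * ((1 : Matrix X X ℂ) ⊗ₖ diagonal d) *
      phaseEstimation m U) *ᵥ tensorVec v (Pi.single (fun _ => false) 1) -
      z • tensorVec v (Pi.single (fun _ => false) 1)) :
        EuclideanSpace ℂ (X × Bits (Fin m)))‖ ^ 2 =
      ‖(WithLp.toLp 2 v : EuclideanSpace ℂ X)‖ ^ 2 *
        ∑ j, ‖d j - z‖ ^ 2 * ‖amplitude m φ j‖ ^ 2 := by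
  set P := phaseEstimation m U with hP
  have hvec : (Pᴴ * ((1 : Matrix X X ℂ) ⊗ₖ diagonal d) * P) *ᵥ
      tensorVec v (Pi.single (fun _ => false) 1) - z • tensorVec v (Pi.single (fun _ => false) 1) =
      Pᴴ *ᵥ tensorVec v fun j => (d j - z) * amplitude m φ j := by
    have h1 : tensorVec v (Pi.single (fun _ => false) 1) =
        Pᴴ *ᵥ tensorVec v (amplitude m φ) := by
      rw [← phaseEstimation_mulVec h, Matrix.mulVec_mulVec, hU, Matrix.one_mulVec]
    rw [← Matrix.mulVec_mulVec, ← Matrix.mulVec_mulVec, phaseEstimation_mulVec h,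
      one_kronecker_mulVec_tensorVec, h1, ← Matrix.mulVec_smul, ← Matrix.mulVec_sub]
    congr 1
    ext p
    simp only [tensorVec, Pi.sub_apply, Pi.smul_apply, smul_eq_mul, mulVec_diagonal]
    ring
  have hPP : Pᴴᴴ * Pᴴ = 1 := by
    rw [conjTranspose_conjTranspose]
    exact mul_eq_one_comm.1 hU
  have hnorm := norm_toEuclideanLin_of_conjTranspose_mul_self hPP
    (WithLp.toLp 2 (tensorVec v fun j => (d j - z) * amplitude m φ j))
  rw [Matrix.toLpLin_apply] at hnorm
  rw [hvec, hnorm, norm_sq_tensorVec]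
  simp only [norm_mul, mul_pow]

lemma norm_sq_phasePower_sub {f : Bits (Fin n) → ZMod 2} {ψ : QState (Fin n)} {φ : ℝ}
    (h : act (rot f) ψ = Complex.exp (Complex.I * φ) • ψ) :
    ‖act (phasePower m f (1 / 4)) (withZeros ψ) -
      Complex.exp (Complex.I * ((φ / 4 : ℝ) : ℂ)) • withZeros ψ‖ ^ 2 =
      ‖ψ‖ ^ 2 * phaseError m φ := by
  have hv : rot f *ᵥ ψ.ofLp = Complex.exp (Complex.I * φ) • ψ.ofLp := by
    have := congrArg WithLp.ofLp h
    simpa [act, Matrix.toLpLin_apply] using this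
  have key := norm_sq_estimated_power_sub
    (phaseEstimation_conjTranspose_mul_self (m := m) f) hv
    (fun j => Complex.exp (Complex.I * (phaseValue m j : ℂ) * ((1 / 4 : ℝ) : ℂ)))
    (Complex.exp (Complex.I * ((φ / 4 : ℝ) : ℂ)))
  have herr : phaseError m φ = ∑ j, ‖Complex.exp (Complex.I * (phaseValue m j : ℂ) *
      ((1 / 4 : ℝ) : ℂ)) - Complex.exp (Complex.I * ((φ / 4 : ℝ) : ℂ))‖ ^ 2 *
        ‖amplitude m φ j‖ ^ 2 := by
    refine Finset.sum_congr rfl fun j _ => ?_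
    rw [show Complex.I * (phaseValue m j : ℂ) * ((1 / 4 : ℝ) : ℂ) =
      Complex.I * ((phaseValue m j / 4 : ℝ) : ℂ) by push_cast; ring, norm_exp_sub_exp, sub_div]
  rw [herr]
  refine Eq.trans ?_ key
  have hw : (withZeros ψ : QState (Fin n ⊕ Fin m)).ofLp =
      tensorVec ψ.ofLp (Pi.single (fun _ => false) 1) ∘
        Equiv.sumArrowEquivProdArrow (Fin n) (Fin m) Bool := by
    funext z
    simp only [withZeros, Function.comp_apply, tensorVec, Equiv.sumArrowEquivProdArrow,
      Equiv.coe_fn_mk, Pi.single_apply, funext_iff]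
    split_ifs <;> simp_all [Function.comp_def]
  rw [EuclideanSpace.norm_sq_eq, EuclideanSpace.norm_sq_eq,
    ← (Equiv.sumArrowEquivProdArrow (Fin n) (Fin m) Bool).sum_comp]
  refine Finset.sum_congr rfl fun z _ => ?_
  congr 2
  rw [PiLp.sub_apply, PiLp.smul_apply, act, Matrix.toLpLin_apply, hw, phasePower,
    Matrix.submatrix_mulVec_equiv]
  simp [Function.comp_assoc]

/-- This is where N ≥ 4 enters: it yields cos θ ≤ 1/2, hence δ ≤ 2π/3, the range allowed by the
chord bound. -/
lemma pi_div_three_le_angle (hn : 2 ≤ n) : Real.pi / 3 ≤ angle n := by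
  by_contra! hlt
  have h0 : 0 ≤ angle n := Real.arccos_nonneg _
  have h1 := Real.cos_lt_cos_of_nonneg_of_le_pi h0 (by linarith [Real.pi_pos]) hlt
  rw [Real.cos_pi_div_three, cos_angle] at h1
  have h2 : (2 : ℝ) ≤ √(2 ^ n) := by
    rw [Real.le_sqrt (by norm_num) (by positivity)]
    calc (2 : ℝ) ^ 2 ≤ 2 ^ n := pow_le_pow_right₀ (by norm_num) hn
      _ = _ := rfl
  have h3 : 1 / √(2 ^ n : ℝ) ≤ 1 / 2 := by gcongr
  linarith

/-- On each eigenvector the circuit nearly multiplies by e^{±iθ}, which is what the exact rotation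
by θ does, and that rotation takes |a⟩ to |x₀⟩. The grid is fine enough because δ ≥ 1/√N gives 2^m δ
≥ L. -/
lemma norm_phasePower_aState_sub_le (hn : 2 ≤ n) {L η : ℝ} (hη : 0 < η)
    (hL : L = 1 + 5200 / η ^ 2) (hm : L * √(2 ^ n) ≤ 2 ^ m)
    {f : Bits (Fin n) → ZMod 2} {x₀ : Bits (Fin n)} (h : Marks f x₀) :
    ‖act (phasePower m f (1 / 4)) (withZeros (aState n)) - withZeros (ket x₀)‖ ≤ η := by
  have hn1 : 1 ≤ n := by omega
  have hL1 : 1 < L := by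
    rw [hL]
    have : 0 < 5200 / η ^ 2 := by positivity
    linarith
  set δ := 2 * Real.pi - 4 * angle n with hδ
  have hδ0 : 0 ≤ δ := by linarith [pi_div_two_sub_angle_nonneg n]
  have hδ1 : δ ≤ 2 / 3 * Real.pi := by linarith [pi_div_three_le_angle hn]
  have hLδ : L ≤ 2 ^ m * δ := by
    have h1 : 1 / √(2 ^ n) ≤ δ := by
      have := one_div_sqrt_le n
      have := one_div_sqrt_pos n
      linarith
    calc L = L * √(2 ^ n) * (1 / √(2 ^ n)) := by field_simp
      _ ≤ 2 ^ m * δ := by gcongr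
  have hbound : 4 / 2 ^ m + 1296 / (L - 1) ≤ η ^ 2 / 4 := by
    have h1 : L - 1 ≤ 2 ^ m := by
      have := one_le_sqrt_two_pow n
      nlinarith
    have h2 : (4 : ℝ) / 2 ^ m ≤ 4 / (L - 1) := by
      gcongr
    -- The constant 5200 is 4 · (4 + 1296).
    have h3 : 4 / (L - 1) + 1296 / (L - 1) = η ^ 2 / 4 := by
      rw [hL]; field_simp; norm_num
    linarith
  have hE : ∀ (σ : ℂ) (φ : ℝ), star σ * σ = 1 →
      act (rot f) (eigState x₀ σ) = Complex.exp (Complex.I * φ) • eigState x₀ σ →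
      phaseError m φ ≤ η ^ 2 / 4 →
      ‖act (phasePower m f (1 / 4)) (withZeros (eigState x₀ σ)) -
        Complex.exp (Complex.I * ((φ / 4 : ℝ) : ℂ)) • withZeros (eigState x₀ σ)‖ ≤ η := by
    intro σ φ hσ hev hφ
    refine abs_le_of_sq_le_sq' ?_ hη.le |>.2
    rw [norm_sq_phasePower_sub hev, norm_sq_eigState hn1 hσ]
    nlinarith [sq_nonneg η]
  have h1 := hE Complex.I (4 * angle n) star_I_mul_I
    (by rw [rot_eq_rotBy hn1 h, act_rotBy_eigState_I hn1]) (by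
      rw [show 4 * angle n = 2 * Real.pi - δ by rw [hδ]; ring]
      exact (phaseError_two_pi_sub_le hL1 hδ0 hδ1 hLδ).trans hbound)
  have h2 := hE (-Complex.I) (-(4 * angle n)) star_neg_I_mul_neg_I
    (by rw [rot_eq_rotBy hn1 h, act_rotBy_eigState_neg_I hn1]; push_cast; rw [mul_neg]) (by
      rw [show -(4 * angle n) = δ - 2 * Real.pi by rw [hδ]; ring]
      exact (phaseError_sub_two_pi_le hL1 hδ0 hδ1 hLδ).trans hbound)
  rw [show 4 * angle n / 4 = angle n by ring] at h1
  rw [show -(4 * angle n) / 4 = -angle n by ring] at h2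
  rw [Complex.ofReal_neg, mul_neg] at h2
  have hpq : Complex.exp (Complex.I * angle n) * Complex.exp (-(Complex.I * angle n)) = 1 := by
    rw [← Complex.exp_add, add_neg_cancel, Complex.exp_zero]
  have hp : ‖Complex.exp (Complex.I * angle n)‖ = 1 := by
    rw [mul_comm, Complex.norm_exp_ofReal_mul_I]
  have hq : ‖Complex.exp (-(Complex.I * angle n))‖ = 1 := by
    rw [← star_exp_angle, norm_star, hp]
  rw [aState_eq (x₀ := x₀) hn1, ket_eq_eigState]
  simp only [withZeros_eq_toEuclideanLin, map_smul, map_add, act_map_smul, act_map_add] at h1 h2 ⊢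
  generalize Complex.exp (Complex.I * angle n) = p at *
  generalize Complex.exp (-(Complex.I * angle n)) = q at *
  generalize Matrix.toEuclideanLin (pad (Fin n) (Fin m)) (eigState x₀ Complex.I) = u at *
  generalize Matrix.toEuclideanLin (pad (Fin n) (Fin m)) (eigState x₀ (-Complex.I)) = w at *
  generalize act (phasePower m f (1 / 4)) u = u' at *
  generalize act (phasePower m f (1 / 4)) w = w' at *
  -- The coefficients of |a⟩ are inverse to the wanted phases, so its error is the half sum of the
  -- two eigenvector errors, up to factors of modulus 1.
  have hrw : (1 / 2 : ℂ) • (q • u' + p • w') - (1 / 2 : ℂ) • (u + w) =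
      (1 / 2 : ℂ) • (q • (u' - p • u) + p • (w' - q • w)) := by
    rw [smul_sub, smul_sub, smul_smul, smul_smul, hpq, mul_comm q p, hpq, one_smul, one_smul]
    module
  rw [hrw, norm_smul]
  have h3 : ‖(1 / 2 : ℂ)‖ = 1 / 2 := by norm_num
  rw [h3]
  have h4 : ‖q • (u' - p • u) + p • (w' - q • w)‖ ≤ η + η := by
    refine (norm_add_le _ _).trans ?_
    rw [norm_smul, norm_smul, hp, hq, one_mul, one_mul]
    exact add_le_add h1 h2
  linarith

end Estimation

/-! ### Assembly of the phase estimation circuit, its time, and the success probability. -/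

section Main

variable {n m : ℕ}

lemma exists_phase_search_circuit (n m : ℕ) :
    ∃ P V : Circuit n ((Fin n ⊕ Fin m) ⊕ Fin (n + m + 2)),
      queries (P ++ V) ≤ 2 ^ m * 4 ∧
      time (P ++ V) ≤ n + (2 ^ m * (16 * n + 2 * m + 17) + 2 * (m * (m + 2))) ∧
      ∀ f, Prepares P f (withZeros (aState n)) ∧ Implements V f (phasePower m f (1 / 4)) 0 := by
  obtain ⟨P, hP1, hP2, hP3⟩ := realizes_lift_hadamardOp (n := n) (Q := Fin n ⊕ Fin m) (n + m + 2)
    Function.Embedding.inl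
  obtain ⟨V, hV1, hV2, hV3⟩ :=
    realizes_phasePower (n := n) m (1 / 4) (show n + m + 1 < n + m + 2 by omega)
  refine ⟨P, V, ?_, ?_, fun f => ⟨?_, implements_of_mul_pad (hV3 f)⟩⟩
  · rw [queries_append]; omega
  · rw [time, List.length_append]
    exact add_le_add hP2 hV2
  · have h := prepares_of_mul_pad (hP3 f)
    rwa [zeroState_sum, act_withZeros (lift_inl_mul_pad _), act_hadamardOp_zeroState] at h

/-- There are O(2^m) blocks of O(n + m) gates, with 2^m = O(√N) and therefore m = O(n), all with
constants depending on L alone. -/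
lemma phase_search_time_le (hn : 1 ≤ n) {L : ℝ} (hL : 1 ≤ L)
    (hm : (2 : ℝ) ^ m ≤ 2 * (L * √(2 ^ n))) :
    ((n + (2 ^ m * (16 * n + 2 * m + 17) + 2 * (m * (m + 2))) : ℕ) : ℝ) ≤
      (2 + 4 * L * (37 + 4 * (2 * Real.log (2 * L) + 1))) *
        (√(2 ^ n) * Real.log (2 ^ n)) := by
  have hn' : (1 : ℝ) ≤ n := by exact_mod_cast hn
  have h1 := natCast_le_two_mul_log n
  have h2 := one_le_sqrt_two_pow n
  have hlogL : 0 ≤ Real.log (2 * L) := Real.log_nonneg (by linarith)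
  have hm2 : (m : ℝ) ≤ 2 ^ m := by exact_mod_cast Nat.lt_two_pow_self.le
  -- Taking logarithms in 2^m ≤ 2L√N gives m log 2 ≤ log(2L) + (n/2) log 2; the first summand is
  -- absorbed using n ≥ 1.
  have hmn : (m : ℝ) ≤ (2 * Real.log (2 * L) + 1) * n := by
    have h3 : Real.log (2 ^ m) ≤ Real.log (2 * (L * √(2 ^ n))) := Real.log_le_log (by positivity) hm
    rw [← mul_assoc, Real.log_mul (by positivity) (by positivity), Real.log_sqrt (by positivity),
      Real.log_pow, Real.log_pow] at h3
    have h4 := Real.log_two_gt_d9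
    by_contra! hlt
    have h5 : Real.log (2 * L) ≤ Real.log (2 * L) * n := le_mul_of_one_le_right hlogL hn'
    nlinarith
  set B := 2 * Real.log (2 * L) + 1 with hB
  have hB0 : 0 ≤ B := by positivity
  push_cast
  calc (n : ℝ) + (2 ^ m * (16 * n + 2 * m + 17) + 2 * (m * (m + 2)))
      ≤ n + (2 ^ m * (16 * n + 2 * m + 17) + 2 * (2 ^ m * (m + 2))) := by gcongr
    _ = n + 2 ^ m * (16 * n + 4 * m + 21) := by ring
    _ ≤ √(2 ^ n) * n + 2 * (L * √(2 ^ n)) * (16 * n + 4 * (B * n) + 21 * n) := by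
        gcongr
        · nlinarith
        · linarith
    _ = (1 + 2 * L * (37 + 4 * B)) * (√(2 ^ n) * n) := by ring
    _ ≤ (1 + 2 * L * (37 + 4 * B)) * (√(2 ^ n) * (2 * Real.log (2 ^ n))) := by gcongr
    _ = _ := by ring

lemma log_two_pow_nonneg (n : ℕ) : 0 ≤ Real.log (2 ^ n) :=
  Real.log_nonneg (one_le_pow₀ (by norm_num))

lemma sq_div_sqrt (C : ℝ) (n : ℕ) : (C / √(2 ^ n)) ^ 2 = C ^ 2 / 2 ^ n := by
  rw [div_pow, Real.sq_sqrt (by positivity)]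

lemma one_sub_sq_le_findProb_of_implements (hn : 1 ≤ n) {v : ℕ} {P V : Circuit n (Fin n ⊕ Fin v)}
    {f : Bits (Fin n) → ZMod 2} {x₀ : Bits (Fin n)} {ε : ℝ} (h : Marks f x₀)
    (hP : Prepares P f (aState n)) (hV : Implements V f (evolution f (1 / 4)) ε) :
    1 - ε ^ 2 ≤ findProb (P ++ V) Sum.inl f x₀ := by
  refine one_sub_sq_le_findProb_append (d := id) (z₀ := x₀) rfl hP ?_
  have := hV (aState n)
  rwa [norm_aState, mul_one, evolution_eq_rotBy hn h,
    show 4 * angle n * (1 / 4) = angle n by ring, act_rotBy_angle_aState hn] at this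

end Main

end QSearch

end

theorem mainTheorem7 :
    -- the two states, their angle, and the generator
    (∀ (n : ℕ) (f : Bits (Fin n) → ZMod 2) (x₀ : Bits (Fin n)), 1 ≤ n → Marks f x₀ →
      ‖aState n‖ = 1 ∧ ‖bState f‖ = 1 ∧ act (oracleOp f) (aState n) = bState f ∧
      aState n + bState f = ((2 / √(2 ^ n : ℝ) : ℝ) : ℂ) • ket x₀ ∧
      cState f = ket x₀ ∧
      inner ℂ (aState n) (bState f) = (Real.cos (2 * theta f) : ℂ) ∧
      Real.cos (2 * theta f) = (2 - 2 ^ n) / 2 ^ n ∧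
      Real.sin (2 * theta f) = 2 * √(2 ^ n - 1) / 2 ^ n ∧
      (gen f).IsHermitian ∧ evolution f 1 = rot f ∧
      act (evolution f (1 / 4)) (aState n) = ket x₀) ∧
    (∃ C : ℝ, 0 < C ∧ ∀ (n : ℕ) (f : Bits (Fin n) → ZMod 2) (x₀ : Bits (Fin n)),
      1 ≤ n → Marks f x₀ →
        |theta f - (Real.pi / 2 - 1 / √(2 ^ n))| ≤ C / 2 ^ n) ∧
    -- both states are prepared in time `O(log N)`
    (∃ C : ℝ, 0 < C ∧ ∀ n : ℕ, 1 ≤ n → ∃ (v : ℕ) (Pa Pb : Circuit n (Fin n ⊕ Fin v)),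
      (time Pa : ℝ) ≤ C * Real.log (2 ^ n) ∧ (time Pb : ℝ) ≤ C * Real.log (2 ^ n) ∧
      ∀ f : Bits (Fin n) → ZMod 2, Prepares Pa f (aState n) ∧ Prepares Pb f (bState f)) ∧
    -- method 2: any simulation of `e^{-iA/4}` finds the marked item
    (∀ (n v : ℕ) (P V : Circuit n (Fin n ⊕ Fin v)) (f : Bits (Fin n) → ZMod 2)
      (x₀ : Bits (Fin n)) (ε : ℝ), 1 ≤ n → Marks f x₀ →
        Prepares P f (aState n) → Implements V f (evolution f (1 / 4)) ε →
          1 - ε ^ 2 ≤ findProb (P ++ V) Sum.inl f x₀) ∧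
    -- method 2: the evolution under `A` is simulated to precision `O(1/√N)`
    (∃ C : ℝ, 0 < C ∧ ∀ (n : ℕ) (t : ℝ), 1 ≤ n → 0 ≤ t → t ≤ 1 →
      ∃ (v : ℕ) (V : Circuit n (Fin n ⊕ Fin v)),
        (queries V : ℝ) ≤ C * √(2 ^ n) ∧ (time V : ℝ) ≤ C * (√(2 ^ n) * Real.log (2 ^ n)) ∧
        ∀ (f : Bits (Fin n) → ZMod 2) (x₀ : Bits (Fin n)), Marks f x₀ →
          Implements V f (evolution f t) (C / √(2 ^ n))) ∧
    -- method 2: the search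
    (∃ C : ℝ, 0 < C ∧ ∀ n : ℕ, 1 ≤ n → ∃ (v : ℕ) (P V : Circuit n (Fin n ⊕ Fin v)),
      (queries (P ++ V) : ℝ) ≤ C * √(2 ^ n) ∧
      (time (P ++ V) : ℝ) ≤ C * (√(2 ^ n) * Real.log (2 ^ n)) ∧
      ∀ (f : Bits (Fin n) → ZMod 2) (x₀ : Bits (Fin n)), Marks f x₀ →
        Prepares P f (aState n) ∧
        Implements V f (evolution f (1 / 4)) (C / √(2 ^ n)) ∧
        1 - C / 2 ^ n ≤ findProb (P ++ V) Sum.inl f x₀) ∧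
    -- method 3: phase estimation with `m` bits, where `2 ^ m` is of the order of `√N`
    (∀ η : ℝ, 0 < η → ∃ L C : ℝ, 1 ≤ L ∧ 0 < C ∧ ∀ n m : ℕ, 2 ≤ n →
      L * √(2 ^ n) ≤ 2 ^ m → (2 : ℝ) ^ m ≤ 2 * (L * √(2 ^ n)) →
      ∃ (v : ℕ) (P V : Circuit n ((Fin n ⊕ Fin m) ⊕ Fin v)),
        (queries (P ++ V) : ℝ) ≤ C * √(2 ^ n) ∧
        (time (P ++ V) : ℝ) ≤ C * (√(2 ^ n) * Real.log (2 ^ n)) ∧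
        ∀ (f : Bits (Fin n) → ZMod 2) (x₀ : Bits (Fin n)), Marks f x₀ →
          Prepares P f (withZeros (aState n)) ∧
          Implements V f (phasePower m f (1 / 4)) 0 ∧
          ‖act (phasePower m f (1 / 4)) (withZeros (aState n)) - withZeros (ket x₀)‖ ≤ η ∧
          1 - η ≤ findProb (P ++ V) (fun i => Sum.inl (Sum.inl i)) f x₀) ∧
    -- method 4: `k = ⌊l⌋` rotations, where `(4l - 1)/√N = (2 · 1 - 1/2) π`
    (∃ C : ℝ, 0 < C ∧ ∀ (n : ℕ) (l : ℝ), 1 ≤ n →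
      (4 * l - 1) / √(2 ^ n) = (2 * 1 - 1 / 2) * Real.pi →
      ∃ (v : ℕ) (P V : Circuit n (Fin n ⊕ Fin v)),
        (queries (P ++ V) : ℝ) ≤ C * √(2 ^ n) ∧
        (time (P ++ V) : ℝ) ≤ C * (√(2 ^ n) * Real.log (2 ^ n)) ∧
        ∀ (f : Bits (Fin n) → ZMod 2) (x₀ : Bits (Fin n)), Marks f x₀ →
          Prepares P f (aState n) ∧
          Implements V f (rot f ^ ⌊l⌋₊) 0 ∧
          ‖act (rot f ^ ⌊l⌋₊) (aState n) - ket x₀‖ ≤ C / √(2 ^ n) ∧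
          1 - C / 2 ^ n ≤ findProb (P ++ V) Sum.inl f x₀) := by
  refine ⟨?_, ?_, ?_, ?_, ?_, ?_, ?_, ?_⟩
  · intro n f x₀ hn h
    have hθ := theta_eq_angle h
    refine ⟨norm_aState n, norm_bState h, act_oracleOp_aState f, aState_add_bState h,
      cState_eq_ket h, ?_, ?_, ?_, gen_isHermitian hn h, ?_, ?_⟩
    · rw [hθ, inner_aState_bState hn h]
    · rw [hθ, cos_two_mul_angle]
    · rw [hθ, sin_two_mul_angle]
    · rw [evolution_eq_rotBy hn h, rot_eq_rotBy hn h, mul_one]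
    · rw [evolution_eq_rotBy hn h, show 4 * angle n * (1 / 4) = angle n by ring,
        act_rotBy_angle_aState hn]
  · refine ⟨1, one_pos, fun n f x₀ _ h => ?_⟩
    rw [theta_eq_angle h]
    exact abs_angle_sub_le n
  · refine ⟨4, by norm_num, fun n hn => ?_⟩
    obtain ⟨Pa, -, ha, hPa⟩ := exists_prepares_aState n 0
    obtain ⟨Pb, hb, hPb⟩ := exists_prepares_bState n 0
    have hn' : (1 : ℝ) ≤ n := by exact_mod_cast hn
    have hlog := natCast_le_two_mul_log n
    have ha' : (time Pa : ℝ) ≤ n := by exact_mod_cast ha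
    have hb' : (time Pb : ℝ) ≤ n + 1 := by exact_mod_cast hb
    exact ⟨0, Pa, Pb, by linarith, by linarith, fun f => ⟨hPa f, hPb f⟩⟩
  · intro n v P V f x₀ ε hn h hP hV
    exact one_sub_sq_le_findProb_of_implements hn h hP hV
  · refine ⟨50, by norm_num, fun n t hn ht0 ht1 => ?_⟩
    obtain ⟨k, hk, hsim⟩ := exists_rot_pow_near_evolution hn ht0 ht1
    obtain ⟨P, V, hq, ht, -, hV⟩ := exists_prepare_and_rot_pow hn hk
    have hsqrt := one_le_sqrt_two_pow n
    rw [queries_append, Nat.cast_add] at hq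
    rw [time, List.length_append, Nat.cast_add] at ht
    refine ⟨n + 1, V, ?_, le_trans ?_ ht, fun f x₀ h => ?_⟩
    · have : (0 : ℝ) ≤ queries P := Nat.cast_nonneg _
      linarith
    · exact le_add_of_nonneg_left (Nat.cast_nonneg _)
    · refine implements_of_norm_sub_le (hV f) fun ψ => (hsim f x₀ h ψ).trans ?_
      gcongr
      norm_num
  -- 256 = 16², the square of the constant of the simulation error.
  · refine ⟨256, by norm_num, fun n hn => ?_⟩
    obtain ⟨k, hk, hsim⟩ := exists_rot_pow_near_evolution hn (t := 1 / 4) (by norm_num)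
      (by norm_num)
    obtain ⟨P, V, hq, ht, hP, hV⟩ := exists_prepare_and_rot_pow hn hk
    have hsqrt := one_le_sqrt_two_pow n
    have hlog := log_two_pow_nonneg n
    refine ⟨n + 1, P, V, by linarith, ht.trans ?_, fun f x₀ h => ?_⟩
    · gcongr
      norm_num
    have himp := implements_of_norm_sub_le (hV f) (hsim f x₀ h)
    refine ⟨hP f, fun ψ => (himp ψ).trans ?_, ?_⟩
    · gcongr
      norm_num
    · have := one_sub_sq_le_findProb_of_implements hn h (hP f) himp
      rw [sq_div_sqrt] at this
      norm_num at this ⊢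
      exact this
  · intro η hη
    -- Norm error η₀ ≤ 1 gives success probability at least 1 - η₀² ≥ 1 - η₀ ≥ 1 - η, so large η are
    -- truncated at 1.
    have hη0 : 0 < min η 1 := lt_min hη one_pos
    set η₀ := min η 1 with hη₀
    have hL1 : 1 ≤ 1 + 5200 / η₀ ^ 2 := le_add_of_nonneg_right (by positivity)
    set L := 1 + 5200 / η₀ ^ 2 with hL
    have hlogL : 0 ≤ Real.log (2 * L) := Real.log_nonneg (by linarith)
    set K := 2 + 4 * L * (37 + 4 * (2 * Real.log (2 * L) + 1)) with hK
    have hK0 : 0 ≤ K := by positivity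
    -- The summand 8L bounds the queries, at most 4 · 2^m ≤ 8L√N, and K bounds the time.
    refine ⟨L, 8 * L + K, hL1, by linarith, fun n m hn hm1 hm2 => ?_⟩
    obtain ⟨P, V, hq, ht, hPV⟩ := exists_phase_search_circuit n m
    have hlog := log_two_pow_nonneg n
    refine ⟨n + m + 2, P, V, ?_, ?_, fun f x₀ h => ?_⟩
    · have hq' : (queries (P ++ V) : ℝ) ≤ 2 ^ m * 4 := by exact_mod_cast hq
      have : 0 ≤ K * √(2 ^ n) := by positivity
      nlinarith
    · have ht' := (Nat.cast_le (α := ℝ).2 ht).trans (phase_search_time_le (by omega) hL1 hm2)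
      exact ht'.trans (mul_le_mul_of_nonneg_right (by linarith) (by positivity))
    · have hnorm := norm_phasePower_aState_sub_le hn hη0 hL hm1 h
      obtain ⟨hP, hV⟩ := hPV f
      refine ⟨hP, hV, hnorm.trans (min_le_left _ _), ?_⟩
      have hfind := one_sub_sq_le_findProb_append (d := Sum.inl) (x₀ := x₀)
        (z₀ := Sum.elim x₀ fun _ => false) (V := V) (ε := η₀) rfl hP (by
          have hV' := hV (withZeros (aState n))
          rw [zero_mul, norm_le_zero_iff, sub_eq_zero] at hV'
          rw [hV', norm_withZeros_sub, ← withZeros_ket]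
          exact hnorm)
      refine le_trans ?_ hfind
      have h1 : η₀ ≤ η := min_le_left _ _
      have h2 : η₀ ≤ 1 := min_le_right _ _
      nlinarith
  -- 324 = 18², the square of the constant of the norm error.
  · refine ⟨324, by norm_num, fun n l hn hl => ?_⟩
    obtain ⟨P, V, hq, ht, hP, hV⟩ := exists_prepare_and_rot_pow hn (floor_le_of_eq n hl)
    have hsqrt := one_le_sqrt_two_pow n
    have hlog := log_two_pow_nonneg n
    refine ⟨n + 1, P, V, by linarith, ht.trans ?_, fun f x₀ h => ?_⟩
    · gcongr
      norm_num
    have hnorm := norm_rot_pow_floor_sub_le hn hl h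
    refine ⟨hP f, implements_of_mul_pad (hV f), hnorm.trans ?_, ?_⟩
    · gcongr
      norm_num
    · have hfind := one_sub_sq_le_findProb_append (d := id) (x₀ := x₀) (z₀ := x₀) (V := V)
        (ε := 18 / √(2 ^ n)) rfl (hP f) (by
          rw [act_withZeros (hV f), norm_withZeros_sub]
          exact hnorm)
      rw [sq_div_sqrt] at hfind
      norm_num at hfind ⊢
      exact hfind
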